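/- **Setting.** Let $\mathbb X=\{1,2,3,\dots\}$ with the hierarchical distance $d(i,j)=\min\{n\ge 0:\ i,j\in(k2^n,(k+1)2^n]\text{ for some integer }k\ge 0\}$, let $\Lambda_n=\{1,\dots,2^n\}$ and $\widetilde\Lambda_n=\Lambda_n\cup\{\delta\}$. Let $\overline W>0$ and $\rho>1$, and assume that the spectral dimension $d_s=2\ln 2/\ln\rho$ equals $2$ (that is, $\rho=2$). At inverse temperature $w$ the weights on $\widetilde\Lambda_n$ are $W_{ij}=w(2\rho)^{-d(i,j)}$ for $i\ne j$ in $\Lambda_n$, $W_{i\delta}=w\,\rho^{-n}/(2(\rho-1))$, and $W_{ii}=0$. The $H^{2|2}$-model on a finite weighted graph $(V,W)$ is the law $$\Big(\tfrac2\pi\Big)^{|V|/2}\mathbf 1_{\{H_\beta>0\}}\,e^{-\frac12\langle 1,H_\beta 1\rangle}\frac{1}{\sqrt{\det H_\beta}}\prod_{i\in V}d\beta_i$$ on $\mathbb R^V$, where $H_\beta$ is the matrix with diagonal entries $2\beta_i$ and off-diagonal entries $-W_{ij}$. A *fine-graining coupling* is a sequence of random vectors $\widetilde\beta^{(n)}=(\widetilde\beta^{(n)}_i)_{i\in\widetilde\Lambda_n}$,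 $n\ge0$, on one probability space, such that $\widetilde\beta^{(n)}$ is the $H^{2|2}$-model on $\widetilde\Lambda_n$ at inverse temperature $\overline W(\rho/2)^n$ ($=\overline W$), and such that almost surely, for every $n$, $\widetilde\beta^{(n)}$ is the coarse-graining of $\widetilde\beta^{(n+1)}$: $\widetilde\beta^{(n)}_\delta=\widetilde\beta^{(n+1)}_\delta$ and $$\frac1{2\widetilde\beta^{(n)}_k}=\frac14\cdot\frac{2\beta_{2k-1}+2\beta_{2k}+2W_{2k-1,2k}}{4\beta_{2k-1}\beta_{2k}-W_{2k-1,2k}^2},\qquad k\in\Lambda_n,$$ with $\beta=\widetilde\beta^{(n+1)}$ and $W$ the weights at level $n+1$. With $\widetilde G^{(n)}=(H_{\widetilde\beta^{(n)}})^{-1}$ put $e^{\widetilde u^{(n)}_i}=\widetilde G^{(n)}(i,\delta)/\widetilde G^{(n)}(\delta,\delta)$ for $i\in\Lambda_n$, and $e^{\widetilde u^{(n)}_i}=1$ for $i\in\mathbb X\setminus\Lambda_n$. For $x\in[0,1)$ let $\varphi^{(n)}_x=e^{\widetilde u^{(n)}_i}$ for the $i$ with $x\in[\frac{i-1}{2^n},\frac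 i{2^n})$, and let $\varphi_x=\limsup_n\varphi^{(n)}_x\in[0,\infty]$. **Statement.** A fine-graining coupling exists, and every fine-graining coupling has the following properties. 1. (Stationarity at each level.) For every $n$, the laws of $(\widetilde\beta^{(n)}_i)_{i\in\Lambda_n}$ and of $(e^{\widetilde u^{(n)}_i})_{i\in\Lambda_n}$ are invariant under all distance-preserving permutations of $\Lambda_n$. 2. (The $\widetilde\beta$-field on $\mathbb X$.) There is a probability measure on $\mathbb R^{\mathbb X}$ whose marginal on $\mathbb R^{\Lambda_n}$ is, for every $n$, the law of $(\widetilde\beta^{(n)}_i)_{i\in\Lambda_n}$. It is invariant and ergodic for the group of all distance-preserving bijections of $\mathbb X$, and already for the subgroup generated by the maps $g_n$, $n\ge1$, where $g_n$ exchanges $[1,2^n]$ with $[2^n+1,2^{n+1}]$ by translation. 3. (The $\widetilde u$-field on $\mathbb X$.) The random elements $(e^{\widetilde u^{(n)}_i})_{i\in\mathbb X}$ of $\mathbb R^{\mathbb X}$ converge in distribution as $n\to\infty$, and the limit law is invariant and ergodic for the same two groups. 4. For every $x\in[0,1)$, almost surely $\varphi^{(n)}_x$ converges to $\varphi_x$,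 and $\varphi_x<\infty$. 5. (Zero-one law.) The sets $\{\varphi_x=0\text{ for all }x\in[0,1)\}$ and $\{\varphi_x>0\text{ for all }x\in[0,1)\}$ are measurable with respect to the completed probability, and each of them has probability $0$ or $1$. Moreover, either for every $x\in[0,1)$ almost surely $\varphi_x=0$, or for every $x\in[0,1)$ almost surely $\varphi_x>0$. -/

import Mathlib

open MeasureTheory Filter Topology
open scoped ENNReal

noncomputable section

/-! ### The `H^{2|2}`-model on a finite weighted graph -/

/-- The Schrödinger matrix `H_β`: diagonal entries `2 β_i`, off-diagonal entries `-W_{ij}`. -/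
def schrodinger {V : Type*} [DecidableEq V] (W : V → V → ℝ) (β : V → ℝ) : Matrix V V ℝ :=
  Matrix.of fun i j => if i = j then 2 * β i else -W i j

/-- The law of the random potential of the `H^{2|2}`-model on a finite weighted graph, given by its
density `(2/π)^{|V|/2} 1_{H_β > 0} exp(-⟨1, H_β 1⟩ / 2) / √(det H_β)` with respect to `∏ dβ_i`. -/
def H22Law {V : Type*} [Fintype V] [DecidableEq V] (W : V → V → ℝ) : Measure (V → ℝ) :=
  (volume : Measure (V → ℝ)).withDensity
    (Set.indicator {β | (schrodinger W β).PosDef} fun β =>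
      ENNReal.ofReal (Real.sqrt (2 / Real.pi) ^ Fintype.card V
        * Real.exp (-(1 / 2) * ∑ i, ∑ j, schrodinger W β i j)
        / Real.sqrt (schrodinger W β).det))

/-- The exponential `e^{u_i} = G(i, i₀) / G(i₀, i₀)` of the `u`-field pinned at `i₀`, where
`G = H_β⁻¹` is the Green matrix. -/
def expUField {V : Type*} [Fintype V] [DecidableEq V] (W : V → V → ℝ) (i₀ : V) (β : V → ℝ)
    (i : V) : ℝ :=
  (schrodinger W β)⁻¹ i i₀ / (schrodinger W β)⁻¹ i₀ i₀

/-- The potential `β'` at the vertex obtained by merging two vertices with potentials `b₁`, `b₂`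
joined by an edge of weight `w`; it is given by
`1 / (2 β') = (1/4) (2 b₁ + 2 b₂ + 2 w) / (4 b₁ b₂ - w ^ 2)`. -/
def mergedPotential (w b₁ b₂ : ℝ) : ℝ :=
  1 / (2 * ((1 / 4) * ((2 * b₁ + 2 * b₂ + 2 * w) / (4 * b₁ * b₂ - w ^ 2))))

/-! ### The Dyson hierarchical lattice

The lattice `{1, 2, 3, …}` is indexed here from `0`: the natural number `i` stands for the vertex
`i + 1`. The ball `Λ_n` is then `{0, …, 2 ^ n - 1}`, the blocks of size `2 ^ n` are the sets
`{i | i / 2 ^ n = k}`, and the vertex `i` is split into `2 * i` and `2 * i + 1`. -/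

/-- The hierarchical distance: the least `n` such that `i` and `j` are in the same block of size
`2 ^ n`. -/
def hierDist (i j : ℕ) : ℕ := sInf {n | i / 2 ^ n = j / 2 ^ n}

/-- The spectral dimension of the hierarchical lattice with parameter `ρ`. -/
def spectralDimension (ρ : ℝ) : ℝ := 2 * (Real.log 2 / Real.log ρ)

/-- `Λ_n` together with the additional boundary vertex `δ_n = none`. -/
abbrev Vertex (n : ℕ) : Type := Option (Fin (2 ^ n))

/-- The edge weights on `Λ_n ∪ {δ_n}` at inverse temperature `w`: `w (2 ρ)^{-d(i, j)}` inside `Λ_n`,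
and `w ρ^{-n} / (2 (ρ - 1))` (the sum of `w (2 ρ)^{-d(i, j)}` over all `j` outside `Λ_n`)
between a vertex of `Λ_n` and `δ_n`. -/
def wiredWeight (ρ w : ℝ) (n : ℕ) : Vertex n → Vertex n → ℝ
  | some i, some j => if i = j then 0 else w * ((2 * ρ) ^ hierDist i j)⁻¹
  | some _, none => w * ((ρ ^ n)⁻¹ / (2 * (ρ - 1)))
  | none, some _ => w * ((ρ ^ n)⁻¹ / (2 * (ρ - 1)))
  | none, none => 0

/-- The left child `2 i` of the vertex `i`. -/
def leftChild {n : ℕ} (i : Fin (2 ^ n)) : Fin (2 ^ (n + 1)) :=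
  ⟨2 * i, by have := i.isLt; rw [pow_succ]; omega⟩

/-- The right child `2 i + 1` of the vertex `i`. -/
def rightChild {n : ℕ} (i : Fin (2 ^ n)) : Fin (2 ^ (n + 1)) :=
  ⟨2 * i + 1, by have := i.isLt; rw [pow_succ]; omega⟩

/-- Coarse-graining of a potential on `Λ_{n+1} ∪ {δ}`, at inverse temperature `w`, to a potential on
`Λ_n ∪ {δ}`: every pair of siblings is merged, the potential at `δ` is kept. -/
def coarseGrain (ρ w : ℝ) (n : ℕ) (β : Vertex (n + 1) → ℝ) : Vertex n → ℝ
  | some i => mergedPotential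
      (wiredWeight ρ w (n + 1) (some (leftChild i)) (some (rightChild i)))
      (β (some (leftChild i))) (β (some (rightChild i)))
  | none => β none

/-- The inverse temperature at level `n` of the fine-graining coupling that starts at `Wbar`. -/
def levelTemperature (ρ Wbar : ℝ) (n : ℕ) : ℝ := Wbar * (ρ / 2) ^ n

/-- The edge weights at level `n` of the fine-graining coupling. -/
def levelWeight (ρ Wbar : ℝ) (n : ℕ) : Vertex n → Vertex n → ℝ :=
  wiredWeight ρ (levelTemperature ρ Wbar n) n

/-- The fine-graining coupling: the potentials `β n` of `H^{2|2}`-models on `Λ_n ∪ {δ}`, `n ≥ 0`,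
on one probability space, where every level is the coarse-graining of the next one. As level `n` is
a function of level `n + 1`, this determines the joint law of all levels: conditionally on the
levels `0, …, n`, level `n + 1` is distributed as the `H^{2|2}`-model on `Λ_{n+1} ∪ {δ}`
conditioned on its coarse-graining being `β n`. -/
structure IsFineGrainingCoupling {Ω : Type*} [MeasurableSpace Ω] (P : Measure Ω) (ρ Wbar : ℝ)
    (β : (n : ℕ) → Ω → Vertex n → ℝ) : Prop where
  measurable : ∀ n, Measurable (β n)
  law : ∀ n, P.map (β n) = H22Law (levelWeight ρ Wbar n)
  coarse : ∀ n, ∀ᵐ ω ∂P,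
    coarseGrain ρ (levelTemperature ρ Wbar (n + 1)) n (β (n + 1) ω) = β n ω

/-- The potential `(β_i)_{i ∈ Λ_n}` at level `n`, without the boundary vertex. -/
def betaLevel {Ω : Type*} (β : (n : ℕ) → Ω → Vertex n → ℝ) (n : ℕ) (ω : Ω) (i : Fin (2 ^ n)) : ℝ :=
  β n ω (some i)

/-- The field `(e^{u_i})_{i ∈ Λ_n}` at level `n`, pinned at the boundary vertex. -/
def expULevel {Ω : Type*} (ρ Wbar : ℝ) (β : (n : ℕ) → Ω → Vertex n → ℝ) (n : ℕ) (ω : Ω)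
    (i : Fin (2 ^ n)) : ℝ :=
  expUField (levelWeight ρ Wbar n) none (β n ω) (some i)

/-- The field `e^{u}` at level `n`, extended by `1` outside `Λ_n` to the whole lattice. -/
def expULattice {Ω : Type*} (ρ Wbar : ℝ) (β : (n : ℕ) → Ω → Vertex n → ℝ) (n : ℕ) (ω : Ω)
    (i : ℕ) : ℝ :=
  if h : i < 2 ^ n then expULevel ρ Wbar β n ω ⟨i, h⟩ else 1

/-- `φ^{(n)}_x`: the value of `e^{u}` at level `n` at the vertex whose dyadic interval
`[i / 2 ^ n, (i + 1) / 2 ^ n)` contains `x ∈ [0, 1)`. -/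
def phiLevel {Ω : Type*} (ρ Wbar : ℝ) (β : (n : ℕ) → Ω → Vertex n → ℝ) (n : ℕ) (x : ℝ) (ω : Ω) :
    ℝ :=
  expULattice ρ Wbar β n ω ⌊2 ^ n * x⌋₊

/-- The limit `φ_x` of `φ^{(n)}_x`, as an everywhere defined function (upper limit in `[0, ∞]`). -/
def phi {Ω : Type*} (ρ Wbar : ℝ) (β : (n : ℕ) → Ω → Vertex n → ℝ) (x : ℝ) (ω : Ω) : ℝ≥0∞ :=
  limsup (fun n => ENNReal.ofReal (phiLevel ρ Wbar β n x ω)) atTop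

/-! ### Automorphisms -/

/-- The group of all automorphisms (distance preserving bijections) of the hierarchical lattice. -/
def hierAut : Subgroup (Equiv.Perm ℕ) where
  carrier := {g | ∀ i j, hierDist (g i) (g j) = hierDist i j}
  one_mem' := fun _ _ => rfl
  mul_mem' := fun {a b} ha hb i j => by
    simpa [Equiv.Perm.mul_apply] using (ha (b i) (b j)).trans (hb i j)
  inv_mem' := fun {a} ha i j => by
    simpa using (ha (a⁻¹ i) (a⁻¹ j)).symm

/-- The exchange of the blocks `{0, …, 2 ^ n - 1}` and `{2 ^ n, …, 2 ^ (n + 1) - 1}` by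
translation. -/
def blockSwap (n : ℕ) : Equiv.Perm ℕ :=
  Function.Involutive.toPerm
    (fun i => if i < 2 ^ n then i + 2 ^ n else if i < 2 ^ (n + 1) then i - 2 ^ n else i) (by
      intro i
      have h : 2 ^ (n + 1) = 2 * 2 ^ n := by rw [pow_succ, mul_comm]
      dsimp only
      split_ifs <;> omega)

/-- The group of automorphisms generated by the block exchanges `g_n`, `n ≥ 1`. -/
def blockSwapGroup : Subgroup (Equiv.Perm ℕ) :=
  Subgroup.closure {g | ∃ n : ℕ, 1 ≤ n ∧ g = blockSwap n}

/-- A random field on the lattice with law `μ` is stationary and ergodic for the group of all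
automorphisms, and already for the subgroup generated by the block exchanges. The automorphism
`g` acts on a configuration `f` by `f ∘ g`. -/
structure IsStationaryErgodic (μ : Measure (ℕ → ℝ)) : Prop where
  ergodic_aut : ErgodicSMul (hierAut)ᵈᵐᵃ (ℕ → ℝ) μ
  ergodic_blockSwap : ErgodicSMul (blockSwapGroup)ᵈᵐᵃ (ℕ → ℝ) μ

end

set_option linter.unusedSectionVars false

namespace H22

/-! ### Scalar integrals -/

/-! Since `ρ = 2`, all levels have the same inverse temperature `w`, and every vertex has total
weight `w / 2` to the rest of the infinite lattice. The basic computation is that removing one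
vertex from an `H^{2|2}`-model with a boundary term `η` amounts to an inverse Gaussian integral and
leaves an `H^{2|2}`-model whose boundary term has absorbed the lost weights (`map_comp_h22Eta`). On
the lattice the absorbed term depends only on distances inside the remaining set. The levels of a
coupling, without `δ`, therefore have the laws of the restrictions of one automorphism-invariant law
`latticeLaw`.

Ergodicity comes from asymptotic independence. A ball and its image under a far block exchange are
joined by weights that tend to zero, so the joint density converges to a product and Fatou's lemma
gives the lower bound `mul_le_liminf_latticeLaw`. Used for an event and its complement, this bound
is enough for the abstract zero-one law `zero_or_one_of_mixing`.

Under `latticeLaw` the field `H⁻¹ η` on growing balls is a nonnegative supermartingale: raising `η`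
at one vertex commutes with restriction, and differentiating the density ratio at zero compares the
means (`setLIntegral_field_le`). The limit is an equivariant function of the potential, hence
stationary and ergodic. By the field equation it almost surely vanishes everywhere or nowhere, and
ergodicity makes this alternative deterministic.

In the coupling one moves to finer levels instead. A change of basis separates the merged matrix
from the sibling differences, and merging becomes a harmonic mean in suitable variables; this shows
that coarse-graining preserves the model (`map_coarseGrain`), and conditional laws then produce a
coupling. The fields at two siblings are the field at the parent times ratios with sum `2`, and they
are exchangeable given the coarser level. So the field is a martingale along every branch and `φ_x`
exists. At each single level its law is that of the lattice field at vertex `0`, which transfers the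
deterministic alternative to every fixed `x`.

The two events that involve all `x` need separate arguments. Always moving to a child with a field
not smaller than its parent's gives a branch with a positive limit, so the all-zero event is null
(`IsMergingFamily.ae_exists_pos`). The all-positive event is null measurable because its complement
is the projection of a measurable set. Up to a null set it coincides with the same event for any
subtree, and the subtrees of two vertices in different halves become asymptotically independent
(`IsMergingFamily.positiveTrees_zero_or_one`). -/

lemma lintegral_exp_neg_half_sq :
    ∫⁻ y : ℝ, ENNReal.ofReal (Real.exp (-(y ^ 2) / 2)) = ENNReal.ofReal (√(2 * Real.pi)) := by
  have h : ∀ y : ℝ, Real.exp (-(y ^ 2) / 2) = Real.exp (-(1 / 2) * y ^ 2) := fun y => by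
    congr 1; ring
  simp_rw [h]
  rw [← ofReal_integral_eq_lintegral_ofReal (integrable_exp_neg_mul_sq (by norm_num))
    (ae_of_all _ fun y => (Real.exp_pos _).le), integral_gaussian]
  congr 2; field_simp

lemma lintegral_Ioi_exp_neg_half_sq :
    ∫⁻ y in Set.Ioi (0 : ℝ), ENNReal.ofReal (Real.exp (-(y ^ 2) / 2))
      = ENNReal.ofReal (√(2 * Real.pi) / 2) := by
  have h : ∀ y : ℝ, Real.exp (-(y ^ 2) / 2) = Real.exp (-(1 / 2) * y ^ 2) := fun y => by
    congr 1; ring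
  simp_rw [h]
  rw [← ofReal_integral_eq_lintegral_ofReal
    (integrable_exp_neg_mul_sq (by norm_num)).integrableOn
    (ae_of_all _ fun y => (Real.exp_pos _).le), integral_gaussian_Ioi]
  congr 3; field_simp

/-- The substitution `y = √z - a / √z` carries this part. For `a > 0` it maps the half-line
bijectively onto the line, and `y² = z - 2a + a²/z` turns a Gaussian into an inverse Gaussian
weight. -/
lemma hasDerivAt_sqrt_sub_div {a z : ℝ} (hz : 0 < z) :
    HasDerivAt (fun z => √z - a / √z) ((1 / √z + a / (z * √z)) / 2) z := by
  have hs : 0 < √z := Real.sqrt_pos.2 hz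
  have h1 := Real.hasDerivAt_sqrt hz.ne'
  refine (h1.sub ((hasDerivAt_const z a).div h1 hs.ne')).congr_deriv ?_
  have h2 : √z * √z = z := Real.mul_self_sqrt hz.le
  rw [div_add_div _ _ hs.ne' (by positivity), ← h2, Real.sqrt_mul_self hs.le]
  field_simp
  ring

lemma image_sqrt_sub_div {a : ℝ} (ha : 0 < a) :
    (fun z => √z - a / √z) '' Set.Ioi 0 = Set.univ := by
  refine Set.eq_univ_of_forall fun y => ?_
  have h0 : 0 < y ^ 2 + 4 * a := by positivity
  have hr : 0 < (y + √(y ^ 2 + 4 * a)) / 2 := by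
    have : |y| < √(y ^ 2 + 4 * a) := by
      rw [← Real.sqrt_sq_eq_abs]; exact Real.sqrt_lt_sqrt (sq_nonneg y) (by linarith)
    have := neg_abs_le y
    linarith
  -- The square of the positive root of `r² - y r - a = 0`, where `r = √z`.
  refine ⟨((y + √(y ^ 2 + 4 * a)) / 2) ^ 2, Set.mem_Ioi.2 (by positivity), ?_⟩
  beta_reduce
  rw [Real.sqrt_sq hr.le]
  rw [sub_eq_iff_eq_add, ← sub_eq_iff_eq_add', eq_div_iff hr.ne']
  have := Real.sq_sqrt h0.le
  nlinarith

lemma injOn_sqrt_sub_div {a : ℝ} (ha : 0 ≤ a) :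
    Set.InjOn (fun z => √z - a / √z) (Set.Ioi 0) := by
  refine StrictMonoOn.injOn fun x hx y hy hxy => ?_
  have hx' : 0 < √x := Real.sqrt_pos.2 hx
  have h1 : √x < √y := Real.sqrt_lt_sqrt (le_of_lt hx) hxy
  have h2 : a / √y ≤ a / √x := div_le_div_of_nonneg_left ha hx' h1.le
  linarith

lemma exp_sqrt_sub_div {a z : ℝ} (hz : 0 < z) :
    Real.exp (-((√z - a / √z) ^ 2) / 2) = Real.exp a * Real.exp (-(z + a ^ 2 / z) / 2) := by
  have hs : 0 < √z := Real.sqrt_pos.2 hz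
  have h2 : √z ^ 2 = z := Real.sq_sqrt hz.le
  rw [← Real.exp_add]
  congr 1
  have : (√z - a / √z) ^ 2 = z - 2 * a + a ^ 2 / z := by
    rw [sub_sq, div_pow, h2]; field_simp
  rw [this]; ring

/-- The two summands are those of the Jacobian of the substitution, so only their sum is evaluated
directly. The sum itself reappears when two siblings are merged. -/
lemma lintegral_inv_sqrt_add {a : ℝ} (ha : 0 < a) :
    ∫⁻ z in Set.Ioi (0 : ℝ),
      ENNReal.ofReal ((1 / √z + a / (z * √z)) * Real.exp (-(z + a ^ 2 / z) / 2))
      = ENNReal.ofReal (2 * √(2 * Real.pi) * Real.exp (-a)) := by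
  have key := lintegral_image_eq_lintegral_abs_deriv_mul measurableSet_Ioi
    (fun z hz => (hasDerivAt_sqrt_sub_div (a := a) hz).hasDerivWithinAt)
    (injOn_sqrt_sub_div ha.le) (fun y => ENNReal.ofReal (2 * Real.exp (-a) *
      Real.exp (-(y ^ 2) / 2)))
  rw [image_sqrt_sub_div ha, setLIntegral_univ] at key
  have hL : ∫⁻ y : ℝ, ENNReal.ofReal (2 * Real.exp (-a) * Real.exp (-(y ^ 2) / 2))
      = ENNReal.ofReal (2 * √(2 * Real.pi) * Real.exp (-a)) := by
    simp_rw [ENNReal.ofReal_mul (show 0 ≤ 2 * Real.exp (-a) by positivity)]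
    rw [lintegral_const_mul' _ _ ENNReal.ofReal_ne_top, lintegral_exp_neg_half_sq,
      ← ENNReal.ofReal_mul (by positivity)]
    congr 1; ring
  rw [← hL, key]
  refine setLIntegral_congr_fun measurableSet_Ioi fun z (hz : 0 < z) => ?_
  have hs : 0 < √z := Real.sqrt_pos.2 hz
  rw [← ENNReal.ofReal_mul (abs_nonneg _), abs_of_nonneg (by positivity), exp_sqrt_sub_div hz]
  congr 1
  have : Real.exp (-a) * Real.exp a = 1 := by rw [← Real.exp_add]; simp
  linear_combination (-(1 / √z + a / (z * √z)) * Real.exp (-(z + a ^ 2 / z) / 2)) * this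

lemma lintegral_inv_sqrt_zero :
    ∫⁻ z in Set.Ioi (0 : ℝ), ENNReal.ofReal (1 / √z * Real.exp (-z / 2))
      = ENNReal.ofReal (√(2 * Real.pi)) := by
  have key := lintegral_image_eq_lintegral_abs_deriv_mul measurableSet_Ioi
    (fun z hz => (hasDerivAt_sqrt_sub_div (a := 0) hz).hasDerivWithinAt)
    (injOn_sqrt_sub_div le_rfl) (fun y => ENNReal.ofReal (2 * Real.exp (-(y ^ 2) / 2)))
  have him : (fun z => √z - 0 / √z) '' Set.Ioi 0 = Set.Ioi 0 := by
    ext y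
    simp only [zero_div, sub_zero, Set.mem_image, Set.mem_Ioi]
    exact ⟨fun ⟨z, hz, h⟩ => h ▸ Real.sqrt_pos.2 hz,
      fun hy => ⟨y ^ 2, by positivity, Real.sqrt_sq hy.le⟩⟩
  have hL : ∫⁻ y in Set.Ioi (0 : ℝ), ENNReal.ofReal (2 * Real.exp (-(y ^ 2) / 2))
      = ENNReal.ofReal (√(2 * Real.pi)) := by
    simp_rw [ENNReal.ofReal_mul (show (0 : ℝ) ≤ 2 by norm_num)]
    rw [lintegral_const_mul' _ _ ENNReal.ofReal_ne_top, lintegral_Ioi_exp_neg_half_sq,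
      ← ENNReal.ofReal_mul (by positivity)]
    congr 1; ring
  rw [him, hL] at key
  rw [key]
  refine setLIntegral_congr_fun measurableSet_Ioi fun z (hz : 0 < z) => ?_
  have hs : 0 < √z := Real.sqrt_pos.2 hz
  rw [← ENNReal.ofReal_mul (abs_nonneg _), abs_of_nonneg (by positivity), exp_sqrt_sub_div hz]
  congr 1
  simp
  ring

/-- Total mass of the (unnormalised) inverse Gaussian density. -/
theorem lintegral_inverse_gaussian {a : ℝ} (ha : 0 ≤ a) :
    ∫⁻ s in Set.Ioi (0 : ℝ), ENNReal.ofReal (1 / √s * Real.exp (-(s + a ^ 2 / s) / 2))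
      = ENNReal.ofReal (√(2 * Real.pi) * Real.exp (-a)) := by
  rcases ha.eq_or_lt with rfl | ha
  · simpa using lintegral_inv_sqrt_zero
  -- The involution `z ↦ a² / z` exchanges the two summands of `lintegral_inv_sqrt_add`, so each has
  -- half of the total integral.
  have hinj : Set.InjOn (fun z : ℝ => a ^ 2 / z) (Set.Ioi 0) := fun x hx y hy h => by
    have hx' : 0 < x := hx
    have hy' : 0 < y := hy
    have h' : a ^ 2 / x = a ^ 2 / y := h
    rw [div_eq_div_iff hx'.ne' hy'.ne'] at h'
    exact (mul_left_cancel₀ (by positivity) h').symm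
  have hder : ∀ z ∈ Set.Ioi (0 : ℝ),
      HasDerivWithinAt (fun z : ℝ => a ^ 2 / z) (-(a ^ 2) / z ^ 2) (Set.Ioi 0) z := fun z hz => by
    have hz' : 0 < z := hz
    refine (((hasDerivAt_const z (a ^ 2)).div (hasDerivAt_id z) hz'.ne').congr_deriv
      ?_).hasDerivWithinAt
    simp
  have him : (fun z : ℝ => a ^ 2 / z) '' Set.Ioi 0 = Set.Ioi 0 := by
    ext y
    simp only [Set.mem_image, Set.mem_Ioi]
    refine ⟨fun ⟨z, hz, h⟩ => h ▸ by positivity, fun hy => ⟨a ^ 2 / y, by positivity, ?_⟩⟩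
    field_simp
  have key := lintegral_image_eq_lintegral_abs_deriv_mul measurableSet_Ioi hder hinj
    (fun s => ENNReal.ofReal (1 / √s * Real.exp (-(s + a ^ 2 / s) / 2)))
  rw [him] at key
  have h2 : ∫⁻ z in Set.Ioi (0 : ℝ), ENNReal.ofReal |(-(a ^ 2) / z ^ 2)| *
        ENNReal.ofReal (1 / √(a ^ 2 / z) * Real.exp (-(a ^ 2 / z + a ^ 2 / (a ^ 2 / z)) / 2))
      = ∫⁻ z in Set.Ioi (0 : ℝ),
        ENNReal.ofReal (a / (z * √z) * Real.exp (-(z + a ^ 2 / z) / 2)) := by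
    refine setLIntegral_congr_fun measurableSet_Ioi fun z (hz : 0 < z) => ?_
    have hs : 0 < √z := Real.sqrt_pos.2 hz
    have h3 : √z * √z = z := Real.mul_self_sqrt hz.le
    rw [← ENNReal.ofReal_mul (abs_nonneg _), neg_div, abs_neg, abs_of_nonneg (by positivity),
      Real.sqrt_div (by positivity), Real.sqrt_sq ha.le, div_div_cancel₀ (by positivity),
      add_comm (a ^ 2 / z) z, ← mul_assoc]
    congr 2
    rw [div_mul_div_comm, div_eq_div_iff (by positivity) (by positivity)]
    field_simp
    linear_combination h3
  have h4 := lintegral_inv_sqrt_add ha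
  have h5 : ∫⁻ z in Set.Ioi (0 : ℝ),
      ENNReal.ofReal ((1 / √z + a / (z * √z)) * Real.exp (-(z + a ^ 2 / z) / 2))
      = (∫⁻ s in Set.Ioi (0 : ℝ), ENNReal.ofReal (1 / √s * Real.exp (-(s + a ^ 2 / s) / 2)))
      + ∫⁻ z in Set.Ioi (0 : ℝ),
        ENNReal.ofReal (a / (z * √z) * Real.exp (-(z + a ^ 2 / z) / 2)) := by
    rw [← lintegral_add_left (by fun_prop)]
    refine setLIntegral_congr_fun measurableSet_Ioi fun z (hz : 0 < z) => ?_
    have hs : 0 < √z := Real.sqrt_pos.2 hz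
    rw [← ENNReal.ofReal_add (by positivity) (by positivity), add_mul]
  rw [← h2, ← key, ← two_mul, h4, show 2 * √(2 * Real.pi) * Real.exp (-a)
    = 2 * (√(2 * Real.pi) * Real.exp (-a)) by ring, ENNReal.ofReal_mul (by norm_num)] at h5
  rw [ENNReal.ofReal_ofNat] at h5
  exact ((ENNReal.mul_right_inj two_ne_zero ENNReal.ofNat_ne_top).1 h5).symm

end H22

namespace H22

/-! ### Positive definite matrices -/

section Matrices

variable {n : Type*} [Fintype n]

lemma posDef_of_forall_pos {A : Matrix n n ℝ} (hA : A.IsHermitian)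
    (h : ∀ x : n → ℝ, x ≠ 0 → 0 < x ⬝ᵥ A.mulVec x) : A.PosDef :=
  .of_dotProduct_mulVec_pos hA fun x hx => by simpa using h x hx

lemma dotProduct_mulVec_pos {A : Matrix n n ℝ} (hA : A.PosDef) {x : n → ℝ} (hx : x ≠ 0) :
    0 < x ⬝ᵥ A.mulVec x := by
  simpa using hA.dotProduct_mulVec_pos hx

lemma dotProduct_mulVec_nonneg {A : Matrix n n ℝ} (hA : A.PosDef) (x : n → ℝ) :
    0 ≤ x ⬝ᵥ A.mulVec x := by
  simpa using hA.posSemidef.dotProduct_mulVec_nonneg x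

lemma dotProduct_mulVec_symm {A : Matrix n n ℝ} (hA : A.IsHermitian) (x y : n → ℝ) :
    x ⬝ᵥ A.mulVec y = y ⬝ᵥ A.mulVec x := by
  have h : A.IsSymm := by simpa using hA
  rw [Matrix.dotProduct_mulVec, ← Matrix.mulVec_transpose, h.eq, dotProduct_comm]

/-- The quadratic form stays positive on the compact unit sphere under small perturbations;
homogeneity extends this to all nonzero vectors. -/
lemma eventually_posDef {ι : Type*} {l : Filter ι} {f : ι → Matrix n n ℝ} {A : Matrix n n ℝ}
    (hf : Tendsto f l (𝓝 A)) (hA : A.PosDef) (hherm : ∀ k, (f k).IsHermitian) :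
    ∀ᶠ k in l, (f k).PosDef := by
  have hcont : Continuous fun p : Matrix n n ℝ × (n → ℝ) => p.2 ⬝ᵥ p.1.mulVec p.2 :=
    continuous_snd.dotProduct (continuous_fst.matrix_mulVec continuous_snd)
  have hK : IsCompact (Metric.sphere (0 : n → ℝ) 1) := isCompact_sphere 0 1
  have key : ∀ᶠ B in 𝓝 A, ∀ x ∈ Metric.sphere (0 : n → ℝ) 1, 0 < x ⬝ᵥ B.mulVec x := by
    refine hK.eventually_forall_of_forall_eventually fun x hx => ?_
    have hx0 : x ≠ 0 := by
      rintro rfl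
      simp at hx
    exact (hcont.tendsto (A, x)).eventually_const_lt (dotProduct_mulVec_pos hA hx0)
  filter_upwards [hf.eventually key] with k hk
  refine posDef_of_forall_pos (hherm k) fun x hx => ?_
  have hn : 0 < ‖x‖ := norm_pos_iff.2 hx
  have h1 := hk (‖x‖⁻¹ • x) (by simp [norm_smul, hn.ne'])
  rw [Matrix.mulVec_smul, smul_dotProduct, dotProduct_smul, smul_eq_mul, smul_eq_mul] at h1
  have h2 : 0 < ‖x‖⁻¹ := inv_pos.2 hn
  exact (mul_pos_iff_of_pos_left h2).1 ((mul_pos_iff_of_pos_left h2).1 h1)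

variable [DecidableEq n]

lemma mulVec_inv_mulVec {A : Matrix n n ℝ} (hA : A.PosDef) (y : n → ℝ) :
    A.mulVec (A⁻¹.mulVec y) = y := by
  rw [Matrix.mulVec_mulVec, Matrix.mul_nonsing_inv _ ((Matrix.isUnit_iff_isUnit_det _).1 hA.isUnit),
    Matrix.one_mulVec]

lemma inv_mulVec_eq {A : Matrix n n ℝ} (hA : A.PosDef) {x y : n → ℝ} (h : A.mulVec x = y) :
    A⁻¹.mulVec y = x := by
  rw [← h, Matrix.mulVec_mulVec,
    Matrix.nonsing_inv_mul _ ((Matrix.isUnit_iff_isUnit_det _).1 hA.isUnit), Matrix.one_mulVec]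

/-- The inverse of a positive definite matrix with nonpositive off-diagonal entries preserves
nonnegative vectors. -/
lemma inv_mulVec_nonneg {A : Matrix n n ℝ} (hA : A.PosDef) (hoff : ∀ i j, i ≠ j → A i j ≤ 0)
    {y : n → ℝ} (hy : ∀ i, 0 ≤ y i) (i : n) : 0 ≤ A⁻¹.mulVec y i := by
  set x := A⁻¹.mulVec y with hx
  have hAx : A.mulVec x = y := mulVec_inv_mulVec hA y
  -- Test the equation with the negative part `z` of the solution. As `x + z` is the positive part,
  -- `z i * (x i + z i) = 0`, and the off-diagonal signs give `z ⬝ᵥ A (x + z) ≤ 0`, which forces `z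
  -- = 0`.
  set z : n → ℝ := fun i => max (-x i) 0 with hz
  have hz0 : ∀ i, 0 ≤ z i := fun i => le_max_right _ _
  have h1 : 0 ≤ z ⬝ᵥ A.mulVec x := by
    rw [hAx]; exact Finset.sum_nonneg fun i _ => mul_nonneg (hz0 i) (hy i)
  have h2 : z ⬝ᵥ A.mulVec x + z ⬝ᵥ A.mulVec z ≤ 0 := by
    rw [← dotProduct_add, ← Matrix.mulVec_add]
    simp only [dotProduct, Matrix.mulVec, Finset.mul_sum]
    refine Finset.sum_nonpos fun i _ => Finset.sum_nonpos fun j _ => ?_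
    have hp : 0 ≤ x j + z j := by
      have := le_max_left (-x j) 0
      simp only [hz]; linarith
    rcases eq_or_ne i j with rfl | hij
    · have : z i * (x i + z i) = 0 := by
        simp only [hz]
        rcases le_total (-x i) 0 with h | h
        · simp [max_eq_right h]
        · simp [max_eq_left h]
      simp only [Pi.add_apply]
      linear_combination A i i * this
    · simp only [Pi.add_apply]
      exact mul_nonpos_of_nonneg_of_nonpos (hz0 i)
        (mul_nonpos_of_nonpos_of_nonneg (hoff i j hij) hp)
  have h3 : z = 0 := by
    by_contra h
    linarith [dotProduct_mulVec_pos hA h]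
  have h4 := congrFun h3 i
  simp only [hz, Pi.zero_apply] at h4
  linarith [le_max_left (-x i) 0]

lemma continuousAt_inv_of_posDef {A : Matrix n n ℝ} (hA : A.PosDef) :
    ContinuousAt (fun B : Matrix n n ℝ => B⁻¹) A := by
  have h : (fun B : Matrix n n ℝ => B⁻¹) = fun B => (B.det)⁻¹ • B.adjugate := by
    funext B; rw [Matrix.inv_def, Ring.inverse_eq_inv']
  rw [h]
  exact (continuous_id.matrix_det.continuousAt.inv₀ hA.det_pos.ne').smul
    continuous_id.matrix_adjugate.continuousAt

end Matrices

/-! ### Schur complements with respect to one vertex -/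

section OptionMatrices

variable {U : Type*} [Fintype U]

lemma option_mulVec_some (M : Matrix (Option U) (Option U) ℝ) (x : Option U → ℝ) (i : U) :
    M.mulVec x (some i) = (M.submatrix some some).mulVec (x ∘ some) i + M (some i) none * x none := by
  simp [Matrix.mulVec, dotProduct, Fintype.sum_option, add_comm]

lemma option_mulVec_none (M : Matrix (Option U) (Option U) ℝ) (x : Option U → ℝ) :
    M.mulVec x none = (fun j => M none (some j)) ⬝ᵥ (x ∘ some) + M none none * x none := by
  simp [Matrix.mulVec, dotProduct, Fintype.sum_option, add_comm]

lemma option_dotProduct (x y : Option U → ℝ) :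
    x ⬝ᵥ y = (x ∘ some) ⬝ᵥ (y ∘ some) + x none * y none := by
  simp [dotProduct, Fintype.sum_option, add_comm]

variable [DecidableEq U] {M : Matrix (Option U) (Option U) ℝ}

/-- Completing the square in the coordinates indexed by `U`; the coefficient left over for `x none ^
2` is the Schur complement. -/
lemma option_quadratic (hM : M.IsHermitian) (hA : (M.submatrix some some).PosDef)
    (x : Option U → ℝ) :
    let A := M.submatrix some some
    let c : U → ℝ := fun i => M (some i) none
    x ⬝ᵥ M.mulVec x
      = (x ∘ some + x none • A⁻¹.mulVec c) ⬝ᵥ A.mulVec (x ∘ some + x none • A⁻¹.mulVec c)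
        + (M none none - c ⬝ᵥ A⁻¹.mulVec c) * x none ^ 2 := by
  intro A c
  have hc : (fun j => M none (some j)) = c := by
    funext j; simpa using hM.apply (some j) none
  have h1 : M.mulVec x ∘ some = A.mulVec (x ∘ some) + x none • c := by
    funext i; simp [option_mulVec_some, A, c, mul_comm]
  rw [option_dotProduct, h1, option_mulVec_none, hc, Matrix.mulVec_add, Matrix.mulVec_smul,
    mulVec_inv_mulVec hA]
  simp only [add_dotProduct, dotProduct_add, smul_dotProduct, dotProduct_smul, smul_eq_mul]
  rw [dotProduct_mulVec_symm hA.1 (A⁻¹.mulVec c) (x ∘ some), mulVec_inv_mulVec hA,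
    dotProduct_comm c (x ∘ some), dotProduct_comm c (A⁻¹.mulVec c)]
  ring

lemma option_posDef_iff (hM : M.IsHermitian) (hA : (M.submatrix some some).PosDef) :
    M.PosDef ↔ 0 < M none none
      - (fun i => M (some i) none) ⬝ᵥ (M.submatrix some some)⁻¹.mulVec fun i => M (some i) none := by
  constructor
  · intro h
    set c : U → ℝ := fun i => M (some i) none
    set g := (M.submatrix some some)⁻¹.mulVec c
    let x : Option U → ℝ := fun o => o.elim 1 fun i => -g i
    have hx : x ≠ 0 := fun h0 => by simpa [x] using congrFun h0 none
    have h1 := dotProduct_mulVec_pos h hx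
    rw [option_quadratic hM hA] at h1
    have h2 : x ∘ some + x none • g = 0 := by funext i; simp [x]
    have h3 : x none = 1 := rfl
    change 0 < (x ∘ some + x none • g) ⬝ᵥ
      (M.submatrix some some).mulVec (x ∘ some + x none • g)
      + (M none none - c ⬝ᵥ g) * x none ^ 2 at h1
    rwa [h2, h3, Matrix.mulVec_zero, dotProduct_zero, zero_add, one_pow, mul_one] at h1
  · intro hs
    refine posDef_of_forall_pos hM fun x hx => ?_
    rw [option_quadratic hM hA]
    by_cases h0 : x none = 0
    · have : x ∘ some ≠ 0 := fun h => hx (by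
        funext o; cases o with
        | none => exact h0
        | some i => exact congrFun h i)
      simpa [h0] using dotProduct_mulVec_pos hA this
    · exact add_pos_of_nonneg_of_pos (dotProduct_mulVec_nonneg hA _) (by positivity)

lemma option_det (hM : M.IsHermitian) (hA : (M.submatrix some some).PosDef) :
    M.det = (M.submatrix some some).det * (M none none
      - (fun i => M (some i) none) ⬝ᵥ
        (M.submatrix some some)⁻¹.mulVec fun i => M (some i) none) := by
  have hAi := hA.isUnit.invertible
  have h : M.submatrix (Equiv.optionEquivSumPUnit.{0} U).symm (Equiv.optionEquivSumPUnit.{0} U).symm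
      = Matrix.fromBlocks (M.submatrix some some) (Matrix.of fun i (_ : PUnit.{1}) => M (some i) none)
        (Matrix.of fun (_ : PUnit.{1}) i => M (some i) none) (Matrix.of fun _ _ => M none none) := by
    ext (i | i) (j | j)
    · simp
    · simp
    · simpa using (hM.apply (some j) none)
    · simp
  rw [← Matrix.det_submatrix_equiv_self (Equiv.optionEquivSumPUnit.{0} U).symm M, h,
    Matrix.det_fromBlocks₁₁]
  congr 1
  rw [Matrix.det_unique]
  simp [Matrix.mul_apply, Matrix.mulVec, dotProduct, Finset.sum_mul, Finset.mul_sum,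
    Matrix.invOf_eq_nonsing_inv]
  rw [Finset.sum_comm]
  refine Finset.sum_congr rfl fun i _ => Finset.sum_congr rfl fun j _ => by ring

/-- Block elimination of `M x = y`. In this form the dependence on the potential at `none` sits in
`s` alone, as a term of type `a² / s`. -/
lemma option_inv_quadratic (hM : M.IsHermitian) (hA : (M.submatrix some some).PosDef)
    (hMp : M.PosDef) (y : Option U → ℝ) :
    let A := M.submatrix some some
    let c : U → ℝ := fun i => M (some i) none
    let s := M none none - c ⬝ᵥ A⁻¹.mulVec c
    y ⬝ᵥ M⁻¹.mulVec y = (y ∘ some) ⬝ᵥ A⁻¹.mulVec (y ∘ some)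
      + (y none - c ⬝ᵥ A⁻¹.mulVec (y ∘ some)) ^ 2 / s := by
  intro A c s
  have hs : 0 < s := (option_posDef_iff hM hA).1 hMp
  have hc : (fun j => M none (some j)) = c := by
    funext j; simpa using hM.apply (some j) none
  set t := (y none - c ⬝ᵥ A⁻¹.mulVec (y ∘ some)) / s with ht
  let x : Option U → ℝ := fun o => o.elim t fun i => A⁻¹.mulVec (y ∘ some - t • c) i
  have hxs : x ∘ some = A⁻¹.mulVec (y ∘ some) - t • A⁻¹.mulVec c := by
    rw [← Matrix.mulVec_smul, ← Matrix.mulVec_sub]; rfl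
  have hx : M.mulVec x = y := by
    funext o
    cases o with
    | some i =>
      rw [option_mulVec_some]
      have : A.mulVec (x ∘ some) = y ∘ some - t • c := mulVec_inv_mulVec hA _
      rw [show M.submatrix some some = A from rfl, this]
      simp [x, c]; ring
    | none =>
      rw [option_mulVec_none, hc, hxs, dotProduct_sub, dotProduct_smul, smul_eq_mul]
      have : t * s = y none - c ⬝ᵥ A⁻¹.mulVec (y ∘ some) := by rw [ht]; field_simp
      simp only [x, Option.elim]
      linear_combination this
  rw [inv_mulVec_eq hMp hx, option_dotProduct, hxs, dotProduct_sub, dotProduct_smul, smul_eq_mul]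
  have hsym : (y ∘ some) ⬝ᵥ A⁻¹.mulVec c = c ⬝ᵥ A⁻¹.mulVec (y ∘ some) :=
    dotProduct_mulVec_symm hA.inv.1 _ _
  rw [hsym]
  have : x none = t := rfl
  rw [this, ht]
  field_simp
  ring

end OptionMatrices

end H22

namespace H22

/-! ### The `H^{2|2}`-model with boundary term -/

section Density

variable {V : Type*} [Fintype V] [DecidableEq V]

/-- The density of the random potential of the `H^{2|2}`-model with weights `W` and boundary
term `η`. -/
noncomputable def h22Density (W : V → V → ℝ) (η : V → ℝ) : (V → ℝ) → ℝ≥0∞ :=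
  Set.indicator {β | (schrodinger W β).PosDef} fun β =>
    ENNReal.ofReal (Real.sqrt (2 / Real.pi) ^ Fintype.card V
      * Real.exp (-(1 / 2) * (∑ i, ∑ j, schrodinger W β i j) + ∑ i, η i
        - (1 / 2) * (η ⬝ᵥ (schrodinger W β)⁻¹.mulVec η))
      / Real.sqrt (schrodinger W β).det)

/-- The law of the random potential of the `H^{2|2}`-model with weights `W` and boundary
term `η`. -/
noncomputable def h22Eta (W : V → V → ℝ) (η : V → ℝ) : Measure (V → ℝ) :=
  volume.withDensity (h22Density W η)

lemma h22Density_of_posDef {W : V → V → ℝ} {η β : V → ℝ} (h : (schrodinger W β).PosDef) :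
    h22Density W η β = ENNReal.ofReal (Real.sqrt (2 / Real.pi) ^ Fintype.card V
      * Real.exp (-(1 / 2) * (∑ i, ∑ j, schrodinger W β i j) + ∑ i, η i
        - (1 / 2) * (η ⬝ᵥ (schrodinger W β)⁻¹.mulVec η))
      / Real.sqrt (schrodinger W β).det) :=
  Set.indicator_of_mem (s := {β | (schrodinger W β).PosDef}) h _

lemma h22Density_of_not_posDef {W : V → V → ℝ} {η β : V → ℝ} (h : ¬(schrodinger W β).PosDef) :
    h22Density W η β = 0 :=
  Set.indicator_of_notMem (s := {β | (schrodinger W β).PosDef}) h _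

lemma H22Law_eq_h22Eta (W : V → V → ℝ) : H22Law W = h22Eta W 0 := by
  simp [H22Law, h22Eta, h22Density]

lemma schrodinger_diag (W : V → V → ℝ) (β : V → ℝ) (i : V) :
    schrodinger W β i i = 2 * β i := by simp [schrodinger]

lemma schrodinger_off (W : V → V → ℝ) (β : V → ℝ) {i j : V} (h : i ≠ j) :
    schrodinger W β i j = -W i j := by simp [schrodinger, h]

lemma isHermitian_schrodinger {W : V → V → ℝ} (hW : ∀ i j, W i j = W j i) (β : V → ℝ) :
    (schrodinger W β).IsHermitian := by
  ext i j
  rcases eq_or_ne i j with rfl | h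
  · simp
  · simp [schrodinger_off _ _ h, schrodinger_off _ _ h.symm, hW i j]

lemma schrodinger_submatrix {U : Type*} [DecidableEq U] {W : V → V → ℝ} {e : U → V}
    (he : Function.Injective e) (β : V → ℝ) :
    (schrodinger W β).submatrix e e = schrodinger (fun i j => W (e i) (e j)) (β ∘ e) := by
  ext i j
  simp [schrodinger, he.eq_iff]

lemma continuous_schrodinger (W : V → V → ℝ) : Continuous fun β => schrodinger W β := by
  refine continuous_matrix fun i j => ?_
  rcases eq_or_ne i j with rfl | h
  · simp only [schrodinger_diag]; fun_prop
  · simp only [schrodinger_off _ _ h]; fun_prop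

lemma isOpen_posDef_schrodinger {W : V → V → ℝ} (hW : ∀ i j, W i j = W j i) :
    IsOpen {β | (schrodinger W β).PosDef} :=
  isOpen_iff_mem_nhds.2 fun β hβ =>
    eventually_posDef ((continuous_schrodinger W).tendsto β) hβ (isHermitian_schrodinger hW)

lemma measurable_schrodinger_inv (W : V → V → ℝ) (i j : V) :
    Measurable fun β => (schrodinger W β)⁻¹ i j := by
  have h : (fun β => (schrodinger W β)⁻¹ i j)
      = fun β => ((schrodinger W β).det)⁻¹ * (schrodinger W β).adjugate i j := by
    funext β; rw [Matrix.inv_def, Ring.inverse_eq_inv', Matrix.smul_apply, smul_eq_mul]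
  rw [h]
  exact (continuous_schrodinger W).matrix_det.measurable.inv.mul
    ((continuous_schrodinger W).matrix_adjugate.matrix_elem i j).measurable

lemma measurable_schrodinger_inv_mulVec (W : V → V → ℝ) (η : V → ℝ) (i : V) :
    Measurable fun β => (schrodinger W β)⁻¹.mulVec η i :=
  Finset.measurable_sum _ fun j _ => (measurable_schrodinger_inv W i j).mul_const _

lemma measurable_h22Density {W : V → V → ℝ} (hW : ∀ i j, W i j = W j i) (η : V → ℝ) :
    Measurable (h22Density W η) := by
  refine Measurable.indicator ?_ (isOpen_posDef_schrodinger hW).measurableSet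
  have h1 : Measurable fun β : V → ℝ => ∑ i, ∑ j, schrodinger W β i j :=
    (continuous_finsetSum _ fun i _ => continuous_finsetSum _ fun j _ =>
      (continuous_schrodinger W).matrix_elem i j).measurable
  have h2 : Measurable fun β : V → ℝ => η ⬝ᵥ (schrodinger W β)⁻¹.mulVec η :=
    Finset.measurable_sum _ fun j _ => (measurable_schrodinger_inv_mulVec W η j).const_mul _
  have h3 : Measurable fun β : V → ℝ => (schrodinger W β).det :=
    (continuous_schrodinger W).matrix_det.measurable
  fun_prop

lemma ae_posDef_h22Eta {W : V → V → ℝ} (hW : ∀ i j, W i j = W j i) (η : V → ℝ) :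
    ∀ᵐ β ∂(h22Eta W η), (schrodinger W β).PosDef := by
  rw [h22Eta, ae_withDensity_iff (measurable_h22Density hW η)]
  refine ae_of_all _ fun β h => ?_
  by_contra h'
  exact h (h22Density_of_not_posDef h')

end Density

/-! ### Integrating out one vertex -/

section Marginal

variable {U : Type*} [Fintype U] [DecidableEq U]

/-- Extension of a configuration by its value at an additional vertex. -/
def optionCons (x : U → ℝ) (b : ℝ) : Option U → ℝ := fun o => o.elim b x

lemma lintegral_comp_affine {q : ℝ} (F : ℝ → ℝ≥0∞) :
    ∫⁻ b in Set.Ioi (q / 2), F (2 * b - q) = 2⁻¹ * ∫⁻ s in Set.Ioi (0 : ℝ), F s := by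
  have key := lintegral_image_eq_lintegral_abs_deriv_mul (s := Set.Ioi (q / 2))
    (f := fun b => 2 * b - q) (f' := fun _ => 2) measurableSet_Ioi
    (fun x _ => by simpa using (((hasDerivAt_id x).const_mul 2).sub_const q).hasDerivWithinAt)
    (fun x _ y _ h => by simpa using h) F
  have him : (fun b => 2 * b - q) '' Set.Ioi (q / 2) = Set.Ioi 0 := by
    ext y
    simp only [Set.mem_image, Set.mem_Ioi]
    exact ⟨fun ⟨z, hz, h⟩ => by linarith, fun hy => ⟨(y + q) / 2, by linarith, by ring⟩⟩
  rw [him] at key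
  rw [key, lintegral_const_mul' _ _ ENNReal.ofReal_ne_top, ← mul_assoc]
  simp [ENNReal.inv_mul_cancel]

lemma lintegral_option (f : (Option U → ℝ) → ℝ≥0∞) (hf : Measurable f) :
    ∫⁻ β, f β = ∫⁻ x : U → ℝ, ∫⁻ b : ℝ, f (optionCons x b) := by
  have h := Measure.pi_map_piOptionEquivProd (ι := U) (β := fun _ => ℝ) (fun _ => volume)
  have h2 : ∀ p : (U → ℝ) × ℝ,
      (MeasurableEquiv.piOptionEquivProd fun _ : Option U => ℝ).symm p = optionCons p.1 p.2 := by
    intro p; funext o; cases o <;> rfl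
  have h3 : Measurable fun p : (U → ℝ) × ℝ => f (optionCons p.1 p.2) := by
    simp_rw [← h2]
    exact hf.comp (MeasurableEquiv.measurable _)
  rw [volume_pi, ← h, lintegral_map hf (MeasurableEquiv.measurable _)]
  simp_rw [h2]
  rw [lintegral_prod _ h3.aemeasurable]
  rfl

/-- As a function of `b` the density is inverse Gaussian in the Schur complement `2 b - q`, with
parameter `a = η none + w ⬝ᵥ A⁻¹ y`. Its mass contributes `exp (-a)`; the cross term in `a` merges
the quadratic forms of `y` and `w` into that of `y + w`, which is why the removed edges reappear as
a boundary term. -/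
lemma lintegral_h22Density_optionCons {W : Option U → Option U → ℝ} (hW : ∀ i j, W i j = W j i)
    (hW0 : ∀ i j, 0 ≤ W i j) {η : Option U → ℝ} (hη : ∀ i, 0 ≤ η i) (x : U → ℝ) :
    ∫⁻ b, h22Density W η (optionCons x b)
      = h22Density (fun i j => W (some i) (some j)) (fun i => η (some i) + W (some i) none) x := by
  set W' : U → U → ℝ := fun i j => W (some i) (some j) with hW'
  set A := schrodinger W' x with hAdef
  have hsub : ∀ b, (schrodinger W (optionCons x b)).submatrix some some = A := fun b => by
    rw [schrodinger_submatrix (Option.some_injective U)]; rfl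
  have hherm := fun b => isHermitian_schrodinger hW (optionCons x b)
  by_cases hA : A.PosDef
  swap
  · rw [h22Density_of_not_posDef hA]
    refine (lintegral_congr fun b => h22Density_of_not_posDef fun h => hA ?_).trans (by simp)
    rw [← hsub b]
    exact h.submatrix (Option.some_injective U)
  set w : U → ℝ := fun i => W (some i) none with hw
  have hc : ∀ b, (fun i => schrodinger W (optionCons x b) (some i) none) = -w := fun b => by
    funext i; simp [schrodinger, w]
  have hd : ∀ b, schrodinger W (optionCons x b) none none = 2 * b := fun b => by
    simp [schrodinger, optionCons]
  set q := w ⬝ᵥ A⁻¹.mulVec w with hq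
  have hq' : (-w) ⬝ᵥ A⁻¹.mulVec (-w) = q := by simp [Matrix.mulVec_neg, q]
  set y : U → ℝ := η ∘ some with hy
  set Q := y ⬝ᵥ A⁻¹.mulVec y with hQ
  set a := η none + w ⬝ᵥ A⁻¹.mulVec y with ha
  have hpd : ∀ b, (schrodinger W (optionCons x b)).PosDef ↔ q / 2 < b := fun b => by
    rw [option_posDef_iff (hherm b) (by rw [hsub]; exact hA), hsub, hc, hd, hq']
    constructor <;> intro h <;> linarith
  have hdet : ∀ b, (schrodinger W (optionCons x b)).det = A.det * (2 * b - q) := fun b => by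
    rw [option_det (hherm b) (by rw [hsub]; exact hA), hsub, hc, hd, hq']
  have hquad : ∀ b, q / 2 < b → η ⬝ᵥ (schrodinger W (optionCons x b))⁻¹.mulVec η
      = Q + a ^ 2 / (2 * b - q) := fun b hb => by
    have := option_inv_quadratic (hherm b) (by rw [hsub]; exact hA) ((hpd b).2 hb) η
    simp only [hsub, hc, hd, hq'] at this
    rw [this]
    simp [a, Q, y]
  have hsum : ∀ b, ∑ i, ∑ j, schrodinger W (optionCons x b) i j
      = ∑ i, ∑ j, A i j - 2 * ∑ i, w i + 2 * b := fun b => by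
    simp only [Fintype.sum_option, hd]
    have h1 : ∀ i, schrodinger W (optionCons x b) (some i) none = - w i := fun i => congrFun (hc b) i
    have h2 : ∀ i, schrodinger W (optionCons x b) none (some i) = - w i := fun i => by
      rw [← h1 i]; simpa using ((hherm b).apply none (some i)).symm
    have h3 : ∀ i j, schrodinger W (optionCons x b) (some i) (some j) = A i j := fun i j => by
      rw [← hsub b]; rfl
    simp only [h1, h2, h3, Finset.sum_add_distrib, Finset.sum_neg_distrib]
    ring
  -- The inverse Gaussian formula requires `0 ≤ a`; the signs of the weights and of the boundary
  -- term enter here.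
  have ha0 : 0 ≤ a := add_nonneg (hη none) (Finset.sum_nonneg fun i _ => mul_nonneg (hW0 _ _)
    (inv_mulVec_nonneg hA (fun i j hij => by
      rw [hAdef, schrodinger_off _ _ hij]; exact neg_nonpos.2 (hW0 _ _)) (fun i => hη (some i)) i))
  set C := Real.sqrt (2 / Real.pi) ^ (Fintype.card U + 1) *
    Real.exp (-(1 / 2) * (∑ i, ∑ j, A i j) + ∑ i, w i - q / 2 + ∑ i, y i + η none - Q / 2)
      / Real.sqrt A.det with hC
  have hC0 : 0 ≤ C := by positivity
  have hint : ∀ b, h22Density W η (optionCons x b) = (Set.Ioi (q / 2)).indicator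
      (fun b => (fun s => ENNReal.ofReal C * ENNReal.ofReal (1 / √s *
        Real.exp (-(s + a ^ 2 / s) / 2))) (2 * b - q)) b := fun b => by
    by_cases hb : q / 2 < b
    · have hs : 0 < 2 * b - q := by linarith
      rw [h22Density_of_posDef ((hpd b).2 hb), Set.indicator_of_mem (Set.mem_Ioi.2 hb),
        hsum, hdet, hquad b hb]
      beta_reduce
      rw [← ENNReal.ofReal_mul hC0, Real.sqrt_mul hA.det_pos.le, Fintype.card_option,
        Fintype.sum_option]
      congr 1
      have hexp : Real.exp (-(1 / 2) * (∑ i, ∑ j, A i j - 2 * ∑ i, w i + 2 * b)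
          + (η none + ∑ i, η (some i)) - 1 / 2 * (Q + a ^ 2 / (2 * b - q)))
          = Real.exp (-(1 / 2) * (∑ i, ∑ j, A i j) + ∑ i, w i - q / 2 + ∑ i, y i + η none - Q / 2)
            * Real.exp (-(2 * b - q + a ^ 2 / (2 * b - q)) / 2) := by
        rw [← Real.exp_add]
        congr 1
        simp only [y, Function.comp]
        ring
      rw [hexp, hC]
      have := Real.sqrt_pos.2 hs
      have := Real.sqrt_pos.2 hA.det_pos
      field_simp
    · rw [h22Density_of_not_posDef ((hpd b).not.2 hb),
        Set.indicator_of_notMem (Set.notMem_Ioi.2 (not_lt.1 hb))]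
  simp_rw [hint]
  rw [lintegral_indicator measurableSet_Ioi,
    lintegral_comp_affine (fun s => ENNReal.ofReal C * ENNReal.ofReal (1 / √s *
        Real.exp (-(s + a ^ 2 / s) / 2))), lintegral_const_mul' _ _ ENNReal.ofReal_ne_top,
    lintegral_inverse_gaussian ha0, h22Density_of_posDef hA,
    ← ENNReal.ofReal_mul hC0,
    show (2 : ℝ≥0∞)⁻¹ = ENNReal.ofReal (2⁻¹) by rw [ENNReal.ofReal_inv_of_pos two_pos]; simp,
    ← ENNReal.ofReal_mul (by norm_num)]
  congr 1
  have hK : Real.sqrt (2 / Real.pi) * √(2 * Real.pi) = 2 := by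
    rw [← Real.sqrt_mul (by positivity), show 2 / Real.pi * (2 * Real.pi) = 2 ^ 2 by
      field_simp, Real.sqrt_sq (by norm_num)]
  have hsym : y ⬝ᵥ A⁻¹.mulVec w = w ⬝ᵥ A⁻¹.mulVec y := dotProduct_mulVec_symm hA.inv.1 _ _
  have hq2 : (fun i => η (some i) + w i) ⬝ᵥ A⁻¹.mulVec (fun i => η (some i) + w i)
      = Q + 2 * (w ⬝ᵥ A⁻¹.mulVec y) + q := by
    rw [show (fun i => η (some i) + w i) = y + w from rfl, Matrix.mulVec_add, add_dotProduct,
      dotProduct_add, dotProduct_add, hsym]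
    ring
  have hexp : Real.exp (-(1 / 2) * (∑ i, ∑ j, A i j) + ∑ i, w i - q / 2 + ∑ i, y i + η none
        - Q / 2) * Real.exp (-a)
      = Real.exp (-(1 / 2) * (∑ i, ∑ j, A i j) + ∑ i, (η (some i) + w i)
        - 1 / 2 * ((fun i => η (some i) + w i) ⬝ᵥ A⁻¹.mulVec fun i => η (some i) + w i)) := by
    rw [← Real.exp_add, hq2, Finset.sum_add_distrib]
    congr 1
    simp only [y, Function.comp, ha]
    ring
  rw [← hexp, hC, pow_succ]
  linear_combination (1 / 2) * Real.sqrt (2 / Real.pi) ^ Fintype.card U *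
    Real.exp (-(1 / 2) * (∑ i, ∑ j, A i j) + ∑ i, w i - q / 2 + ∑ i, y i + η none - Q / 2)
      * Real.exp (-a) / Real.sqrt A.det * hK

lemma measurable_optionCons : Measurable fun p : (U → ℝ) × ℝ => optionCons p.1 p.2 :=
  measurable_pi_lambda _ fun o => by
    cases o with
    | none => exact measurable_snd
    | some i => exact (measurable_pi_apply i).comp measurable_fst

/-- Removing one vertex from the `H^{2|2}`-model. -/
lemma map_comp_some_h22Eta {W : Option U → Option U → ℝ} (hW : ∀ i j, W i j = W j i)
    (hW0 : ∀ i j, 0 ≤ W i j) {η : Option U → ℝ} (hη : ∀ i, 0 ≤ η i) :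
    (h22Eta W η).map (fun β => β ∘ some)
      = h22Eta (fun i j => W (some i) (some j)) (fun i => η (some i) + W (some i) none) := by
  have hm : Measurable fun β : Option U → ℝ => β ∘ some :=
    measurable_pi_lambda _ fun i => measurable_pi_apply _
  ext s hs
  rw [Measure.map_apply hm hs, h22Eta, withDensity_apply _ (hm hs),
    ← lintegral_indicator (hm hs), lintegral_option _
    ((measurable_h22Density hW η).indicator (hm hs)), h22Eta, withDensity_apply _ hs,
    ← lintegral_indicator hs]
  refine lintegral_congr fun x => ?_
  by_cases hx : x ∈ s
  · rw [Set.indicator_of_mem hx, ← lintegral_h22Density_optionCons hW hW0 hη]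
    exact lintegral_congr fun b => Set.indicator_of_mem (by exact hx) _
  · rw [Set.indicator_of_notMem hx]
    exact (lintegral_congr fun b => Set.indicator_of_notMem (by exact hx) _).trans (by simp)

end Marginal

/-! ### Relabelling and restriction to a set of vertices -/

section Embedding

lemma map_comp_equiv_h22Eta {U V : Type*} [Fintype U] [DecidableEq U] [Fintype V] [DecidableEq V]
    (e : U ≃ V) {W : V → V → ℝ} (hW : ∀ i j, W i j = W j i) (η : V → ℝ) :
    (h22Eta W η).map (fun β => β ∘ e) = h22Eta (fun i j => W (e i) (e j)) (η ∘ e) := by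
  have hmp : MeasurePreserving (fun β : V → ℝ => β ∘ e) volume volume := by
    have := volume_measurePreserving_piCongrLeft (fun _ : U => ℝ) e.symm
    convert this using 2 with β
    funext i
    simpa using (MeasurableEquiv.piCongrLeft_apply_apply (β := fun _ => ℝ) e.symm β (e i)).symm
  have hdens : ∀ β, h22Density W η β
      = h22Density (fun i j => W (e i) (e j)) (η ∘ e) (β ∘ e) := by
    intro β
    have hsub := schrodinger_submatrix (W := W) e.injective β
    have hpd : (schrodinger W β).PosDef ↔
        (schrodinger (fun i j => W (e i) (e j)) (β ∘ e)).PosDef := by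
      rw [← hsub]
      refine ⟨fun h => h.submatrix e.injective, fun h => ?_⟩
      have := h.submatrix e.symm.injective
      simpa using this
    by_cases h : (schrodinger W β).PosDef
    · rw [h22Density_of_posDef h, h22Density_of_posDef (hpd.1 h), ← hsub,
        Matrix.det_submatrix_equiv_self, Fintype.card_congr e]
      have h1 : ∑ i, ∑ j, (schrodinger W β).submatrix e e i j
          = ∑ i, ∑ j, schrodinger W β i j := by
        rw [← e.sum_comp]
        exact Finset.sum_congr rfl fun i _ => by simp [e.sum_comp (schrodinger W β (e i))]
      have h2 : (η ∘ e) ⬝ᵥ ((schrodinger W β).submatrix e e)⁻¹.mulVec (η ∘ e)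
          = η ⬝ᵥ (schrodinger W β)⁻¹.mulVec η := by
        rw [Matrix.inv_submatrix_equiv, Matrix.submatrix_mulVec_equiv]
        simp [Function.comp_assoc]
      rw [h1, h2]
      simp [e.sum_comp η]
    · rw [h22Density_of_not_posDef h, h22Density_of_not_posDef (hpd.not.1 h)]
  ext s hs
  rw [Measure.map_apply hmp.measurable hs, h22Eta, withDensity_apply _ (hmp.measurable hs), h22Eta,
    withDensity_apply _ hs, ← hmp.setLIntegral_comp_preimage hs
      (measurable_h22Density (fun i j => hW (e i) (e j)) _)]
  exact lintegral_congr fun β => hdens β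

/-- The restriction of the `H^{2|2}`-model to a set of vertices is again an `H^{2|2}`-model, whose
boundary term collects the weights to the removed vertices. -/
theorem map_comp_h22Eta {U V : Type*} [Fintype U] [DecidableEq U] [Fintype V] [DecidableEq V]
    {e : U → V} (he : Function.Injective e) {W : V → V → ℝ} (hW : ∀ i j, W i j = W j i)
    (hW0 : ∀ i j, 0 ≤ W i j) {η : V → ℝ} (hη : ∀ i, 0 ≤ η i) :
    (h22Eta W η).map (fun β => β ∘ e)
      = h22Eta (fun i j => W (e i) (e j))
        (fun i => η (e i) + (∑ j, W (e i) j - ∑ u, W (e i) (e u))) := by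
  by_cases hsurj : Function.Surjective e
  · rw [show e = Equiv.ofBijective e ⟨he, hsurj⟩ from rfl, map_comp_equiv_h22Eta _ hW]
    congr 1
    funext i
    rw [(Equiv.ofBijective e ⟨he, hsurj⟩).sum_comp (W _)]
    simp
  -- Remove one vertex outside the range and recurse on the number of vertices.
  · obtain ⟨v, hv⟩ : ∃ v, ∀ u, e u ≠ v := by simpa [Function.Surjective] using hsurj
    have hcard : Fintype.card {a // a ≠ v} < Fintype.card V := Fintype.card_subtype_lt (x := v)
      (by simp)
    let f : Option {a // a ≠ v} ≃ V := Equiv.optionSubtypeNe v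
    let e' : U → {a // a ≠ v} := fun u => ⟨e u, hv u⟩
    have he' : Function.Injective e' := fun a b h => he (congrArg Subtype.val h)
    have hfe : ∀ u, f (some (e' u)) = e u := fun u => by simp [f, e']
    have hf1 : ∀ a, f (some a) = a := fun a => by simp [f]
    have hf0 : f none = v := by simp [f]
    have hm1 : Measurable fun β : V → ℝ => β ∘ f :=
      measurable_pi_lambda _ fun i => measurable_pi_apply _
    have hm2 : Measurable fun β : Option {a // a ≠ v} → ℝ => β ∘ some :=
      measurable_pi_lambda _ fun i => measurable_pi_apply _
    have hm3 : Measurable fun β : {a // a ≠ v} → ℝ => β ∘ e' :=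
      measurable_pi_lambda _ fun i => measurable_pi_apply _
    have hcomp : (fun β : V → ℝ => β ∘ e)
        = (fun β : {a // a ≠ v} → ℝ => β ∘ e') ∘ (fun β : Option {a // a ≠ v} → ℝ => β ∘ some)
          ∘ (fun β : V → ℝ => β ∘ f) := by
      funext β u; simp [Function.comp, hfe]
    rw [hcomp, ← Measure.map_map hm3 (hm2.comp hm1), ← Measure.map_map hm2 hm1,
      map_comp_equiv_h22Eta f hW η, map_comp_some_h22Eta (W := fun i j => W (f i) (f j)) (η := η ∘ f)
        (fun i j => hW _ _) (fun i j => hW0 _ _) (fun i => hη _),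
      map_comp_h22Eta he' (W := fun i j => W (f (some i)) (f (some j)))
        (η := fun i => (η ∘ f) (some i) + W (f (some i)) (f none)) (fun i j => hW _ _) (fun i j => hW0 _ _)
        (fun i => add_nonneg (hη _) (hW0 _ _))]
    simp only [hfe, hf0]
    congr 1
    funext i
    have : ∑ j, W (e i) j = W (e i) v + ∑ j : {a // a ≠ v}, W (e i) (f (some j)) := by
      rw [← f.sum_comp, Fintype.sum_option, hf0]
    rw [this]
    simp only [Function.comp, hfe]
    ring
termination_by Fintype.card V

/-- Normalisation is the case of restriction to the empty vertex set, where the model is a point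
mass. -/
lemma h22Eta_univ {V : Type*} [Fintype V] [DecidableEq V] {W : V → V → ℝ}
    (hW : ∀ i j, W i j = W j i) (hW0 : ∀ i j, 0 ≤ W i j) {η : V → ℝ} (hη : ∀ i, 0 ≤ η i) :
    h22Eta W η Set.univ = 1 := by
  have h := map_comp_h22Eta (e := (Empty.elim : Empty → V)) (fun a => a.elim) hW hW0 hη
  have hm : Measurable fun β : V → ℝ => β ∘ (Empty.elim : Empty → V) :=
    measurable_pi_lambda _ fun i => i.elim
  have h1 := congrArg (fun μ => μ Set.univ) h
  simp only [Measure.map_apply hm MeasurableSet.univ, Set.preimage_univ] at h1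
  rw [h1, h22Eta, withDensity_apply _ MeasurableSet.univ, setLIntegral_univ]
  have hpd : ∀ (W : Empty → Empty → ℝ) (x : Empty → ℝ), (schrodinger W x).PosDef := fun W x =>
    posDef_of_forall_pos (by ext i; exact i.elim) fun y hy =>
      absurd (Subsingleton.elim y 0) hy
  simp [h22Density, hpd, volume_pi]

lemma isProbabilityMeasure_h22Eta {V : Type*} [Fintype V] [DecidableEq V] {W : V → V → ℝ}
    (hW : ∀ i j, W i j = W j i) (hW0 : ∀ i j, 0 ≤ W i j) {η : V → ℝ} (hη : ∀ i, 0 ≤ η i) :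
    IsProbabilityMeasure (h22Eta W η) := ⟨h22Eta_univ hW hW0 hη⟩

end Embedding

end H22

namespace H22

/-! ### Restriction decreases the field in mean -/

section Tilt

variable {V : Type*} [Fintype V] [DecidableEq V]

/-- The field `H_β⁻¹ η`. -/
noncomputable def field (W : V → V → ℝ) (η : V → ℝ) (β : V → ℝ) : V → ℝ :=
  (schrodinger W β)⁻¹.mulVec η

lemma field_nonneg {W : V → V → ℝ} (hW0 : ∀ i j, 0 ≤ W i j) {η β : V → ℝ} (hη : ∀ i, 0 ≤ η i)
    (h : (schrodinger W β).PosDef) (i : V) : 0 ≤ field W η β i :=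
  inv_mulVec_nonneg h (fun i j hij => by
    rw [schrodinger_off _ _ hij]; exact neg_nonpos.2 (hW0 _ _)) hη i

/-- The exponent of the Radon-Nikodym density when the boundary term is increased by `t` at `v`. -/
noncomputable def tiltExponent (W : V → V → ℝ) (η : V → ℝ) (v : V) (t : ℝ) (β : V → ℝ) : ℝ :=
  t * field W η β v + t ^ 2 / 2 * (schrodinger W β)⁻¹ v v

lemma measurable_field (W : V → V → ℝ) (η : V → ℝ) : Measurable (field W η) :=
  measurable_pi_lambda _ fun v => measurable_schrodinger_inv_mulVec W η v

lemma measurable_tiltExponent (W : V → V → ℝ) (η : V → ℝ) (v : V) (t : ℝ) :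
    Measurable (tiltExponent W η v t) :=
  ((measurable_schrodinger_inv_mulVec W η v).const_mul _).add
    ((measurable_schrodinger_inv W v v).const_mul _)

lemma tiltExponent_nonneg {W : V → V → ℝ} (hW0 : ∀ i j, 0 ≤ W i j) {η β : V → ℝ}
    (hη : ∀ i, 0 ≤ η i) (h : (schrodinger W β).PosDef) (v : V) {t : ℝ} (ht : 0 ≤ t) :
    0 ≤ tiltExponent W η v t β :=
  add_nonneg (mul_nonneg ht (field_nonneg hW0 hη h v))
    (mul_nonneg (by positivity) h.inv.diag_pos.le)

/-- Expanding `η ⬝ᵥ H⁻¹ η` after the change of `η` produces a linear term with the field at `v` and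
a quadratic term with the Green function at `v`. -/
lemma h22Density_tilt (W : V → V → ℝ) (η : V → ℝ) (v : V) (t : ℝ)
    (β : V → ℝ) :
    h22Density W (η + t • Pi.single v 1) β
      = h22Density W η β * ENNReal.ofReal (Real.exp (t - tiltExponent W η v t β)) := by
  by_cases h : (schrodinger W β).PosDef
  swap
  · rw [h22Density_of_not_posDef h, h22Density_of_not_posDef h, zero_mul]
  rw [h22Density_of_posDef h, h22Density_of_posDef h, ← ENNReal.ofReal_mul (by positivity)]
  congr 1
  have h1 : ∑ i, (η + t • Pi.single v (1 : ℝ) : V → ℝ) i = ∑ i, η i + t := by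
    simp [Finset.sum_add_distrib, ← Finset.mul_sum]
  have h2 : (η + t • Pi.single v (1 : ℝ)) ⬝ᵥ
      (schrodinger W β)⁻¹.mulVec (η + t • Pi.single v (1 : ℝ))
      = η ⬝ᵥ (schrodinger W β)⁻¹.mulVec η + 2 * tiltExponent W η v t β := by
    rw [Matrix.mulVec_add, Matrix.mulVec_smul, add_dotProduct, dotProduct_add, dotProduct_add,
      dotProduct_smul, smul_dotProduct, smul_dotProduct, dotProduct_smul,
      dotProduct_mulVec_symm h.inv.1 η (Pi.single v 1)]
    simp only [single_dotProduct, one_mul, Matrix.mulVec_single_one, smul_eq_mul, tiltExponent,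
      field, Matrix.col_apply]
    ring
  have h3 : ∀ S E Q T : ℝ, Real.exp (-(1 / 2) * S + (E + t) - 1 / 2 * (Q + 2 * T))
      = Real.exp (-(1 / 2) * S + E - 1 / 2 * Q) * Real.exp (t - T) := fun S E Q T => by
    rw [← Real.exp_add]; ring_nf
  rw [h1, h2, h3]
  ring

lemma h22Eta_tilt {W : V → V → ℝ} (hW : ∀ i j, W i j = W j i) (η : V → ℝ) (v : V) (t : ℝ) :
    h22Eta W (η + t • Pi.single v 1) = (h22Eta W η).withDensity fun β =>
      ENNReal.ofReal (Real.exp (t - tiltExponent W η v t β)) := by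
  have := measurable_tiltExponent W η v t
  rw [h22Eta, h22Eta, ← withDensity_mul _ (measurable_h22Density hW η) (by fun_prop)]
  congr 1
  funext β
  exact h22Density_tilt W η v t β

variable {U : Type*} [Fintype U] [DecidableEq U]

lemma measurable_comp_right (e : U → V) : Measurable fun β : V → ℝ => β ∘ e :=
  measurable_pi_lambda _ fun _ => measurable_pi_apply _

/-- Tilting commutes with restriction: an increment of the boundary term at `e u` becomes the same
increment at `u`. On events of the small graph the two density ratios thus have equal integrals. -/
lemma setLIntegral_exp_tilt {e : U → V} (he : Function.Injective e) {W : V → V → ℝ}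
    (hW : ∀ i j, W i j = W j i) (hW0 : ∀ i j, 0 ≤ W i j) {η : V → ℝ} (hη : ∀ i, 0 ≤ η i) (u : U)
    {t : ℝ} (ht : 0 ≤ t) {A : Set (U → ℝ)} (hA : MeasurableSet A) :
    let W' : U → U → ℝ := fun i j => W (e i) (e j)
    let η' : U → ℝ := fun i => η (e i) + (∑ j, W (e i) j - ∑ u, W (e i) (e u))
    ∫⁻ β in (fun β => β ∘ e) ⁻¹' A, ENNReal.ofReal (Real.exp (-tiltExponent W η (e u) t β))
        ∂(h22Eta W η)
      = ∫⁻ x in A, ENNReal.ofReal (Real.exp (-tiltExponent W' η' u t x)) ∂(h22Eta W' η') := by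
  intro W' η'
  have hA' := measurable_comp_right e hA
  have h1 := map_comp_h22Eta he hW hW0 (η := η + t • Pi.single (e u) 1) (fun i =>
    add_nonneg (hη i) (mul_nonneg ht (by by_cases h : i = e u <;> simp [h])))
  have h2 : (fun i => (η + t • Pi.single (e u) (1 : ℝ) : V → ℝ) (e i)
      + (∑ j, W (e i) j - ∑ u, W (e i) (e u))) = η' + t • Pi.single u (1 : ℝ) := by
    funext i
    have : (Pi.single (e u) (1 : ℝ) : V → ℝ) (e i) = (Pi.single u (1 : ℝ) : U → ℝ) i := by
      simp [Pi.single_apply, he.eq_iff]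
    simp only [Pi.add_apply, Pi.smul_apply, this, η']
    ring
  rw [h2, h22Eta_tilt hW, h22Eta_tilt (fun i j => hW _ _)] at h1
  have h3 := congrArg (fun μ => μ A) h1
  simp only [Measure.map_apply (measurable_comp_right e) hA, withDensity_apply _ hA,
    withDensity_apply _ hA'] at h3
  have h4 : ∀ x : ℝ, ENNReal.ofReal (Real.exp (t - x))
      = ENNReal.ofReal (Real.exp t) * ENNReal.ofReal (Real.exp (-x)) := fun x => by
    rw [← ENNReal.ofReal_mul (Real.exp_pos t).le, ← Real.exp_add, sub_eq_add_neg]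
  simp_rw [h4] at h3
  rw [lintegral_const_mul' _ _ ENNReal.ofReal_ne_top, lintegral_const_mul' _ _
    ENNReal.ofReal_ne_top] at h3
  exact (ENNReal.mul_right_inj (by simpa using Real.exp_pos t) ENNReal.ofReal_ne_top).1 h3

lemma lintegral_exp_tilt {W : V → V → ℝ} (hW : ∀ i j, W i j = W j i) (hW0 : ∀ i j, 0 ≤ W i j)
    {η : V → ℝ} (hη : ∀ i, 0 ≤ η i) (v : V) {t : ℝ} (ht : 0 ≤ t) :
    ∫⁻ β, ENNReal.ofReal (Real.exp (-tiltExponent W η v t β)) ∂(h22Eta W η)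
      = ENNReal.ofReal (Real.exp (-t)) := by
  have h1 := h22Eta_univ hW hW0 (η := η + t • Pi.single v 1) (fun i =>
    add_nonneg (hη i) (mul_nonneg ht (by by_cases h : i = v <;> simp [h])))
  rw [h22Eta_tilt hW, withDensity_apply _ MeasurableSet.univ, setLIntegral_univ] at h1
  have h4 : ∀ x : ℝ, ENNReal.ofReal (Real.exp (-x))
      = ENNReal.ofReal (Real.exp (-t)) * ENNReal.ofReal (Real.exp (t - x)) := fun x => by
    rw [← ENNReal.ofReal_mul (Real.exp_pos _).le, ← Real.exp_add]; ring_nf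
  rw [lintegral_congr fun β => h4 _, lintegral_const_mul' _ _ ENNReal.ofReal_ne_top, h1, mul_one]

/-- Fatou's lemma for the difference quotients of the tilts. -/
lemma setLIntegral_field_le_liminf {W : V → V → ℝ}
    {η : V → ℝ} (v : V) (A : Set (V → ℝ)) :
    ∫⁻ β in A, ENNReal.ofReal (field W η β v) ∂(h22Eta W η)
      ≤ liminf (fun n : ℕ => ∫⁻ β in A, ENNReal.ofReal (((1 : ℝ) / (n + 1))⁻¹ *
        (1 - Real.exp (-tiltExponent W η v (1 / (n + 1)) β))) ∂(h22Eta W η)) atTop := by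
  refine le_trans (le_of_eq ?_) (lintegral_liminf_le fun n => ?_)
  · refine lintegral_congr fun β => ?_
    refine (Tendsto.liminf_eq ?_).symm
    refine (ENNReal.continuous_ofReal.tendsto _).comp ?_
    have hd : HasDerivAt (fun t => 1 - Real.exp (-tiltExponent W η v t β)) (field W η β v) 0 := by
      have h1 : HasDerivAt (fun t => tiltExponent W η v t β) (field W η β v) 0 := by
        have h2 := ((hasDerivAt_id (0 : ℝ)).mul_const (field W η β v)).add
          ((((hasDerivAt_id (0 : ℝ)).pow 2).div_const 2).mul_const ((schrodinger W β)⁻¹ v v))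
        refine h2.congr_deriv ?_
        simp
      refine (h1.neg.exp.const_sub 1).congr_deriv ?_
      simp [tiltExponent]
    have h3 := hd.tendsto_slope_zero_right.comp
      (tendsto_nhdsWithin_iff.2 ⟨tendsto_one_div_add_atTop_nhds_zero_nat (𝕜 := ℝ),
        Eventually.of_forall fun n => Set.mem_Ioi.2 (by positivity)⟩)
    refine h3.congr fun n => ?_
    simp [tiltExponent]
  · have := measurable_tiltExponent W η v (1 / (n + 1))
    fun_prop

/-- The difference quotients have mean `(1 - exp (-t)) / t ≤ 1`, because the tilted model is
normalised; Fatou's lemma passes to `t → 0`. -/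
lemma lintegral_field_le_one {W : V → V → ℝ} (hW : ∀ i j, W i j = W j i)
    (hW0 : ∀ i j, 0 ≤ W i j) {η : V → ℝ} (hη : ∀ i, 0 ≤ η i) (v : V) :
    ∫⁻ β, ENNReal.ofReal (field W η β v) ∂(h22Eta W η) ≤ 1 := by
  have hp := isProbabilityMeasure_h22Eta hW hW0 hη
  have h := setLIntegral_field_le_liminf (W := W) (η := η) v Set.univ
  simp only [setLIntegral_univ] at h
  refine h.trans (liminf_le_of_frequently_le' (Frequently.of_forall fun n => ?_))
  set t : ℝ := 1 / (n + 1) with ht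
  have ht0 : 0 < t := by positivity
  have hm := measurable_tiltExponent W η v t
  simp_rw [ENNReal.ofReal_mul (inv_pos.2 ht0).le, ENNReal.ofReal_sub _ (Real.exp_pos _).le]
  rw [lintegral_const_mul' _ _ ENNReal.ofReal_ne_top, lintegral_sub (by fun_prop)
    (by rw [lintegral_exp_tilt hW hW0 hη v ht0.le]; exact ENNReal.ofReal_ne_top), lintegral_exp_tilt
    hW hW0 hη v ht0.le]
  · simp only [ENNReal.ofReal_one, lintegral_const, measure_univ, mul_one]
    rw [← ENNReal.ofReal_one, ← ENNReal.ofReal_sub _ (Real.exp_pos _).le,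
      ← ENNReal.ofReal_mul (inv_pos.2 ht0).le]
    refine ENNReal.ofReal_le_ofReal ?_
    rw [inv_mul_le_iff₀ ht0]
    linarith [Real.add_one_le_exp (-t)]
  · filter_upwards [ae_posDef_h22Eta hW η] with β hβ
    refine ENNReal.ofReal_le_ofReal ?_
    have := tiltExponent_nonneg hW0 hη hβ v ht0.le
    exact Real.exp_le_one_iff.2 (by linarith)

/-- On events determined by a subset of vertices, the field has smaller mean than the field of the
restriction. -/
theorem setLIntegral_field_le {e : U → V} (he : Function.Injective e) {W : V → V → ℝ}
    (hW : ∀ i j, W i j = W j i) (hW0 : ∀ i j, 0 ≤ W i j) {η : V → ℝ} (hη : ∀ i, 0 ≤ η i) (u : U)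
    {A : Set (U → ℝ)} (hA : MeasurableSet A) :
    let W' : U → U → ℝ := fun i j => W (e i) (e j)
    let η' : U → ℝ := fun i => η (e i) + (∑ j, W (e i) j - ∑ u, W (e i) (e u))
    (∀ i, 0 ≤ η' i) →
    ∫⁻ β in (fun β => β ∘ e) ⁻¹' A, ENNReal.ofReal (field W η β (e u)) ∂(h22Eta W η)
      ≤ ∫⁻ x in A, ENNReal.ofReal (field W' η' x u) ∂(h22Eta W' η') := by
  intro W' η' hη'
  have hp := isProbabilityMeasure_h22Eta hW hW0 hη
  have hW' : ∀ i j, W' i j = W' j i := fun i j => hW _ _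
  have hW0' : ∀ i j, 0 ≤ W' i j := fun i j => hW0 _ _
  have hp' := isProbabilityMeasure_h22Eta hW' hW0' hη'
  have hmap : (h22Eta W η).map (fun β => β ∘ e) = h22Eta W' η' := map_comp_h22Eta he hW hW0 hη
  -- first on sets where the Green function is bounded
  have key : ∀ (K : ℕ) (B : Set (U → ℝ)), MeasurableSet B →
      (∀ x ∈ B, (schrodinger W' x)⁻¹ u u ≤ K) →
      ∫⁻ β in (fun β => β ∘ e) ⁻¹' B, ENNReal.ofReal (field W η β (e u)) ∂(h22Eta W η)
        ≤ ∫⁻ x in B, ENNReal.ofReal (field W' η' x u) ∂(h22Eta W' η') := by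
    intro K B hB hK
    refine (setLIntegral_field_le_liminf (e u) _).trans ?_
    have hlim : Tendsto (fun n : ℕ => ∫⁻ x in B, ENNReal.ofReal (field W' η' x u) ∂(h22Eta W' η')
        + ENNReal.ofReal (1 / (n + 1) * (K / 2))) atTop
        (𝓝 (∫⁻ x in B, ENNReal.ofReal (field W' η' x u) ∂(h22Eta W' η') + 0)) := by
      refine tendsto_const_nhds.add ?_
      have h := (tendsto_one_div_add_atTop_nhds_zero_nat (𝕜 := ℝ)).mul_const ((K : ℝ) / 2)
      rw [zero_mul] at h
      simpa [Function.comp_def] using (ENNReal.continuous_ofReal.tendsto 0).comp h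
    rw [add_zero] at hlim
    rw [← hlim.liminf_eq]
    refine liminf_le_liminf (Eventually.of_forall fun n => ?_)
    set t : ℝ := 1 / (n + 1) with ht
    have ht0 : 0 < t := by positivity
    have hm := measurable_tiltExponent W η (e u) t
    have hm' := measurable_tiltExponent W' η' u t
    have hB' := measurable_comp_right e hB
    have hle1 : ∀ᵐ β ∂(h22Eta W η), Real.exp (-tiltExponent W η (e u) t β) ≤ 1 := by
      filter_upwards [ae_posDef_h22Eta hW η] with β hβ
      have := tiltExponent_nonneg hW0 hη hβ (e u) ht0.le
      exact Real.exp_le_one_iff.2 (by linarith)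
    have hle2 : ∀ᵐ x ∂(h22Eta W' η'), Real.exp (-tiltExponent W' η' u t x) ≤ 1 := by
      filter_upwards [ae_posDef_h22Eta hW' η'] with β hβ
      have := tiltExponent_nonneg hW0' hη' hβ u ht0.le
      exact Real.exp_le_one_iff.2 (by linarith)
    have htilt := setLIntegral_exp_tilt he hW hW0 hη u ht0.le hB
    have hfin : ∫⁻ x in B, ENNReal.ofReal (Real.exp (-tiltExponent W' η' u t x)) ∂(h22Eta W' η')
        ≠ ∞ := by
      refine ne_top_of_le_ne_top ENNReal.one_ne_top ((lintegral_mono_ae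
        (ae_restrict_of_ae (hle2.mono fun x hx => ENNReal.ofReal_le_ofReal hx))).trans ?_)
      simpa using prob_le_one
    have heq : ∫⁻ β in (fun β => β ∘ e) ⁻¹' B, ENNReal.ofReal (t⁻¹ *
          (1 - Real.exp (-tiltExponent W η (e u) t β))) ∂(h22Eta W η)
        = ∫⁻ x in B, ENNReal.ofReal (t⁻¹ *
          (1 - Real.exp (-tiltExponent W' η' u t x))) ∂(h22Eta W' η') := by
      simp_rw [ENNReal.ofReal_mul (inv_pos.2 ht0).le, ENNReal.ofReal_sub _ (Real.exp_pos _).le]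
      rw [lintegral_const_mul' _ _ ENNReal.ofReal_ne_top, lintegral_const_mul' _ _
        ENNReal.ofReal_ne_top, lintegral_sub (by fun_prop) (htilt ▸ hfin)
        (ae_restrict_of_ae (hle1.mono fun x hx => ENNReal.ofReal_le_ofReal hx)),
        lintegral_sub (by fun_prop) hfin
        (ae_restrict_of_ae (hle2.mono fun x hx => ENNReal.ofReal_le_ofReal hx)), htilt]
      simp only [ENNReal.ofReal_one, lintegral_const, one_mul, Measure.restrict_apply_univ]
      rw [← hmap, Measure.map_apply (measurable_comp_right e) hB]
    rw [heq]
    -- By `1 - exp (-x) ≤ x` the quotient is at most the field plus `t / 2` times the Green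
    -- function. The bound `K` makes this error vanish with `t`, which gives the direction that
    -- Fatou's lemma does not.
    calc _ ≤ ∫⁻ x in B, (ENNReal.ofReal (field W' η' x u) + ENNReal.ofReal (t * (K / 2)))
          ∂(h22Eta W' η') := by
          refine setLIntegral_mono_ae ((measurable_field W' η').eval.ennreal_ofReal.add_const
            _).aemeasurable ?_
          filter_upwards [ae_posDef_h22Eta hW' η'] with x hx hxB
          rw [← ENNReal.ofReal_add (field_nonneg hW0' hη' hx u) (by positivity)]
          refine ENNReal.ofReal_le_ofReal ?_
          rw [inv_mul_le_iff₀ ht0]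
          have h1 := Real.add_one_le_exp (-tiltExponent W' η' u t x)
          have h2 : tiltExponent W' η' u t x ≤ t * (field W' η' x u + t * (K / 2)) := by
            have := hK x hxB
            unfold tiltExponent
            nlinarith [sq_nonneg t]
          linarith
      _ ≤ _ := by
          rw [lintegral_add_right _ measurable_const]
          gcongr
          simp only [lintegral_const, Measure.restrict_apply_univ]
          exact mul_le_of_le_one_right' prob_le_one
  -- exhaust
  set C : ℕ → Set (U → ℝ) := fun K => A ∩ {x | (schrodinger W' x)⁻¹ u u ≤ K} with hC
  have hCm : ∀ K, MeasurableSet (C K) := fun K =>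
    hA.inter (measurableSet_le (measurable_schrodinger_inv W' u u) measurable_const)
  have hCmono : Monotone C := fun K L hKL x hx => ⟨hx.1, le_trans (b := (K : ℝ)) hx.2 (Nat.cast_le.2 hKL)⟩
  have hCU : ⋃ K, C K = A := by
    rw [← Set.inter_iUnion, Set.inter_eq_left]
    intro x _
    obtain ⟨K, hK⟩ := exists_nat_ge ((schrodinger W' x)⁻¹ u u)
    exact Set.mem_iUnion.2 ⟨K, hK⟩
  have hpre : (fun β : V → ℝ => β ∘ e) ⁻¹' A = ⋃ K, (fun β : V → ℝ => β ∘ e) ⁻¹' C K := by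
    rw [← Set.preimage_iUnion, hCU]
  rw [hpre, setLIntegral_iUnion_of_directed _
    (monotone_nat_of_le_succ fun K => Set.preimage_mono (hCmono K.le_succ)).directed_le]
  refine iSup_le fun K => (key K (C K) (hCm K) fun x hx => hx.2).trans ?_
  exact lintegral_mono_set Set.inter_subset_left

end Tilt

end H22

namespace H22

/-! ### The hierarchical lattice -/

/-- The block partitions become coarser with `n`, and any two vertices eventually share a block, so
the infimum is attained and every larger level qualifies. -/
lemma hierDist_le_iff {i j n : ℕ} : hierDist i j ≤ n ↔ i / 2 ^ n = j / 2 ^ n := by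
  have hne : {n | i / 2 ^ n = j / 2 ^ n}.Nonempty := by
    refine ⟨i + j, ?_⟩
    have h : ∀ k ≤ i + j, k / 2 ^ (i + j) = 0 := fun k hk =>
      Nat.div_eq_of_lt (hk.trans_lt Nat.lt_two_pow_self)
    rw [Set.mem_ofPred_eq, h i (by omega), h j (by omega)]
  have hmono : ∀ {a b : ℕ}, a ≤ b → i / 2 ^ a = j / 2 ^ a → i / 2 ^ b = j / 2 ^ b := by
    intro a b hab h
    obtain ⟨c, rfl⟩ := Nat.exists_eq_add_of_le hab
    rw [pow_add, ← Nat.div_div_eq_div_mul, ← Nat.div_div_eq_div_mul, h]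
  exact ⟨fun h => hmono h (Nat.sInf_mem hne), fun h => Nat.sInf_le h⟩

lemma hierDist_eq_of_forall {i j i' j' : ℕ}
    (h : ∀ n, i / 2 ^ n = j / 2 ^ n ↔ i' / 2 ^ n = j' / 2 ^ n) :
    hierDist i j = hierDist i' j' := by
  unfold hierDist
  congr 1
  ext n
  exact h n

lemma hierDist_eq_succ {i j n : ℕ} (h : i / 2 ^ (n + 1) = j / 2 ^ (n + 1))
    (h' : i / 2 ^ n ≠ j / 2 ^ n) : hierDist i j = n + 1 := by
  have h1 := hierDist_le_iff.2 h
  have h2 := hierDist_le_iff.not.2 h'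
  omega

lemma hierDist_comm (i j : ℕ) : hierDist i j = hierDist j i :=
  hierDist_eq_of_forall fun _ => eq_comm

lemma mem_hierAut_iff {g : Equiv.Perm ℕ} :
    g ∈ hierAut ↔ ∀ i j n, g i / 2 ^ n = g j / 2 ^ n ↔ i / 2 ^ n = j / 2 ^ n := by
  refine ⟨fun h i j n => ?_, fun h i j => hierDist_eq_of_forall (h i j)⟩
  rw [← hierDist_le_iff, ← hierDist_le_iff, h i j]

/-- Exclusive or with a fixed number, a translation of the hierarchical lattice. -/
def xorPerm (a : ℕ) : Equiv.Perm ℕ :=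
  Function.Involutive.toPerm (fun i => i ^^^ a) fun i => by simp

lemma xorPerm_apply (a i : ℕ) : xorPerm a i = i ^^^ a := rfl

lemma xorPerm_mem (a : ℕ) : xorPerm a ∈ hierAut := by
  rw [mem_hierAut_iff]
  intro i j n
  simp only [xorPerm_apply, ← Nat.shiftRight_eq_div_pow, Nat.shiftRight_xor_distrib]
  exact ⟨fun h => by simpa [Nat.xor_assoc] using congrArg (· ^^^ (a >>> n)) h, fun h => by rw [h]⟩

lemma blockSwap_apply (m i : ℕ) : blockSwap m i
    = if i < 2 ^ m then i + 2 ^ m else if i < 2 ^ (m + 1) then i - 2 ^ m else i := rfl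

lemma blockSwap_mem (m : ℕ) : blockSwap m ∈ hierAut := by
  have key : ∀ i j n, i / 2 ^ n = j / 2 ^ n →
      blockSwap m i / 2 ^ n = blockSwap m j / 2 ^ n := by
    intro i j n h
    rcases Nat.lt_or_ge m n with hmn | hnm
    · have h0 : ∀ i, blockSwap m i / 2 ^ n = i / 2 ^ n := by
        intro i
        have h1 : 2 ^ (m + 1) ≤ 2 ^ n := Nat.pow_le_pow_right two_pos hmn
        have h2 : 2 ^ (m + 1) = 2 * 2 ^ m := by rw [pow_succ, mul_comm]
        rw [blockSwap_apply]
        split_ifs with hi hi'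
        · rw [Nat.div_eq_of_lt (by omega), Nat.div_eq_of_lt (by omega)]
        · rw [Nat.div_eq_of_lt (by omega), Nat.div_eq_of_lt (by omega)]
        · rfl
      rw [h0, h0, h]
    · obtain ⟨c, rfl⟩ := Nat.exists_eq_add_of_le hnm
      have hlt : ∀ k, i < 2 ^ (n + k) ↔ j < 2 ^ (n + k) := by
        intro k
        rw [pow_add, mul_comm, ← Nat.div_lt_iff_lt_mul (by positivity),
          ← Nat.div_lt_iff_lt_mul (by positivity), h]
      have h1 := hlt c
      have h2 := hlt (c + 1)
      rw [blockSwap_apply, blockSwap_apply, add_assoc]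
      simp only [h1, h2]
      have hc : 2 ^ (n + c) = 2 ^ n * 2 ^ c := pow_add _ _ _
      split_ifs with hj hj'
      · rw [hc, Nat.add_mul_div_left _ _ (by positivity), Nat.add_mul_div_left _ _ (by positivity),
          h]
      · rw [hc, Nat.sub_mul_div, Nat.sub_mul_div, h]
      · exact h
  rw [mem_hierAut_iff]
  refine fun i j n => ⟨fun h => ?_, key i j n⟩
  have hinv : ∀ i, blockSwap m (blockSwap m i) = i :=
    Function.Involutive.toPerm_involutive _
  simpa [hinv] using key _ _ n h

lemma blockSwapGroup_le : blockSwapGroup ≤ hierAut := by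
  rw [blockSwapGroup, Subgroup.closure_le]
  rintro g ⟨n, -, rfl⟩
  exact blockSwap_mem n

/-- As soon as `Λ_m` contains `g 0`, it is the ball of radius `m` around `0` and around `g 0`, and
an isometry maps the one onto the other. -/
lemma exists_forall_lt_iff {g : Equiv.Perm ℕ} (hg : g ∈ hierAut) :
    ∃ M, ∀ m ≥ M, ∀ i, g i < 2 ^ m ↔ i < 2 ^ m := by
  refine ⟨g 0, fun m hm i => ?_⟩
  have h0 : g 0 / 2 ^ m = 0 :=
    Nat.div_eq_of_lt (lt_of_le_of_lt hm Nat.lt_two_pow_self)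
  have h := mem_hierAut_iff.1 hg i 0 m
  rw [h0, Nat.zero_div, Nat.div_eq_zero_iff_lt (by positivity),
    Nat.div_eq_zero_iff_lt (by positivity)] at h
  exact h

/-- The weights `w 4^{-d(i,j)}` on the whole lattice. -/
noncomputable def latticeWeight (w : ℝ) (i j : ℕ) : ℝ :=
  if i = j then 0 else w * ((4 : ℝ) ^ hierDist i j)⁻¹

/-- The total weight between a vertex of `Λ_n` and the complement of `Λ_n`. -/
noncomputable def boundaryWeight (w : ℝ) (n : ℕ) : ℝ := w * (((2 : ℝ) ^ n)⁻¹ / 2)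

variable {w : ℝ}

lemma latticeWeight_comm (i j : ℕ) : latticeWeight w i j = latticeWeight w j i := by
  simp [latticeWeight, eq_comm, hierDist_comm i j]

lemma latticeWeight_nonneg (hw : 0 < w) (i j : ℕ) : 0 ≤ latticeWeight w i j := by
  unfold latticeWeight; split_ifs <;> positivity

lemma latticeWeight_pos (hw : 0 < w) {i j : ℕ} (h : i ≠ j) : 0 < latticeWeight w i j := by
  rw [latticeWeight, if_neg h]; positivity

lemma boundaryWeight_pos (hw : 0 < w) (n : ℕ) : 0 < boundaryWeight w n := by
  unfold boundaryWeight; positivity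

lemma latticeWeight_congr {i j i' j' : ℕ}
    (h : ∀ n, i / 2 ^ n = j / 2 ^ n ↔ i' / 2 ^ n = j' / 2 ^ n) :
    latticeWeight w i j = latticeWeight w i' j' := by
  have h0 : i = j ↔ i' = j' := by simpa using h 0
  simp only [latticeWeight, h0, hierDist_eq_of_forall h]

lemma latticeWeight_block (k n : ℕ) {i j : ℕ} (hi : i < 2 ^ n) (hj : j < 2 ^ n) :
    latticeWeight w (k * 2 ^ n + i) (k * 2 ^ n + j) = latticeWeight w i j := by
  refine latticeWeight_congr fun d => ?_
  rcases Nat.le_total d n with h | h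
  · obtain ⟨c, rfl⟩ := Nat.exists_eq_add_of_le h
    have : k * 2 ^ (d + c) = 2 ^ d * (k * 2 ^ c) := by rw [pow_add]; ring
    rw [this, Nat.mul_add_div (by positivity), Nat.mul_add_div (by positivity)]
    omega
  · obtain ⟨c, rfl⟩ := Nat.exists_eq_add_of_le h
    have h1 : ∀ i < 2 ^ n, (k * 2 ^ n + i) / 2 ^ (n + c) = k / 2 ^ c := fun i hi => by
      rw [pow_add, ← Nat.div_div_eq_div_mul, mul_comm k, Nat.mul_add_div (by positivity),
        Nat.div_eq_of_lt hi, add_zero]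
    have h2 : ∀ i < 2 ^ n, i / 2 ^ (n + c) = 0 := fun i hi =>
      Nat.div_eq_of_lt (hi.trans_le (Nat.pow_le_pow_right two_pos h))
    simp [h1 i hi, h1 j hj, h2 i hi, h2 j hj]

lemma latticeWeight_cross {n : ℕ} {i j : ℕ} (hi : i < 2 ^ n) (hj : 2 ^ n ≤ j)
    (hj' : j < 2 ^ (n + 1)) : latticeWeight w i j = w * ((4 : ℝ) ^ (n + 1))⁻¹ := by
  rw [latticeWeight, if_neg (by omega), hierDist_eq_succ]
  · rw [Nat.div_eq_of_lt hj', Nat.div_eq_of_lt (hi.trans (Nat.pow_lt_pow_right one_lt_two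
      n.lt_succ_self))]
  · rw [Nat.div_eq_of_lt hi]
    exact (Nat.div_pos hj (by positivity)).ne

/-- Passing from `n` to `n + 1` adds `2 ^ n` vertices at distance `n + 1`, of weight `w 4^{-(n+1)}`
each; this is exactly the decrease of `boundaryWeight`. -/
lemma sum_latticeWeight_add (n i : ℕ) (hi : i < 2 ^ n) :
    ∑ j ∈ Finset.range (2 ^ n), latticeWeight w i j + boundaryWeight w n = w / 2 := by
  induction n generalizing i with
  | zero =>
    have : i = 0 := by simpa using hi
    subst this
    simp [latticeWeight, boundaryWeight]; ring
  | succ n ih =>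
    have h2 : 2 ^ (n + 1) = 2 ^ n + 2 ^ n := by rw [pow_succ]; ring
    have hb : boundaryWeight w n = 2 ^ n * (w * ((4 : ℝ) ^ (n + 1))⁻¹)
        + boundaryWeight w (n + 1) := by
      unfold boundaryWeight
      rw [show (4 : ℝ) = 2 * 2 by norm_num, mul_pow, pow_succ]
      field_simp
      norm_num
    rw [h2, Finset.sum_range_add]
    rcases Nat.lt_or_ge i (2 ^ n) with h | h
    · have : ∀ j ∈ Finset.range (2 ^ n), latticeWeight w i (2 ^ n + j)
          = w * ((4 : ℝ) ^ (n + 1))⁻¹ := fun j hj => by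
        have := Finset.mem_range.1 hj
        exact latticeWeight_cross h (by omega) (by omega)
      rw [Finset.sum_congr rfl this, Finset.sum_const, Finset.card_range, nsmul_eq_mul]
      have := ih i h
      push_cast
      linarith
    · obtain ⟨i, rfl⟩ := Nat.exists_eq_add_of_le h
      have hi' : i < 2 ^ n := by omega
      have h3 : ∀ j ∈ Finset.range (2 ^ n), latticeWeight w (2 ^ n + i) j
          = w * ((4 : ℝ) ^ (n + 1))⁻¹ := fun j hj => by
        have := Finset.mem_range.1 hj
        rw [latticeWeight_comm]
        exact latticeWeight_cross this (by omega) (by omega)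
      have h4 : ∀ j ∈ Finset.range (2 ^ n), latticeWeight w (2 ^ n + i) (2 ^ n + j)
          = latticeWeight w i j := fun j hj => by
        simpa using latticeWeight_block (w := w) 1 n hi' (Finset.mem_range.1 hj)
      rw [Finset.sum_congr rfl h3, Finset.sum_congr rfl h4, Finset.sum_const, Finset.card_range,
        nsmul_eq_mul]
      have := ih i hi'
      push_cast
      linarith

lemma sum_fin_latticeWeight (n i : ℕ) (hi : i < 2 ^ n) :
    ∑ j : Fin (2 ^ n), latticeWeight w i j = w / 2 - boundaryWeight w n := by
  rw [Fin.sum_univ_eq_sum_range (fun j => latticeWeight w i j)]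
  linarith [sum_latticeWeight_add (w := w) n i hi]

/-- The law of the random potential on `Λ_n`. -/
noncomputable def ballLaw (w : ℝ) (n : ℕ) : Measure (Fin (2 ^ n) → ℝ) :=
  h22Eta (fun i j => latticeWeight w i j) (fun _ => boundaryWeight w n)

lemma isProbabilityMeasure_ballLaw (hw : 0 < w) (n : ℕ) : IsProbabilityMeasure (ballLaw w n) :=
  isProbabilityMeasure_h22Eta (fun _ _ => latticeWeight_comm _ _)
    (fun _ _ => latticeWeight_nonneg hw _ _) fun _ => (boundaryWeight_pos hw n).le

/-- Because the total weight at a vertex is always `w / 2`, the ambient ball drops out: only the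
weights inside the image of `e` matter. -/
lemma map_comp_ballLaw_eq_h22Eta (hw : 0 < w) {n : ℕ} {U : Type*} [Fintype U] [DecidableEq U]
    {e : U → Fin (2 ^ n)} (he : Function.Injective e) :
    (ballLaw w n).map (fun β => β ∘ e) = h22Eta (fun i j => latticeWeight w (e i) (e j))
      (fun i => w / 2 - ∑ u, latticeWeight w (e i) (e u)) := by
  rw [ballLaw, map_comp_h22Eta he (fun _ _ => latticeWeight_comm _ _)
    (fun _ _ => latticeWeight_nonneg hw _ _) fun _ => (boundaryWeight_pos hw n).le]
  congr 1
  funext i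
  rw [sum_fin_latticeWeight n _ (e i).isLt]
  ring

/-- The common source of the symmetries: consistency of the balls, invariance under automorphisms,
the exchange of siblings and the embedding of blocks are all instances. -/
lemma map_comp_ballLaw (hw : 0 < w) {n m : ℕ} {e : Fin (2 ^ n) → Fin (2 ^ m)}
    (he : ∀ i j, latticeWeight w (e i) (e j) = latticeWeight w i j) :
    (ballLaw w m).map (fun β => β ∘ e) = ballLaw w n := by
  -- Weights vanish on the diagonal and are positive off it, so preserving them forces injectivity.
  have hinj : Function.Injective e := by
    intro i j h
    by_contra hne
    have h1 := he i j
    rw [h] at h1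
    have h2 := latticeWeight_pos hw (fun h => hne (Fin.ext h) : (i : ℕ) ≠ j)
    rw [← h1] at h2
    simp [latticeWeight] at h2
  rw [map_comp_ballLaw_eq_h22Eta hw hinj, ballLaw]
  simp only [he]
  congr 1
  funext i
  rw [sum_fin_latticeWeight n _ i.isLt]
  ring

end H22

namespace H22

open ProbabilityTheory

/-! ### Projective sequences of laws -/

/-- A sequence of laws, each of which is the image of the next one, is the sequence of laws of
the components of a random sequence each of whose terms is a function of the next one. -/
theorem exists_measure_of_consistent {E : ℕ → Type} [∀ n, MeasurableSpace (E n)]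
    [∀ n, StandardBorelSpace (E n)] [∀ n, Nonempty (E n)] (ν : ∀ n, Measure (E n))
    [∀ n, IsProbabilityMeasure (ν n)] (p : ∀ n, E (n + 1) → E n) (hp : ∀ n, Measurable (p n))
    (hν : ∀ n, (ν (n + 1)).map (p n) = ν n) :
    ∃ P : Measure (∀ n, E n), IsProbabilityMeasure P ∧ (∀ n, P.map (fun x => x n) = ν n) ∧
      ∀ n, ∀ᵐ x ∂P, p n (x (n + 1)) = x n := by
  let f : ∀ n, (∀ i : Finset.Iic n, E i) → E n := fun n x => x ⟨n, Finset.mem_Iic.2 le_rfl⟩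
  have hf : ∀ n, Measurable (f n) := fun n => measurable_pi_apply _
  -- A Markov chain from coarse to fine: term `n + 1` is drawn from its conditional law under `ν (n
  -- + 1)` given its image under `p n`, and the past enters only through term `n`.
  let κ : ∀ n, Kernel (∀ i : Finset.Iic n, E i) (E (n + 1)) := fun n =>
    (condDistrib id (p n) (ν (n + 1))).comap (f n) (hf n)
  let P := Kernel.trajMeasure (ν 0) κ
  have hmap : ∀ n, (P.map (Preorder.frestrictLe n)).map (f n) = P.map (fun x => x n) := fun n => by
    rw [Measure.map_map (hf n) (by fun_prop)]; rfl
  have h0 : P.map (fun x => x 0) = ν 0 := by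
    rw [← hmap, show P = (Kernel.traj κ 0) ∘ₘ ((ν 0).map (MeasurableEquiv.piUnique _).symm) from rfl,
      Measure.map_comp _ _ (by fun_prop), Kernel.traj_map_frestrictLe, Kernel.partialTraj_self,
      Measure.id_comp]
    exact (Measure.map_map (hf 0) (MeasurableEquiv.measurable _)).trans Measure.map_id
  have hjoint : ∀ n, P.map (fun x => x n) = ν n →
      P.map (fun x => (x n, x (n + 1))) = (ν (n + 1)).map (fun x => (p n x, x)) := by
    intro n hn
    have h1 := Kernel.map_frestrictLe_trajMeasure_compProd_eq_map_trajMeasure (μ₀ := ν 0) (κ := κ)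
      (a := n)
    change P.map (Preorder.frestrictLe n) ⊗ₘ κ n = P.map _ at h1
    have h2 := congrArg (fun μ => μ.map (Prod.map (f n) id)) h1
    beta_reduce at h2
    rw [Measure.map_map ((hf n).prodMap measurable_id) (by fun_prop)] at h2
    have h3 := compProd_map_condDistrib (mβ := inferInstance) (X := p n) (Y := id) (μ := ν (n + 1)) aemeasurable_id
    refine h2.symm.trans (Eq.trans ?_ h3)
    rw [hν, ← hn, ← hmap]
    ext s hs
    rw [Measure.map_apply ((hf n).prodMap measurable_id) hs, Measure.compProd_apply
      (((hf n).prodMap measurable_id) hs), Measure.compProd_apply hs, lintegral_map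
      (Kernel.measurable_kernel_prodMk_left hs) (hf n)]
    rfl
  have hmarg : ∀ n, P.map (fun x => x n) = ν n := by
    intro n
    induction n with
    | zero => exact h0
    | succ n ih =>
      have := congrArg (fun μ => μ.map Prod.snd) (hjoint n ih)
      beta_reduce at this
      rw [Measure.map_map measurable_snd (by fun_prop), Measure.map_map measurable_snd
        (by have := hp n; fun_prop)] at this
      exact this.trans Measure.map_id
  refine ⟨P, inferInstance, hmarg, fun n => ?_⟩
  have hs : MeasurableSet {q : E n × E (n + 1) | p n q.2 = q.1} :=
    measurableSet_eq_fun ((hp n).comp measurable_snd) measurable_fst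
  have h1 : ∀ᵐ q ∂(P.map (fun x => (x n, x (n + 1)))), p n q.2 = q.1 := by
    rw [hjoint n (hmarg n), ae_map_iff (by have := hp n; fun_prop) hs]
    simp
  rwa [ae_map_iff (by fun_prop) hs] at h1

/-! ### The law of the potential on the whole lattice -/

/-- Restriction of a configuration to `Λ_n`. -/
def restrictBall (n : ℕ) (b : ℕ → ℝ) : Fin (2 ^ n) → ℝ := fun i => b i

lemma measurable_restrictBall (n : ℕ) : Measurable (restrictBall n) :=
  measurable_pi_lambda _ fun _ => measurable_pi_apply _

/-- A law on the lattice is determined by its restrictions to the balls `Λ_n`. -/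
lemma ext_of_map_restrictBall {μ ν : Measure (ℕ → ℝ)} [IsFiniteMeasure μ]
    (h : ∀ n, μ.map (restrictBall n) = ν.map (restrictBall n)) : μ = ν := by
  have hfin : ∀ I : Finset ℕ, μ.map I.restrict = ν.map I.restrict := by
    intro I
    obtain ⟨n, hn⟩ : ∃ n, ∀ i ∈ I, i < 2 ^ n := by
      refine ⟨I.sup id, fun i hi => lt_of_le_of_lt ?_ Nat.lt_two_pow_self⟩
      exact Finset.le_sup (f := id) hi
    let r : (Fin (2 ^ n) → ℝ) → (I → ℝ) := fun x i => x ⟨i, hn i i.2⟩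
    have hr : Measurable r := measurable_pi_lambda _ fun _ => measurable_pi_apply _
    have hc : (I.restrict : (ℕ → ℝ) → (I → ℝ)) = r ∘ restrictBall n := rfl
    rw [hc, ← Measure.map_map hr (measurable_restrictBall n), h,
      Measure.map_map hr (measurable_restrictBall n)]
  have h1 : IsProjectiveLimit μ (fun I => μ.map I.restrict) := fun I => rfl
  have h2 : IsProjectiveLimit ν (fun I => μ.map I.restrict) := fun I => (hfin I).symm
  exact h1.unique h2

/-- The ball laws form a projective sequence under restriction to the next smaller ball. Coordinate
`i` is read off at level `i`, which is possible since `i < 2 ^ i`. -/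
lemma exists_latticeLaw {w : ℝ} (hw : 0 < w) : ∃ μ : Measure (ℕ → ℝ), IsProbabilityMeasure μ ∧
    ∀ n, μ.map (restrictBall n) = ballLaw w n := by
  have hlt : ∀ n : ℕ, 2 ^ n ≤ 2 ^ (n + 1) := fun n => Nat.pow_le_pow_right two_pos n.le_succ
  let p : ∀ n, (Fin (2 ^ (n + 1)) → ℝ) → (Fin (2 ^ n) → ℝ) := fun n x =>
    x ∘ Fin.castLE (hlt n)
  have hp : ∀ n, Measurable (p n) := fun n => measurable_comp_right _
  have := isProbabilityMeasure_ballLaw hw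
  obtain ⟨P, hP, hmarg, hcons⟩ := exists_measure_of_consistent (E := fun n => Fin (2 ^ n) → ℝ)
    (ballLaw w) p hp (fun n => map_comp_ballLaw hw fun i j => rfl)
  let F : (∀ n, Fin (2 ^ n) → ℝ) → ℕ → ℝ := fun x i => x i ⟨i, Nat.lt_two_pow_self⟩
  have hF : Measurable F := measurable_pi_lambda _ fun i =>
    (measurable_pi_apply _).comp (measurable_pi_apply i)
  refine ⟨P.map F, Measure.isProbabilityMeasure_map hF.aemeasurable, fun n => ?_⟩
  rw [Measure.map_map (measurable_restrictBall n) hF, ← hmarg n]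
  refine Measure.map_congr ?_
  filter_upwards [ae_all_iff.2 hcons] with x hx
  have key : ∀ m k (i : ℕ) (hi : i < 2 ^ m) (hi' : i < 2 ^ (m + k)),
      x (m + k) ⟨i, hi'⟩ = x m ⟨i, hi⟩ := by
    intro m k
    induction k with
    | zero => intro i hi hi'; rfl
    | succ k ih =>
      intro i hi hi'
      have hlt' : i < 2 ^ (m + k) := hi.trans_le (Nat.pow_le_pow_right two_pos (by omega))
      rw [← ih i hi hlt', ← hx (m + k)]
      rfl
  have key2 : ∀ m m' (i : ℕ) (hi : i < 2 ^ m) (hi' : i < 2 ^ m'),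
      x m ⟨i, hi⟩ = x m' ⟨i, hi'⟩ := by
    intro m m' i hi hi'
    rcases Nat.le_total m m' with h | h
    · obtain ⟨k, rfl⟩ := Nat.exists_eq_add_of_le h
      exact (key m k i hi hi').symm
    · obtain ⟨k, rfl⟩ := Nat.exists_eq_add_of_le h
      exact key m' k i hi' hi
  funext i
  exact key2 _ _ _ _ _

/-- The law of the random potential on the whole lattice. -/
noncomputable def latticeLaw {w : ℝ} (hw : 0 < w) : Measure (ℕ → ℝ) :=
  (exists_latticeLaw hw).choose

instance {w : ℝ} (hw : 0 < w) : IsProbabilityMeasure (latticeLaw hw) :=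
  (exists_latticeLaw hw).choose_spec.1

lemma map_restrictBall_latticeLaw {w : ℝ} (hw : 0 < w) (n : ℕ) :
    (latticeLaw hw).map (restrictBall n) = ballLaw w n :=
  (exists_latticeLaw hw).choose_spec.2 n

lemma measurable_comp_nat (g : ℕ → ℕ) : Measurable fun b : ℕ → ℝ => b ∘ g :=
  measurable_pi_lambda _ fun _ => measurable_pi_apply _

lemma map_comp_latticeLaw {w : ℝ} (hw : 0 < w) {n : ℕ} {e : Fin (2 ^ n) → ℕ}
    (he : ∀ i j, latticeWeight w (e i) (e j) = latticeWeight w i j) :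
    (latticeLaw hw).map (fun b => b ∘ e) = ballLaw w n := by
  obtain ⟨m, hm⟩ : ∃ m, ∀ i, e i < 2 ^ m :=
    ⟨Finset.univ.sup e, fun i => lt_of_le_of_lt (Finset.le_sup (Finset.mem_univ i))
      Nat.lt_two_pow_self⟩
  let e' : Fin (2 ^ n) → Fin (2 ^ m) := fun i => ⟨e i, hm i⟩
  have hc : (fun b : ℕ → ℝ => b ∘ e) = (fun x => x ∘ e') ∘ restrictBall m := rfl
  rw [hc, ← Measure.map_map (measurable_comp_right e') (measurable_restrictBall m),
    map_restrictBall_latticeLaw, map_comp_ballLaw hw he]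

lemma measurePreserving_comp_latticeLaw {w : ℝ} (hw : 0 < w) {g : Equiv.Perm ℕ}
    (hg : g ∈ hierAut) :
    MeasurePreserving (fun b : ℕ → ℝ => b ∘ g) (latticeLaw hw) (latticeLaw hw) := by
  refine ⟨measurable_comp_nat g, ?_⟩
  have : IsProbabilityMeasure ((latticeLaw hw).map fun b : ℕ → ℝ => b ∘ g) :=
    Measure.isProbabilityMeasure_map (measurable_comp_nat g).aemeasurable
  refine ext_of_map_restrictBall fun n => ?_
  rw [Measure.map_map (measurable_restrictBall n) (measurable_comp_nat g),
    map_restrictBall_latticeLaw]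
  exact map_comp_latticeLaw hw (e := fun i => g i) fun i j =>
    latticeWeight_congr fun n => mem_hierAut_iff.1 hg i j n

end H22

namespace H22

/-! ### Asymptotic independence of far away balls -/

/-- Convergence at positive definite points of the limit model is all that an application of Fatou's
lemma needs. -/
lemma tendsto_h22Density {V ι : Type*} [Fintype V] [DecidableEq V] {l : Filter ι}
    {Ws : ι → V → V → ℝ} {ηs : ι → V → ℝ} {W : V → V → ℝ} {η : V → ℝ}
    (hWs : ∀ k i j, Ws k i j = Ws k j i) (hW : ∀ i j, Tendsto (fun k => Ws k i j) l (𝓝 (W i j)))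
    (hη : ∀ i, Tendsto (fun k => ηs k i) l (𝓝 (η i))) {β : V → ℝ}
    (hβ : (schrodinger W β).PosDef) :
    Tendsto (fun k => h22Density (Ws k) (ηs k) β) l (𝓝 (h22Density W η β)) := by
  have hH : Tendsto (fun k => schrodinger (Ws k) β) l (𝓝 (schrodinger W β)) := by
    refine tendsto_pi_nhds.2 fun i => tendsto_pi_nhds.2 fun j => ?_
    rcases eq_or_ne i j with rfl | h
    · simp only [schrodinger_diag]; exact tendsto_const_nhds
    · simp only [schrodinger_off _ _ h]; exact (hW i j).neg
  have hev := eventually_posDef hH hβ fun k => isHermitian_schrodinger (hWs k) β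
  have hη' : Tendsto ηs l (𝓝 η) := tendsto_pi_nhds.2 hη
  have hinv := (continuousAt_inv_of_posDef hβ).tendsto.comp hH
  have hdet : Tendsto (fun k => (schrodinger (Ws k) β).det) l (𝓝 (schrodinger W β).det) :=
    ((continuous_id.matrix_det).tendsto _).comp hH
  have hquad : Tendsto (fun k => ηs k ⬝ᵥ (schrodinger (Ws k) β)⁻¹.mulVec (ηs k)) l
      (𝓝 (η ⬝ᵥ (schrodinger W β)⁻¹.mulVec η)) := by
    have hc : Continuous fun p : (V → ℝ) × Matrix V V ℝ => p.1 ⬝ᵥ p.2.mulVec p.1 :=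
      continuous_fst.dotProduct (continuous_snd.matrix_mulVec continuous_fst)
    exact (hc.tendsto (η, (schrodinger W β)⁻¹)).comp (hη'.prodMk_nhds hinv)
  have hsumH : Tendsto (fun k => ∑ i, ∑ j, schrodinger (Ws k) β i j) l
      (𝓝 (∑ i, ∑ j, schrodinger W β i j)) := tendsto_finsetSum _ fun i _ =>
    tendsto_finsetSum _ fun j _ => tendsto_pi_nhds.1 (tendsto_pi_nhds.1 hH i) j
  have hsumη : Tendsto (fun k => ∑ i, ηs k i) l (𝓝 (∑ i, η i)) :=
    tendsto_finsetSum _ fun i _ => hη i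
  rw [h22Density_of_posDef hβ]
  refine Tendsto.congr' (hev.mono fun k hk => (h22Density_of_posDef hk).symm) ?_
  refine (ENNReal.continuous_ofReal.tendsto _).comp ?_
  refine Tendsto.div ?_ ((Real.continuous_sqrt.tendsto _).comp hdet)
    (Real.sqrt_pos.2 hβ.det_pos).ne'
  refine tendsto_const_nhds.mul ((Real.continuous_exp.tendsto _).comp ?_)
  exact ((hsumH.const_mul _).add hsumη).sub (hquad.const_mul _)

/-! ### Two copies of a graph joined by small weights -/

section Sum

variable {U : Type*} [Fintype U] [DecidableEq U]

/-- Two copies of a weighted graph, with weight `ε` between every pair of vertices from different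
copies. -/
def crossWeight (W : U → U → ℝ) (ε : ℝ) : U ⊕ U → U ⊕ U → ℝ
  | .inl i, .inl j => W i j
  | .inr i, .inr j => W i j
  | .inl _, .inr _ => ε
  | .inr _, .inl _ => ε

lemma crossWeight_comm {W : U → U → ℝ} (hW : ∀ i j, W i j = W j i) (ε : ℝ) (i j : U ⊕ U) :
    crossWeight W ε i j = crossWeight W ε j i := by
  rcases i with i | i <;> rcases j with j | j <;> simp [crossWeight, hW i j]

lemma schrodinger_crossWeight_zero (W : U → U → ℝ) (x : U ⊕ U → ℝ) :
    schrodinger (crossWeight W 0) x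
      = Matrix.fromBlocks (schrodinger W (x ∘ Sum.inl)) 0 0 (schrodinger W (x ∘ Sum.inr)) := by
  ext (i | i) (j | j) <;> simp [schrodinger, crossWeight]

lemma h22Density_crossWeight_zero {W : U → U → ℝ} (hW : ∀ i j, W i j = W j i) (η : U → ℝ)
    {x : U ⊕ U → ℝ} (h1 : (schrodinger W (x ∘ Sum.inl)).PosDef)
    (h2 : (schrodinger W (x ∘ Sum.inr)).PosDef) :
    (schrodinger (crossWeight W 0) x).PosDef ∧
    h22Density (crossWeight W 0) (Sum.elim η η) x
      = h22Density W η (x ∘ Sum.inl) * h22Density W η (x ∘ Sum.inr) := by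
  have hmul : ∀ y : U ⊕ U → ℝ, (schrodinger (crossWeight W 0) x).mulVec y
      = Sum.elim ((schrodinger W (x ∘ Sum.inl)).mulVec (y ∘ Sum.inl))
        ((schrodinger W (x ∘ Sum.inr)).mulVec (y ∘ Sum.inr)) := fun y => by
    rw [schrodinger_crossWeight_zero, Matrix.fromBlocks_mulVec]; simp
  have hdot : ∀ (y : U ⊕ U → ℝ) (a b : U → ℝ), y ⬝ᵥ Sum.elim a b
      = (y ∘ Sum.inl) ⬝ᵥ a + (y ∘ Sum.inr) ⬝ᵥ b := fun y a b => by
    simp [dotProduct, Fintype.sum_sum_type]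
  have hpd : (schrodinger (crossWeight W 0) x).PosDef := by
    refine posDef_of_forall_pos (isHermitian_schrodinger (crossWeight_comm hW 0) x) fun y hy => ?_
    rw [hmul, hdot]
    by_cases h : y ∘ Sum.inl = 0
    · have h' : y ∘ Sum.inr ≠ 0 := fun h' => hy (by
        funext i; rcases i with i | i
        · exact congrFun h i
        · exact congrFun h' i)
      exact add_pos_of_nonneg_of_pos (dotProduct_mulVec_nonneg h1 _) (dotProduct_mulVec_pos h2 h')
    · exact add_pos_of_pos_of_nonneg (dotProduct_mulVec_pos h1 h) (dotProduct_mulVec_nonneg h2 _)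
  refine ⟨hpd, ?_⟩
  rw [h22Density_of_posDef hpd, h22Density_of_posDef h1, h22Density_of_posDef h2,
    ← ENNReal.ofReal_mul (by positivity)]
  congr 1
  have hdet : (schrodinger (crossWeight W 0) x).det
      = (schrodinger W (x ∘ Sum.inl)).det * (schrodinger W (x ∘ Sum.inr)).det := by
    rw [schrodinger_crossWeight_zero, Matrix.det_fromBlocks_zero₂₁]
  have hinv : (schrodinger (crossWeight W 0) x)⁻¹.mulVec (Sum.elim η η)
      = Sum.elim ((schrodinger W (x ∘ Sum.inl))⁻¹.mulVec η)
        ((schrodinger W (x ∘ Sum.inr))⁻¹.mulVec η) := by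
    refine inv_mulVec_eq hpd ?_
    rw [hmul, Sum.elim_comp_inl, Sum.elim_comp_inr, mulVec_inv_mulVec h1, mulVec_inv_mulVec h2]
  have hsum : ∑ i, ∑ j, schrodinger (crossWeight W 0) x i j
      = ∑ i, ∑ j, schrodinger W (x ∘ Sum.inl) i j + ∑ i, ∑ j, schrodinger W (x ∘ Sum.inr) i j := by
    rw [schrodinger_crossWeight_zero]
    simp [Fintype.sum_sum_type]
  have hexp : ∀ S T E Q R : ℝ, Real.exp (-(1 / 2) * (S + T) + (E + E) - 1 / 2 * (Q + R))
      = Real.exp (-(1 / 2) * S + E - 1 / 2 * Q) * Real.exp (-(1 / 2) * T + E - 1 / 2 * R) :=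
    fun S T E Q R => by rw [← Real.exp_add]; ring_nf
  rw [hdet, hinv, hsum, hdot, Fintype.sum_sum_type, Fintype.card_sum, pow_add,
    Real.sqrt_mul h1.det_pos.le]
  simp only [Sum.elim_inl, Sum.elim_inr, Sum.elim_comp_inl, Sum.elim_comp_inr]
  rw [hexp]
  have := (Real.sqrt_pos.2 h1.det_pos).ne'
  have := (Real.sqrt_pos.2 h2.det_pos).ne'
  field_simp

/-- Without cross weights the density factorises. The indicator retains the points at which
`tendsto_h22Density` applies. -/
lemma mul_le_setLIntegral_crossWeight_zero {W : U → U → ℝ} (hW : ∀ i j, W i j = W j i)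
    (η : U → ℝ) {C D : Set (U → ℝ)} (hC : MeasurableSet C) (hD : MeasurableSet D) :
    h22Eta W η C * h22Eta W η D
      ≤ ∫⁻ x in {x : U ⊕ U → ℝ | x ∘ Sum.inl ∈ C ∧ x ∘ Sum.inr ∈ D},
        {x | (schrodinger (crossWeight W 0) x).PosDef}.indicator
          (h22Density (crossWeight W 0) (Sum.elim η η)) x := by
  have hmp := volume_measurePreserving_sumPiEquivProdPi (fun _ : U ⊕ U => ℝ)
  have hm := measurable_h22Density hW η
  have hS : MeasurableSet {x : U ⊕ U → ℝ | x ∘ Sum.inl ∈ C ∧ x ∘ Sum.inr ∈ D} :=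
    (measurable_comp_right Sum.inl hC).inter (measurable_comp_right Sum.inr hD)
  have hF : Measurable fun p : (U → ℝ) × (U → ℝ) =>
      C.indicator (h22Density W η) p.1 * D.indicator (h22Density W η) p.2 :=
    ((hm.indicator hC).comp measurable_fst).mul ((hm.indicator hD).comp measurable_snd)
  calc h22Eta W η C * h22Eta W η D
      = ∫⁻ p : (U → ℝ) × (U → ℝ), C.indicator (h22Density W η) p.1
          * D.indicator (h22Density W η) p.2 := by
        rw [h22Eta, withDensity_apply _ hC, withDensity_apply _ hD, ← lintegral_indicator hC,
          ← lintegral_indicator hD]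
        exact (lintegral_prod_mul (hm.indicator hC).aemeasurable
          (hm.indicator hD).aemeasurable).symm
    _ = ∫⁻ x : U ⊕ U → ℝ, C.indicator (h22Density W η) (x ∘ Sum.inl)
          * D.indicator (h22Density W η) (x ∘ Sum.inr) := by
        rw [← hmp.lintegral_comp hF]
        rfl
    _ ≤ _ := by
        rw [← lintegral_indicator hS]
        refine lintegral_mono fun x => ?_
        by_cases hx : x ∘ Sum.inl ∈ C ∧ x ∘ Sum.inr ∈ D
        swap
        · rcases not_and_or.1 hx with h | h <;> simp [h]
        rw [Set.indicator_of_mem hx.1, Set.indicator_of_mem hx.2, Set.indicator_of_mem (by exact hx)]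
        by_cases h1 : (schrodinger W (x ∘ Sum.inl)).PosDef
        swap
        · simp [h22Density_of_not_posDef h1]
        by_cases h2 : (schrodinger W (x ∘ Sum.inr)).PosDef
        swap
        · simp [h22Density_of_not_posDef h2]
        obtain ⟨h3, h4⟩ := h22Density_crossWeight_zero hW η h1 h2
        have h5 : x ∈ {x | (schrodinger (crossWeight W 0) x).PosDef} := h3
        rw [Set.indicator_of_mem h5, h4]

lemma mul_le_liminf_crossWeight {W : U → U → ℝ} (hW : ∀ i j, W i j = W j i)
    {η : U → ℝ} {ηs : ℕ → U ⊕ U → ℝ} {ε : ℕ → ℝ} (hε : Tendsto ε atTop (𝓝 0))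
    (hη : ∀ i, Tendsto (fun k => ηs k i) atTop (𝓝 (Sum.elim η η i)))
    {C D : Set (U → ℝ)} (hC : MeasurableSet C) (hD : MeasurableSet D) :
    h22Eta W η C * h22Eta W η D ≤ liminf (fun k => h22Eta (crossWeight W (ε k)) (ηs k)
      {x | x ∘ Sum.inl ∈ C ∧ x ∘ Sum.inr ∈ D}) atTop := by
  have hS : MeasurableSet {x : U ⊕ U → ℝ | x ∘ Sum.inl ∈ C ∧ x ∘ Sum.inr ∈ D} :=
    (measurable_comp_right Sum.inl hC).inter (measurable_comp_right Sum.inr hD)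
  refine (mul_le_setLIntegral_crossWeight_zero hW η hC hD).trans ?_
  simp_rw [h22Eta, withDensity_apply _ hS]
  refine le_trans (lintegral_mono fun x => ?_)
    (lintegral_liminf_le fun k => measurable_h22Density (crossWeight_comm hW (ε k)) (ηs k))
  by_cases hx : x ∈ {x | (schrodinger (crossWeight W 0) x).PosDef}
  swap
  · rw [Set.indicator_of_notMem hx]; exact bot_le
  rw [Set.indicator_of_mem hx]
  refine (Tendsto.liminf_eq (tendsto_h22Density (fun k => crossWeight_comm hW (ε k)) ?_ hη
    hx)).ge
  rintro (i | i) (j | j)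
  · exact tendsto_const_nhds
  · exact hε
  · exact hε
  · exact tendsto_const_nhds

end Sum

lemma blockSwap_of_lt {m i : ℕ} (h : i < 2 ^ m) : blockSwap m i = 2 ^ m + i := by
  rw [blockSwap_apply, if_pos h, add_comm]

/-- For `m ≥ n` all edges between `Λ_n` and its image under `blockSwap m` have weight `w
4^{-(m+1)}`, and on both sides the boundary term is `boundaryWeight w n` minus `2 ^ n` of these
weights. Both corrections vanish in the limit, which leaves two uncoupled copies. -/
theorem mul_le_liminf_latticeLaw {w : ℝ} (hw : 0 < w) (n : ℕ) {C D : Set (Fin (2 ^ n) → ℝ)}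
    (hC : MeasurableSet C) (hD : MeasurableSet D) :
    ballLaw w n C * ballLaw w n D ≤ liminf (fun m => latticeLaw hw
      {b | restrictBall n b ∈ C ∧ restrictBall n (b ∘ blockSwap m) ∈ D}) atTop := by
  set ε : ℕ → ℝ := fun m => w * ((4 : ℝ) ^ (m + 1))⁻¹ with hε
  have hε0 : Tendsto ε atTop (𝓝 0) := by
    have h1 : Tendsto (fun m : ℕ => ((4 : ℝ) ^ (m + 1))⁻¹) atTop (𝓝 0) :=
      tendsto_inv_atTop_zero.comp
        ((tendsto_pow_atTop_atTop_of_one_lt (by norm_num)).comp (tendsto_add_atTop_nat 1))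
    simpa using h1.const_mul w
  let W : Fin (2 ^ n) → Fin (2 ^ n) → ℝ := fun i j => latticeWeight w i j
  let ηs : ℕ → Fin (2 ^ n) ⊕ Fin (2 ^ n) → ℝ := fun m _ => boundaryWeight w n - 2 ^ n * ε m
  have hlim := mul_le_liminf_crossWeight (W := W) (fun _ _ => latticeWeight_comm _ _)
    (η := fun _ => boundaryWeight w n) (ηs := ηs) hε0 (fun i => by
      have h2 : Sum.elim (fun _ => boundaryWeight w n) (fun _ => boundaryWeight w n) i
          = boundaryWeight w n - 2 ^ n * 0 := by cases i <;> simp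
      rw [h2]
      exact tendsto_const_nhds.sub (hε0.const_mul _)) hC hD
  refine hlim.trans (le_of_eq (liminf_congr ?_))
  filter_upwards [eventually_ge_atTop n] with m hm
  have h2n : 2 ^ n ≤ 2 ^ m := Nat.pow_le_pow_right two_pos hm
  have h2m : 2 ^ (m + 1) = 2 ^ m + 2 ^ m := by rw [pow_succ]; ring
  let e : Fin (2 ^ n) ⊕ Fin (2 ^ n) → Fin (2 ^ (m + 1)) :=
    Sum.elim (fun i => ⟨i, by omega⟩) (fun i => ⟨2 ^ m + i, by omega⟩)
  have he : Function.Injective e := by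
    rintro (i | i) (j | j) h
    · exact congrArg Sum.inl (Fin.ext (Fin.mk.inj_iff.1 h))
    · have := Fin.mk.inj_iff.1 h; omega
    · have := Fin.mk.inj_iff.1 h; omega
    · have := Fin.mk.inj_iff.1 h; exact congrArg Sum.inr (Fin.ext (by omega))
  have hW : (fun i j => latticeWeight w (e i) (e j)) = crossWeight W (ε m) := by
    funext i j
    rcases i with i | i <;> rcases j with j | j
    · rfl
    · exact latticeWeight_cross (by simp only [Sum.elim_inl, e]; omega)
        (by simp only [Sum.elim_inr, e]; omega) (by simp only [Sum.elim_inr, e]; omega)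
    · rw [latticeWeight_comm]
      exact latticeWeight_cross (by simp only [Sum.elim_inl, e]; omega)
        (by simp only [Sum.elim_inr, e]; omega) (by simp only [Sum.elim_inr, e]; omega)
    · simpa [e, W, crossWeight] using latticeWeight_block (w := w) 1 m (i.isLt.trans_le h2n) (j.isLt.trans_le h2n)
  have hη : (fun i => w / 2 - ∑ u, latticeWeight w (e i) (e u)) = ηs m := by
    funext i
    have h1 : ∀ u, latticeWeight w (e i) (e u) = crossWeight W (ε m) i u := fun u =>
      congrFun (congrFun hW i) u
    simp only [h1, Fintype.sum_sum_type, ηs]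
    rcases i with i | i <;>
    · simp only [crossWeight, W, sum_fin_latticeWeight n _ i.isLt, Finset.sum_const,
        Finset.card_univ, Fintype.card_fin, nsmul_eq_mul]
      push_cast
      ring
  have hS : MeasurableSet {x : Fin (2 ^ n) ⊕ Fin (2 ^ n) → ℝ | x ∘ Sum.inl ∈ C ∧ x ∘ Sum.inr ∈ D} :=
    (measurable_comp_right Sum.inl hC).inter (measurable_comp_right Sum.inr hD)
  rw [← hW, ← hη, ← map_comp_ballLaw_eq_h22Eta hw he, ← map_restrictBall_latticeLaw hw,
    Measure.map_map (measurable_comp_right e) (measurable_restrictBall _),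
    Measure.map_apply ((measurable_comp_right e).comp (measurable_restrictBall _)) hS]
  congr 1
  ext b
  have h3 : restrictBall n (b ∘ blockSwap m) = (restrictBall (m + 1) b ∘ e) ∘ Sum.inr := by
    funext i
    simp [restrictBall, e, blockSwap_of_lt (i.isLt.trans_le h2n)]
  simp only [Set.mem_preimage, Set.mem_ofPred_eq, h3]
  rfl

/-! ### A zero-one law from asymptotic independence -/

section ZeroOne

/-- The events that coincide almost surely with events determined by `f`. -/
abbrev aeComap {Ω Y : Type*} [mΩ : MeasurableSpace Ω] [MeasurableSpace Y] (P : Measure Ω) (f : Ω → Y) :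
    MeasurableSpace Ω where
  MeasurableSet' A := MeasurableSet[mΩ] A ∧ ∃ B, MeasurableSet B ∧ A =ᵐ[P] f ⁻¹' B
  measurableSet_empty := ⟨.empty, ∅, .empty, by simp⟩
  measurableSet_compl A := fun ⟨hA, B, hB, h⟩ => ⟨hA.compl, Bᶜ, hB.compl, h.compl⟩
  measurableSet_iUnion A h := by
    choose h1 B hB hAB using h
    refine ⟨.iUnion h1, ⋃ i, B i, .iUnion hB, ?_⟩
    rw [Set.preimage_iUnion]
    exact Filter.EventuallyEq.countable_iUnion hAB

variable {X : Type*} [mX : MeasurableSpace X]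

lemma measurable_aeComap {Y : Type*} [MeasurableSpace Y] (P : Measure X) {f : X → Y}
    (hf : Measurable f) : @Measurable X Y (aeComap P f) _ f :=
  fun B hB => ⟨hf hB, B, hB, EventuallyEq.rfl⟩

lemma aeComap_le {Y : Type*} [MeasurableSpace Y] (P : Measure X) (f : X → Y) :
    aeComap P f ≤ mX := fun _ h => h.1

/-- Approximate `A` up to `ε` by an event `D` determined by `f N`. Almost surely `F m ω ∈ A` implies
`G m ω ∈ A`, so `F m ω ∈ D` and `G m ω ∉ D` can only happen if the approximation fails at one of the
two points. Mixing then gives `μ D * μ Dᶜ ≤ 2 ε`, and `μ A * μ Aᶜ = 0` follows. Events are taken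
modulo null sets because in one application the `σ`-algebras are nested only in this sense. -/
theorem zero_or_one_of_mixing (μ : Measure X) [IsProbabilityMeasure μ] {Y : ℕ → Type*}
    [∀ N, MeasurableSpace (Y N)] {f : ∀ N, X → Y N} (hf : ∀ N, Measurable (f N))
    (hmono : Monotone fun N => aeComap μ (f N)) (hgen : mX ≤ ⨆ N, aeComap μ (f N))
    {Ω : Type*} [MeasurableSpace Ω] (P : Measure Ω) [IsProbabilityMeasure P]
    {F G : ℕ → Ω → X} (hF : ∀ m, MeasurePreserving (F m) P μ)
    (hG : ∀ m, MeasurePreserving (G m) P μ)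
    (hmix : ∀ N (C : Set (Y N)), MeasurableSet C → μ (f N ⁻¹' C) * μ (f N ⁻¹' C)ᶜ
      ≤ liminf (fun m => P {ω | f N (F m ω) ∈ C ∧ f N (G m ω) ∈ Cᶜ}) atTop)
    {A : Set X} (hA : MeasurableSet A) (hinv : ∀ m, P {ω | F m ω ∈ A ∧ G m ω ∈ Aᶜ} = 0) :
    μ A = 0 ∨ μ A = 1 := by
  let 𝒜 : Set (Set X) := {s | ∃ N, MeasurableSet[aeComap μ (f N)] s}
  have halg : IsSetAlgebra 𝒜 :=
    { empty_mem := ⟨0, (aeComap μ (f 0)).measurableSet_empty⟩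
      compl_mem := fun s ⟨N, hN⟩ => ⟨N, hN.compl⟩
      union_mem := fun s t ⟨N, hN⟩ ⟨M, hM⟩ => ⟨max N M,
        (hmono (le_max_left N M) _ hN).union (hmono (le_max_right N M) _ hM)⟩ }
  have hgen' : mX = MeasurableSpace.generateFrom 𝒜 := by
    refine le_antisymm (hgen.trans (iSup_le fun N s hs =>
      MeasurableSpace.measurableSet_generateFrom ⟨N, hs⟩))
      (MeasurableSpace.generateFrom_le fun s ⟨N, hN⟩ => hN.1)
  have hdense := Measure.MeasureDense.of_generateFrom_isSetAlgebra_finite μ halg hgen'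
  have key : ∀ ε : ℝ, 0 < ε → μ.real A * μ.real Aᶜ ≤ 4 * ε + ε ^ 2 := by
    intro ε hε
    obtain ⟨t, ⟨N, ht, C, hC, htC⟩, htA⟩ := hdense.approx A hA (measure_ne_top _ _) ε hε
    set D := f N ⁻¹' C with hD
    have hDm : MeasurableSet D := hf N hC
    have h1 : μ (A \ D) ≤ ENNReal.ofReal ε := by
      refine le_trans (le_of_eq ?_) ((measure_mono (Set.subset_union_left (t := t \ A))).trans htA.le)
      exact measure_congr ((ae_eq_refl A).diff htC.symm)
    have h2 : μ (D \ A) ≤ ENNReal.ofReal ε := by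
      refine le_trans (le_of_eq ?_) ((measure_mono (Set.subset_union_right (s := A \ t))).trans htA.le)
      exact measure_congr (htC.symm.diff (ae_eq_refl A))
    have h3 : μ D * μ Dᶜ ≤ ENNReal.ofReal ε + ENNReal.ofReal ε := by
      refine (hmix N C hC).trans (liminf_le_of_frequently_le' (Frequently.of_forall fun m => ?_))
      have hsub : {ω | f N (F m ω) ∈ C ∧ f N (G m ω) ∈ Cᶜ}
          ⊆ {ω | F m ω ∈ A ∧ G m ω ∈ Aᶜ} ∪ ((F m ⁻¹' (D \ A)) ∪ (G m ⁻¹' (A \ D))) := by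
        intro ω ⟨ha, hb⟩
        by_cases hFA : F m ω ∈ A
        · by_cases hGA : G m ω ∈ A
          · exact Or.inr (Or.inr ⟨hGA, hb⟩)
          · exact Or.inl ⟨hFA, hGA⟩
        · exact Or.inr (Or.inl ⟨ha, hFA⟩)
      refine (measure_mono hsub).trans ((measure_union_le _ _).trans ?_)
      rw [hinv m, zero_add]
      refine (measure_union_le _ _).trans ?_
      rw [(hF m).measure_preimage (hDm.diff hA).nullMeasurableSet,
        (hG m).measure_preimage (hA.diff hDm).nullMeasurableSet]
      exact add_le_add h2 h1
    have r1 : μ.real (A \ D) ≤ ε := ENNReal.toReal_le_of_le_ofReal hε.le h1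
    have r2 : μ.real (D \ A) ≤ ε := ENNReal.toReal_le_of_le_ofReal hε.le h2
    have r3 : μ.real D * μ.real Dᶜ ≤ 2 * ε := by
      rw [Measure.real, Measure.real, ← ENNReal.toReal_mul]
      refine ENNReal.toReal_le_of_le_ofReal (by positivity) (h3.trans (le_of_eq ?_))
      rw [← ENNReal.ofReal_add hε.le hε.le]; ring_nf
    have r4 : μ.real A ≤ μ.real D + ε := by
      have : A ⊆ D ∪ (A \ D) := fun x hx => by by_cases h : x ∈ D <;> simp [h, hx]
      linarith [measureReal_mono (μ := μ) this, measureReal_union_le (μ := μ) D (A \ D)]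
    have r5 : μ.real Aᶜ ≤ μ.real Dᶜ + ε := by
      have : Aᶜ ⊆ Dᶜ ∪ (D \ A) := fun x hx => by
        by_cases h : x ∈ D
        · exact Or.inr ⟨h, hx⟩
        · exact Or.inl h
      linarith [measureReal_mono (μ := μ) this, measureReal_union_le (μ := μ) Dᶜ (D \ A)]
    have r6 : μ.real D ≤ 1 := measureReal_le_one
    have r7 : μ.real Dᶜ ≤ 1 := measureReal_le_one
    calc μ.real A * μ.real Aᶜ ≤ (μ.real D + ε) * (μ.real Dᶜ + ε) := by gcongr
      _ ≤ 4 * ε + ε ^ 2 := by nlinarith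
  have h0 : μ.real A * μ.real Aᶜ ≤ 0 := by
    have hlim : Tendsto (fun ε : ℝ => 4 * ε + ε ^ 2) (𝓝[>] 0) (𝓝 0) := by
      have : Continuous fun ε : ℝ => 4 * ε + ε ^ 2 := by fun_prop
      simpa using (this.tendsto 0).mono_left nhdsWithin_le_nhds
    exact ge_of_tendsto hlim (eventually_mem_nhdsWithin.mono fun ε hε => key ε hε)
  have h1 : μ.real A * μ.real Aᶜ = 0 := le_antisymm h0 (by positivity)
  rcases mul_eq_zero.1 h1 with h | h
  · exact Or.inl ((measureReal_eq_zero_iff).1 h)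
  · refine Or.inr ((prob_compl_eq_zero_iff hA).1 ((measureReal_eq_zero_iff).1 h))

end ZeroOne

end H22

namespace H22

/-! ### Ergodicity of the potential on the lattice -/

lemma aeComap_comp_le {X Y Z : Type*} [MeasurableSpace X] [MeasurableSpace Y] [MeasurableSpace Z]
    (P : Measure X) {f : X → Y} {f' : X → Z} {r : Z → Y} (hr : Measurable r)
    (h : f =ᵐ[P] r ∘ f') : aeComap P f ≤ aeComap P f' := by
  rintro A ⟨hA, B, hB, hAB⟩
  refine ⟨hA, r ⁻¹' B, hr hB, hAB.trans ?_⟩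
  filter_upwards [h] with x hx
  exact congrArg (· ∈ B) hx

lemma measurable_restrict_succ (n : ℕ) : Measurable
    fun (x : Fin (2 ^ (n + 1)) → ℝ) (i : Fin (2 ^ n)) =>
      x ⟨i, i.isLt.trans_le (Nat.pow_le_pow_right two_pos n.le_succ)⟩ :=
  measurable_pi_lambda _ fun _ => measurable_pi_apply _

theorem latticeLaw_zero_or_one {w : ℝ} (hw : 0 < w) {A : Set (ℕ → ℝ)} (hA : MeasurableSet A)
    (h : ∀ m, 1 ≤ m → (fun b : ℕ → ℝ => b ∘ blockSwap m) ⁻¹' A =ᵐ[latticeLaw hw] A) :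
    latticeLaw hw A = 0 ∨ latticeLaw hw A = 1 := by
  refine zero_or_one_of_mixing (latticeLaw hw) measurable_restrictBall
    (monotone_nat_of_le_succ fun n => aeComap_comp_le _ (measurable_restrict_succ n)
      (ae_of_all _ fun b => rfl)) ?_ (latticeLaw hw)
    -- The shift to `m + 1` leaves out `blockSwap 0`, which is not among the generators.
    (F := fun _ => id) (G := fun m b => b ∘ blockSwap (m + 1)) (fun m => MeasurePreserving.id _)
    (fun m => measurePreserving_comp_latticeLaw hw (blockSwap_mem _)) (fun N C hC => ?_) hA
    fun m => ?_
  · refine iSup_le fun i => le_iSup_of_le i ?_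
    rintro s ⟨B, hB, rfl⟩
    exact ((measurable_pi_apply (⟨i, Nat.lt_two_pow_self⟩ : Fin (2 ^ i))).comp
      (measurable_aeComap (latticeLaw hw) (measurable_restrictBall i))) hB
  · have h1 := mul_le_liminf_latticeLaw hw N hC hC.compl
    rw [← liminf_nat_add _ 1] at h1
    rwa [← map_restrictBall_latticeLaw hw, Measure.map_apply (measurable_restrictBall N) hC,
      Measure.map_apply (measurable_restrictBall N) hC.compl] at h1
  · have h1 := h (m + 1) (by omega)
    rw [← compl_mem_ae_iff]
    filter_upwards [h1] with b hb ⟨hb1, hb2⟩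
    exact hb2 (hb.mpr hb1)

/-- Both groups lie in `hierAut` and contain the block exchanges with `m ≥ 1`, so invariance is
checked for the large group and the zero-one law for the exchanges only. -/
lemma isStationaryErgodic_of {μ : Measure (ℕ → ℝ)} [IsProbabilityMeasure μ]
    (hinv : ∀ g ∈ hierAut, MeasurePreserving (fun b : ℕ → ℝ => b ∘ (g : Equiv.Perm ℕ)) μ μ)
    (herg : ∀ A : Set (ℕ → ℝ), MeasurableSet A →
      (∀ m, 1 ≤ m → (fun b : ℕ → ℝ => b ∘ blockSwap m) ⁻¹' A =ᵐ[μ] A) → μ A = 0 ∨ μ A = 1) :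
    IsStationaryErgodic μ := by
  have key : ∀ A : Set (ℕ → ℝ), MeasurableSet A →
      (∀ m, 1 ≤ m → (fun b : ℕ → ℝ => b ∘ blockSwap m) ⁻¹' A =ᵐ[μ] A) →
      EventuallyConst A (ae μ) := by
    intro A hA h
    rw [eventuallyConst_set']
    rcases herg A hA h with h | h
    · exact Or.inl (ae_eq_empty.2 h)
    · exact Or.inr (ae_eq_univ.2 ((prob_compl_eq_zero_iff hA).2 h))
  refine ⟨?_, ?_⟩
  · refine { measure_preimage_smul := fun c s hs => ?_, aeconst_of_forall_preimage_smul_ae_eq := ?_ }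
    · exact (hinv _ (DomMulAct.mk.symm c).2).measure_preimage hs.nullMeasurableSet
    · intro s hs h
      exact key s hs fun m _ => h (DomMulAct.mk ⟨blockSwap m, blockSwap_mem m⟩)
  · refine { measure_preimage_smul := fun c s hs => ?_, aeconst_of_forall_preimage_smul_ae_eq := ?_ }
    · exact (hinv _ (blockSwapGroup_le (DomMulAct.mk.symm c).2)).measure_preimage
        hs.nullMeasurableSet
    · intro s hs h
      exact key s hs fun m hm => h (DomMulAct.mk
        ⟨blockSwap m, Subgroup.subset_closure ⟨m, hm, rfl⟩⟩)

theorem isStationaryErgodic_latticeLaw {w : ℝ} (hw : 0 < w) :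
    IsStationaryErgodic (latticeLaw hw) :=
  isStationaryErgodic_of (fun _ hg => measurePreserving_comp_latticeLaw hw hg)
    fun _ hA h => latticeLaw_zero_or_one hw hA h

/-! ### The field on the lattice -/

/-- The field on `Λ_n` with boundary value `1`. -/
noncomputable def ballField (w : ℝ) (n : ℕ) (x : Fin (2 ^ n) → ℝ) : Fin (2 ^ n) → ℝ :=
  field (fun i j => latticeWeight w i j) (fun _ => boundaryWeight w n) x

/-- The field on `Λ_n`, extended by `1` to the lattice. -/
noncomputable def extendedField (w : ℝ) (n : ℕ) (x : Fin (2 ^ n) → ℝ) (i : ℕ) : ℝ :=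
  if h : i < 2 ^ n then ballField w n x ⟨i, h⟩ else 1

lemma measurable_ballField (w : ℝ) (n : ℕ) : Measurable (ballField w n) := measurable_field _ _

lemma measurable_extendedField (w : ℝ) (n : ℕ) : Measurable (extendedField w n) := by
  refine measurable_pi_lambda _ fun i => ?_
  unfold extendedField
  split_ifs
  · exact (measurable_pi_apply _).comp (measurable_ballField w n)
  · exact measurable_const

lemma ae_posDef_ballLaw (w : ℝ) (n : ℕ) : ∀ᵐ x ∂(ballLaw w n),
    (schrodinger (fun i j : Fin (2 ^ n) => latticeWeight w i j) x).PosDef :=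
  ae_posDef_h22Eta (fun _ _ => latticeWeight_comm _ _) _

lemma ballField_nonneg {w : ℝ} (hw : 0 < w) {n : ℕ} {x : Fin (2 ^ n) → ℝ}
    (h : (schrodinger (fun i j : Fin (2 ^ n) => latticeWeight w i j) x).PosDef) (i : Fin (2 ^ n)) :
    0 ≤ ballField w n x i :=
  field_nonneg (fun _ _ => latticeWeight_nonneg hw _ _) (fun _ => (boundaryWeight_pos hw n).le) h i

lemma extendedField_nonneg {w : ℝ} (hw : 0 < w) {n : ℕ} {x : Fin (2 ^ n) → ℝ}
    (h : (schrodinger (fun i j : Fin (2 ^ n) => latticeWeight w i j) x).PosDef) (i : ℕ) :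
    0 ≤ extendedField w n x i := by
  unfold extendedField
  split_ifs
  · exact ballField_nonneg hw h _
  · exact zero_le_one

lemma schrodinger_mulVec_ballField {w : ℝ} {n : ℕ} {x : Fin (2 ^ n) → ℝ}
    (h : (schrodinger (fun i j : Fin (2 ^ n) => latticeWeight w i j) x).PosDef) :
    (schrodinger (fun i j : Fin (2 ^ n) => latticeWeight w i j) x).mulVec (ballField w n x)
      = fun _ => boundaryWeight w n :=
  mulVec_inv_mulVec h _

lemma field_comp_equiv {V : Type*} [Fintype V] [DecidableEq V] (σ : Equiv.Perm V)
    {W : V → V → ℝ} {η : V → ℝ} (hW : ∀ i j, W (σ i) (σ j) = W i j) (hη : ∀ i, η (σ i) = η i)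
    (β : V → ℝ) : field W η (β ∘ σ) = field W η β ∘ σ := by
  have hsub := schrodinger_submatrix (W := W) σ.injective β
  simp only [hW] at hsub
  change (schrodinger W (β ∘ σ))⁻¹.mulVec η = _
  have hη' : η = η ∘ σ := funext fun i => (hη i).symm
  conv_lhs => rw [hη']
  rw [← hsub, Matrix.inv_submatrix_equiv, Matrix.submatrix_mulVec_equiv]
  simp [Function.comp_assoc, field]

lemma ballField_comp_perm {w : ℝ} {n : ℕ} {σ : Equiv.Perm (Fin (2 ^ n))}
    (hσ : ∀ i j : Fin (2 ^ n), hierDist (σ i) (σ j) = hierDist i j) (x : Fin (2 ^ n) → ℝ) :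
    ballField w n (x ∘ σ) = ballField w n x ∘ σ := by
  refine field_comp_equiv σ (fun i j => ?_) (fun _ => rfl) x
  simp only [latticeWeight, hσ, Fin.val_inj, σ.injective.eq_iff]

/-- The restriction to `Λ_n` of an automorphism of the lattice that maps `Λ_n` to itself. -/
noncomputable def permBall {g : Equiv.Perm ℕ} {n : ℕ} (h : ∀ i, g i < 2 ^ n ↔ i < 2 ^ n) :
    Equiv.Perm (Fin (2 ^ n)) :=
  Equiv.ofBijective (fun i => ⟨g i, (h i).2 i.isLt⟩) (Finite.injective_iff_bijective.1
    fun _ _ hij => Fin.ext (g.injective (Fin.mk.inj_iff.1 hij)))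

lemma extendedField_comp {w : ℝ} {g : Equiv.Perm ℕ} (hg : g ∈ hierAut) {n : ℕ}
    (h : ∀ i, g i < 2 ^ n ↔ i < 2 ^ n) (b : ℕ → ℝ) :
    extendedField w n (restrictBall n (b ∘ g)) = extendedField w n (restrictBall n b) ∘ g := by
  have h1 : restrictBall n (b ∘ g) = restrictBall n b ∘ permBall h := rfl
  have h2 := ballField_comp_perm (w := w) (σ := permBall h) (fun i j => hg i j) (restrictBall n b)
  funext i
  simp only [extendedField, Function.comp, h, h1, h2]
  split_ifs <;> rfl

/-- The field along the increasing sequence of balls is a nonnegative supermartingale. -/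
lemma setLIntegral_extendedField_le {w : ℝ} (hw : 0 < w) {n i : ℕ} (hi : i < 2 ^ n)
    {C : Set (Fin (2 ^ n) → ℝ)} (hC : MeasurableSet C) :
    ∫⁻ b in restrictBall n ⁻¹' C, ENNReal.ofReal (extendedField w (n + 1) (restrictBall (n + 1) b) i)
        ∂(latticeLaw hw)
      ≤ ∫⁻ b in restrictBall n ⁻¹' C, ENNReal.ofReal (extendedField w n (restrictBall n b) i)
        ∂(latticeLaw hw) := by
  have hle : 2 ^ n ≤ 2 ^ (n + 1) := Nat.pow_le_pow_right two_pos n.le_succ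
  let e : Fin (2 ^ n) → Fin (2 ^ (n + 1)) := Fin.castLE hle
  have he : Function.Injective e := Fin.castLE_injective hle
  have hη' : (fun i : Fin (2 ^ n) => boundaryWeight w (n + 1)
      + (∑ j : Fin (2 ^ (n + 1)), latticeWeight w (e i) j
        - ∑ u : Fin (2 ^ n), latticeWeight w (e i) (e u)))
      = fun _ => boundaryWeight w n := by
    funext i
    rw [sum_fin_latticeWeight (n + 1) _ (e i).isLt]
    have := sum_fin_latticeWeight (w := w) n i i.isLt
    simp only [e, Fin.val_castLE, this]
    ring
  have key := setLIntegral_field_le he (W := fun i j => latticeWeight w i j)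
    (η := fun _ => boundaryWeight w (n + 1)) (fun _ _ => latticeWeight_comm _ _)
    (fun _ _ => latticeWeight_nonneg hw _ _) (fun _ => (boundaryWeight_pos hw _).le) ⟨i, hi⟩ hC
    (by rw [hη']; exact fun _ => (boundaryWeight_pos hw n).le)
  rw [hη'] at key
  have h1 : ∀ b : ℕ → ℝ, extendedField w n (restrictBall n b) i
      = ballField w n (restrictBall n b) ⟨i, hi⟩ := fun b => dif_pos hi
  have h2 : ∀ b : ℕ → ℝ, extendedField w (n + 1) (restrictBall (n + 1) b) i
      = ballField w (n + 1) (restrictBall (n + 1) b) (e ⟨i, hi⟩) := fun b =>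
    dif_pos (hi.trans_le hle)
  simp_rw [h1, h2]
  have m1 := (measurable_ballField w (n + 1)).eval (a := e ⟨i, hi⟩)
  have m2 := (measurable_ballField w n).eval (a := ⟨i, hi⟩)
  have e1 := setLIntegral_map (μ := latticeLaw hw) (measurable_comp_right e hC)
    m1.ennreal_ofReal (measurable_restrictBall (n + 1))
  have e2 := setLIntegral_map (μ := latticeLaw hw) hC m2.ennreal_ofReal (measurable_restrictBall n)
  rw [map_restrictBall_latticeLaw] at e1 e2
  exact (e1.symm.le.trans key).trans e2.le

lemma lintegral_ballField_le_one {w : ℝ} (hw : 0 < w) (n : ℕ) (i : Fin (2 ^ n)) :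
    ∫⁻ x, ENNReal.ofReal (ballField w n x i) ∂(ballLaw w n) ≤ 1 :=
  lintegral_field_le_one (fun _ _ => latticeWeight_comm _ _)
    (fun _ _ => latticeWeight_nonneg hw _ _) (fun _ => (boundaryWeight_pos hw _).le) i

/-- Convergence of nonnegative processes that decrease in mean. -/
theorem ae_tendsto_of_supermartingale {Ω : Type*} [mΩ : MeasurableSpace Ω] (P : Measure Ω)
    [IsProbabilityMeasure P] (ℱ : Filtration ℕ mΩ) {M : ℕ → Ω → ℝ}
    (hM : ∀ n, Measurable[ℱ n] (M n)) (h0 : ∀ n, 0 ≤ᵐ[P] M n)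
    (h1 : ∀ n, ∫⁻ ω, ENNReal.ofReal (M n ω) ∂P ≤ 1)
    (hle : ∀ n A, MeasurableSet[ℱ n] A →
      ∫⁻ ω in A, ENNReal.ofReal (M (n + 1) ω) ∂P ≤ ∫⁻ ω in A, ENNReal.ofReal (M n ω) ∂P) :
    ∀ᵐ ω ∂P, ∃ c, 0 ≤ c ∧ Tendsto (fun n => M n ω) atTop (𝓝 c) := by
  have hmeas : ∀ n, Measurable (M n) := fun n => (hM n).mono (ℱ.le n) le_rfl
  have hint : ∀ n, Integrable (M n) P := fun n =>
    ⟨(hmeas n).aestronglyMeasurable, by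
      rw [hasFiniteIntegral_iff_ofReal (h0 n)]; exact (h1 n).trans_lt ENNReal.one_lt_top⟩
  have hsup : Supermartingale M ℱ P := by
    refine supermartingale_of_setIntegral_succ_le (fun n => (hM n).stronglyMeasurable) hint
      fun n A hA => ?_
    rw [integral_eq_lintegral_of_nonneg_ae (ae_restrict_of_ae (h0 _))
      (hmeas _).aestronglyMeasurable, integral_eq_lintegral_of_nonneg_ae
      (ae_restrict_of_ae (h0 _)) (hmeas _).aestronglyMeasurable]
    refine ENNReal.toReal_mono ?_ (hle n A hA)
    exact ((setLIntegral_le_lintegral _ _).trans_lt ((h1 n).trans_lt ENNReal.one_lt_top)).ne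
  have hbdd : ∀ n, eLpNorm ((-M) n) 1 P ≤ (1 : NNReal) := fun n => by
    rw [Pi.neg_apply, eLpNorm_neg, eLpNorm_one_eq_lintegral_enorm]
    refine le_trans (le_of_eq (lintegral_congr_ae ?_)) (h1 n)
    filter_upwards [h0 n] with ω hω
    exact Real.enorm_of_nonneg hω
  have hconv := hsup.neg.exists_ae_tendsto_of_bdd hbdd
  filter_upwards [hconv, ae_all_iff.2 h0] with ω ⟨c, hc⟩ hω
  have hc' : Tendsto (fun n => M n ω) atTop (𝓝 (-c)) := by simpa using hc.neg
  exact ⟨-c, ge_of_tendsto' hc' hω, hc'⟩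

lemma ae_posDef_latticeLaw {w : ℝ} (hw : 0 < w) : ∀ᵐ b ∂(latticeLaw hw), ∀ n,
    (schrodinger (fun i j : Fin (2 ^ n) => latticeWeight w i j) (restrictBall n b)).PosDef := by
  refine ae_all_iff.2 fun n => ?_
  have h := ae_posDef_ballLaw w n
  rw [← map_restrictBall_latticeLaw hw] at h
  exact ae_of_ae_map (measurable_restrictBall n).aemeasurable h

lemma ae_tendsto_extendedField {w : ℝ} (hw : 0 < w) (i : ℕ) : ∀ᵐ b ∂(latticeLaw hw),
    ∃ c, 0 ≤ c ∧ Tendsto (fun n => extendedField w n (restrictBall n b) i) atTop (𝓝 c) := by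
  -- Time starts at level `i`, where `i` already lies in the ball, so the conventional value `1`
  -- outside the ball never enters.
  have hlt : ∀ n, i < 2 ^ (i + n) := fun n =>
    Nat.lt_two_pow_self.trans_le (Nat.pow_le_pow_right two_pos (by omega))
  let ℱ : Filtration ℕ (inferInstance : MeasurableSpace (ℕ → ℝ)) :=
    { seq := fun n => MeasurableSpace.comap (restrictBall (i + n)) inferInstance
      mono' := monotone_nat_of_le_succ fun n => by
        rintro _ ⟨B, hB, rfl⟩
        refine ⟨_, measurable_restrict_succ (i + n) hB, ?_⟩
        rfl
      le' := fun n => (measurable_restrictBall _).comap_le }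
  have h := ae_tendsto_of_supermartingale (latticeLaw hw) ℱ
    (M := fun n b => extendedField w (i + n) (restrictBall (i + n) b) i) (fun n => ?_) (fun n => ?_)
    (fun n => ?_) fun n A hA => ?_
  · filter_upwards [h] with b ⟨c, hc, hb⟩
    refine ⟨c, hc, (tendsto_add_atTop_iff_nat
      (f := fun n => extendedField w n (restrictBall n b) i) i).1 (hb.congr fun n => ?_)⟩
    exact congrArg (fun n => extendedField w n (restrictBall n b) i) (add_comm i n)
  · exact ((measurable_pi_apply i).comp (measurable_extendedField w (i + n))).comp
      (comap_measurable _)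
  · filter_upwards [ae_posDef_latticeLaw hw] with b hb
    exact extendedField_nonneg hw (hb _) i
  · have h2 : ∀ b : ℕ → ℝ, extendedField w (i + n) (restrictBall (i + n) b) i
        = ballField w (i + n) (restrictBall (i + n) b) ⟨i, hlt n⟩ := fun b => dif_pos (hlt n)
    simp_rw [h2]
    have m1 := (measurable_ballField w (i + n)).eval (a := ⟨i, hlt n⟩)
    have e1 := lintegral_map (μ := latticeLaw hw) m1.ennreal_ofReal (measurable_restrictBall (i + n))
    rw [map_restrictBall_latticeLaw] at e1
    exact e1.symm.le.trans (lintegral_ballField_le_one hw _ _)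
  · obtain ⟨B, hB, rfl⟩ := hA
    exact setLIntegral_extendedField_le hw (hlt n) hB

/-- The limit of the fields on the balls `Λ_n`. -/
noncomputable def limitField (w : ℝ) (b : ℕ → ℝ) (i : ℕ) : ℝ :=
  (limsup (fun n => ENNReal.ofReal (extendedField w n (restrictBall n b) i)) atTop).toReal

lemma measurable_limitField (w : ℝ) : Measurable (limitField w) :=
  measurable_pi_lambda _ fun i => (Measurable.limsup fun n =>
    (((measurable_pi_apply i).comp (measurable_extendedField w n)).comp
      (measurable_restrictBall n)).ennreal_ofReal).ennreal_toReal

lemma ae_tendsto_limitField {w : ℝ} (hw : 0 < w) : ∀ᵐ b ∂(latticeLaw hw),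
    Tendsto (fun n => extendedField w n (restrictBall n b)) atTop (𝓝 (limitField w b)) := by
  filter_upwards [ae_all_iff.2 (ae_tendsto_extendedField hw)] with b hb
  refine tendsto_pi_nhds.2 fun i => ?_
  obtain ⟨c, hc, h⟩ := hb i
  have h1 := ((ENNReal.continuous_ofReal.tendsto _).comp h).limsup_eq
  have h2 : limitField w b i = c := by
    rw [limitField]
    exact (congrArg ENNReal.toReal h1).trans (ENNReal.toReal_ofReal hc)
  rwa [h2]

/-- An automorphism preserves all sufficiently large balls, and the upper limit is defined for every
configuration; hence equivariance holds without an exceptional set. -/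
lemma limitField_comp {w : ℝ} {g : Equiv.Perm ℕ} (hg : g ∈ hierAut) (b : ℕ → ℝ) :
    limitField w (b ∘ g) = limitField w b ∘ g := by
  obtain ⟨M, hM⟩ := exists_forall_lt_iff hg
  funext i
  simp only [limitField, Function.comp]
  congr 1
  refine limsup_congr ?_
  filter_upwards [eventually_ge_atTop M] with n hn
  have := congrFun (extendedField_comp (w := w) hg (hM n hn) b) i
  rw [Function.comp] at this
  exact congrArg ENNReal.ofReal this

/-- The law of the limit field is stationary and ergodic. -/
theorem isStationaryErgodic_limitField {w : ℝ} (hw : 0 < w) :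
    IsStationaryErgodic ((latticeLaw hw).map (limitField w)) := by
  have hm := measurable_limitField w
  have : IsProbabilityMeasure ((latticeLaw hw).map (limitField w)) :=
    Measure.isProbabilityMeasure_map hm.aemeasurable
  have hcomp : ∀ g ∈ hierAut, (fun b : ℕ → ℝ => b ∘ (g : Equiv.Perm ℕ)) ∘ limitField w
      = limitField w ∘ fun b : ℕ → ℝ => b ∘ g := fun g hg =>
    funext fun b => (limitField_comp hg b).symm
  refine isStationaryErgodic_of (fun g hg => ⟨measurable_comp_nat g, ?_⟩) fun A hA h => ?_
  · rw [Measure.map_map (measurable_comp_nat g) hm, hcomp g hg,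
      ← Measure.map_map hm (measurable_comp_nat g),
      (measurePreserving_comp_latticeLaw hw hg).map_eq]
  · rw [Measure.map_apply hm hA]
    refine latticeLaw_zero_or_one hw (hm hA) fun m hm1 => ?_
    rw [← Set.preimage_comp, ← hcomp _ (blockSwap_mem m), Set.preimage_comp]
    exact (hm.measurePreserving _).quasiMeasurePreserving.preimage_ae_eq (h m hm1)

/-- The limit field vanishes everywhere or nowhere. -/
lemma ae_limitField_eq_zero {w : ℝ} (hw : 0 < w) : ∀ᵐ b ∂(latticeLaw hw),
    ∀ i j, limitField w b i = 0 → limitField w b j = 0 := by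
  filter_upwards [ae_tendsto_limitField hw, ae_posDef_latticeLaw hw] with b hb hpd i j hi
  rcases eq_or_ne i j with rfl | hij
  · exact hi
  have hti := tendsto_pi_nhds.1 hb i
  have htj := tendsto_pi_nhds.1 hb j
  have hnn : ∀ n k, 0 ≤ extendedField w n (restrictBall n b) k := fun n k =>
    extendedField_nonneg hw (hpd n) k
  have hW := latticeWeight_pos hw hij
  -- Row `i` of the field equation, with all nonnegative terms dropped except that of `j`: a Harnack
  -- bound whose constant does not depend on `n`.
  have hle : ∀ᶠ n in atTop, latticeWeight w i j * extendedField w n (restrictBall n b) j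
      ≤ 2 * b i * extendedField w n (restrictBall n b) i := by
    filter_upwards [eventually_ge_atTop (i + j)] with n hn
    have hin : i < 2 ^ n := lt_of_le_of_lt (by omega) (Nat.lt_two_pow_self (n := n))
    have hjn : j < 2 ^ n := lt_of_le_of_lt (by omega) (Nat.lt_two_pow_self (n := n))
    have h1 := congrFun (schrodinger_mulVec_ballField (hpd n)) ⟨i, hin⟩
    simp only [Matrix.mulVec, dotProduct] at h1
    rw [← Finset.add_sum_erase _ _ (Finset.mem_univ (⟨i, hin⟩ : Fin (2 ^ n))), schrodinger_diag,
      ← Finset.add_sum_erase _ _ (Finset.mem_erase.2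
        ⟨fun h => hij (Fin.mk.inj_iff.1 h).symm, Finset.mem_univ (⟨j, hjn⟩ : Fin (2 ^ n))⟩),
      schrodinger_off _ _ (fun h => hij (Fin.mk.inj_iff.1 h))] at h1
    have h2 : ∑ k ∈ (Finset.univ.erase (⟨i, hin⟩ : Fin (2 ^ n))).erase ⟨j, hjn⟩,
        schrodinger (fun i j : Fin (2 ^ n) => latticeWeight w i j) (restrictBall n b) ⟨i, hin⟩ k
          * ballField w n (restrictBall n b) k ≤ 0 := by
      refine Finset.sum_nonpos fun k hk => ?_
      have hk' := Finset.ne_of_mem_erase (Finset.mem_of_mem_erase hk)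
      rw [schrodinger_off _ _ hk'.symm]
      exact mul_nonpos_of_nonpos_of_nonneg (neg_nonpos.2 (latticeWeight_nonneg hw _ _))
        (ballField_nonneg hw (hpd n) k)
    have h3 := boundaryWeight_pos hw n
    have h4 : extendedField w n (restrictBall n b) i
      = ballField w n (restrictBall n b) ⟨i, hin⟩ := dif_pos hin
    have h5 : extendedField w n (restrictBall n b) j
      = ballField w n (restrictBall n b) ⟨j, hjn⟩ := dif_pos hjn
    have h6 : restrictBall n b ⟨i, hin⟩ = b i := rfl
    rw [h4, h5]
    rw [h6] at h1
    linarith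
  have hlim := le_of_tendsto_of_tendsto (htj.const_mul _) (hti.const_mul _) hle
  rw [hi, mul_zero] at hlim
  have h0 : 0 ≤ limitField w b j := ge_of_tendsto' htj fun n => hnn n j
  nlinarith

/-- By `ae_limitField_eq_zero`, vanishing at `0` and vanishing at `blockSwap m 0` are almost surely
the same event, so the event is invariant. -/
lemma limitField_zero_or_one {w : ℝ} (hw : 0 < w) :
    latticeLaw hw {b | limitField w b 0 = 0} = 0 ∨ latticeLaw hw {b | limitField w b 0 = 0} = 1 := by
  refine latticeLaw_zero_or_one hw
    (measurableSet_eq_fun (measurable_limitField w).eval measurable_const) fun m _ => ?_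
  filter_upwards [ae_limitField_eq_zero hw] with b hb
  have h1 : limitField w (b ∘ blockSwap m) 0 = limitField w b (blockSwap m 0) := by
    rw [limitField_comp (blockSwap_mem m)]; rfl
  change (limitField w (b ∘ blockSwap m) 0 = 0) = (limitField w b 0 = 0)
  rw [h1]
  exact propext ⟨fun h => hb _ _ h, fun h => hb _ _ h⟩

end H22

namespace H22

/-! ### The levels of the fine-graining coupling -/

lemma eq_two_of_spectralDimension {ρ : ℝ} (hρ : 1 < ρ) (h : spectralDimension ρ = 2) : ρ = 2 := by
  have h1 : Real.log ρ ≠ 0 := (Real.log_pos hρ).ne'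
  unfold spectralDimension at h
  have h2 : Real.log 2 = Real.log ρ := by field_simp at h; linarith
  exact (Real.log_injOn_pos (Set.mem_Ioi.2 two_pos) (Set.mem_Ioi.2 (by linarith)) h2).symm

/-- The factor `(ρ / 2) ^ n` is `1`. This is what allows all levels to be compared with a single
model on the infinite lattice. -/
lemma levelWeight_two (w : ℝ) (n : ℕ) : levelWeight 2 w n = wiredWeight 2 w n := by
  simp [levelWeight, levelTemperature]

lemma wiredWeight_some_some (w : ℝ) (n : ℕ) (i j : Fin (2 ^ n)) :
    wiredWeight 2 w n (some i) (some j) = latticeWeight w i j := by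
  simp only [wiredWeight, latticeWeight, Fin.ext_iff]
  norm_num

lemma wiredWeight_some_none (w : ℝ) (n : ℕ) (i : Fin (2 ^ n)) :
    wiredWeight 2 w n (some i) none = boundaryWeight w n := by
  simp only [wiredWeight, boundaryWeight]
  norm_num

lemma wiredWeight_none_some (w : ℝ) (n : ℕ) (i : Fin (2 ^ n)) :
    wiredWeight 2 w n none (some i) = boundaryWeight w n := by
  simp only [wiredWeight, boundaryWeight]
  norm_num

lemma wiredWeight_comm (w : ℝ) (n : ℕ) : ∀ i j : Vertex n,
    wiredWeight 2 w n i j = wiredWeight 2 w n j i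
  | some i, some j => by simp only [wiredWeight_some_some, latticeWeight_comm]
  | some _, none => rfl
  | none, some _ => rfl
  | none, none => rfl

lemma wiredWeight_nonneg {w : ℝ} (hw : 0 < w) (n : ℕ) : ∀ i j : Vertex n,
    0 ≤ wiredWeight 2 w n i j
  | some i, some j => by rw [wiredWeight_some_some]; exact latticeWeight_nonneg hw _ _
  | some _, none => by rw [wiredWeight_some_none]; exact (boundaryWeight_pos hw n).le
  | none, some _ => by rw [wiredWeight_none_some]; exact (boundaryWeight_pos hw n).le
  | none, none => le_rfl

lemma isProbabilityMeasure_H22Law {w : ℝ} (hw : 0 < w) (n : ℕ) :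
    IsProbabilityMeasure (H22Law (wiredWeight 2 w n)) := by
  rw [H22Law_eq_h22Eta]
  exact isProbabilityMeasure_h22Eta (wiredWeight_comm w n) (wiredWeight_nonneg hw n) fun _ => le_rfl

/-- Removing `δ` turns its edges into a boundary term, and the weight of such an edge is the total
weight from a vertex of `Λ_n` to the rest of the lattice. -/
lemma map_comp_some_H22Law {w : ℝ} (hw : 0 < w) (n : ℕ) :
    (H22Law (wiredWeight 2 w n)).map (fun β => β ∘ some) = ballLaw w n := by
  rw [H22Law_eq_h22Eta, map_comp_some_h22Eta (η := 0) (wiredWeight_comm w n)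
    (wiredWeight_nonneg hw n) fun _ => le_rfl]
  simp only [wiredWeight_some_some, wiredWeight_some_none, Pi.zero_apply, zero_add]
  rfl

lemma ae_posDef_H22Law (w : ℝ) (n : ℕ) :
    ∀ᵐ β ∂(H22Law (wiredWeight 2 w n)), (schrodinger (wiredWeight 2 w n) β).PosDef := by
  rw [H22Law_eq_h22Eta]
  exact ae_posDef_h22Eta (wiredWeight_comm w n) _

lemma posDef_submatrix_some {U : Type*} [Fintype U] [DecidableEq U]
    {M : Matrix (Option U) (Option U) ℝ} (h : M.PosDef) : (M.submatrix some some).PosDef :=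
  h.submatrix (Option.some_injective U)

/-- The field pinned at the boundary vertex is the field with boundary condition given by the
weights of the edges at that vertex. -/
lemma expUField_none {U : Type*} [Fintype U] [DecidableEq U] {W : Option U → Option U → ℝ}
    {β : Option U → ℝ} (h : (schrodinger W β).PosDef) (i : U) :
    expUField W none β (some i)
      = field (fun i j => W (some i) (some j)) (fun i => W (some i) none) (β ∘ some) i := by
  have hA := posDef_submatrix_some h
  rw [schrodinger_submatrix (Option.some_injective U)] at hA
  set g : Option U → ℝ := fun j => (schrodinger W β)⁻¹ j none with hg
  have hgg : (schrodinger W β).mulVec g = Pi.single none 1 := by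
    have h1 := mulVec_inv_mulVec h (Pi.single none 1)
    rwa [Matrix.mulVec_single_one] at h1
  have hpos : 0 < g none := h.inv.diag_pos
  have h2 : (schrodinger (fun i j => W (some i) (some j)) (β ∘ some)).mulVec
      ((g none)⁻¹ • (g ∘ some)) = fun i => W (some i) none := by
    funext j
    have h3 := congrFun hgg (some j)
    rw [option_mulVec_some, schrodinger_submatrix (Option.some_injective U),
      schrodinger_off _ _ (Option.some_ne_none j), Pi.single_eq_of_ne (Option.some_ne_none j)] at h3
    rw [Matrix.mulVec_smul, Pi.smul_apply, smul_eq_mul, eq_neg_of_add_eq_zero_left h3]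
    field_simp
  rw [field, inv_mulVec_eq hA h2]
  simp only [expUField, Pi.smul_apply, Function.comp, smul_eq_mul, hg, div_eq_inv_mul]

/-! ### Laws of the individual levels of a coupling -/

section Coupling

variable {Ω : Type*} [MeasurableSpace Ω] {P : Measure Ω} [IsProbabilityMeasure P] {w : ℝ}
  {β : (n : ℕ) → Ω → Vertex n → ℝ}

lemma map_level (h : IsFineGrainingCoupling P 2 w β) (n : ℕ) :
    P.map (β n) = H22Law (wiredWeight 2 w n) := by
  rw [h.law, levelWeight_two]

lemma measurable_betaLevel (h : IsFineGrainingCoupling P 2 w β) (n : ℕ) :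
    Measurable (betaLevel β n) :=
  (measurable_comp_right some).comp (h.measurable n)

lemma map_betaLevel (hw : 0 < w) (h : IsFineGrainingCoupling P 2 w β) (n : ℕ) :
    P.map (betaLevel β n) = ballLaw w n := by
  rw [← map_comp_some_H22Law hw, ← map_level h,
    Measure.map_map (measurable_comp_right some) (h.measurable n)]
  rfl

lemma ae_posDef_level (h : IsFineGrainingCoupling P 2 w β) :
    ∀ᵐ ω ∂P, ∀ n, (schrodinger (wiredWeight 2 w n) (β n ω)).PosDef := by
  refine ae_all_iff.2 fun n => ?_
  have h1 := ae_posDef_H22Law w n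
  rw [← map_level h] at h1
  exact ae_of_ae_map (h.measurable n).aemeasurable h1

lemma expULevel_eq {n : ℕ} {ω : Ω} (h : (schrodinger (wiredWeight 2 w n) (β n ω)).PosDef) :
    expULevel 2 w β n ω = ballField w n (betaLevel β n ω) := by
  funext i
  rw [expULevel, levelWeight_two, expUField_none h]
  simp only [wiredWeight_some_some, wiredWeight_some_none]
  rfl

lemma expULattice_eq {n : ℕ} {ω : Ω} (h : (schrodinger (wiredWeight 2 w n) (β n ω)).PosDef) :
    expULattice 2 w β n ω = extendedField w n (betaLevel β n ω) := by
  funext i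
  rw [expULattice, extendedField, expULevel_eq h]

lemma ae_expULattice_eq (h : IsFineGrainingCoupling P 2 w β) (n : ℕ) :
    expULattice 2 w β n =ᵐ[P] fun ω => extendedField w n (betaLevel β n ω) := by
  filter_upwards [ae_posDef_level h] with ω hω using expULattice_eq (hω n)

lemma ae_expULevel_eq (h : IsFineGrainingCoupling P 2 w β) (n : ℕ) :
    expULevel 2 w β n =ᵐ[P] fun ω => ballField w n (betaLevel β n ω) := by
  filter_upwards [ae_posDef_level h] with ω hω using expULevel_eq (hω n)

lemma map_extendedField_betaLevel (hw : 0 < w) (h : IsFineGrainingCoupling P 2 w β) (n : ℕ) :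
    P.map (fun ω => extendedField w n (betaLevel β n ω))
      = (latticeLaw hw).map fun b => extendedField w n (restrictBall n b) := by
  have h1 := Measure.map_map (μ := P) (measurable_extendedField w n) (measurable_betaLevel h n)
  have h2 := Measure.map_map (μ := latticeLaw hw) (measurable_extendedField w n)
    (measurable_restrictBall n)
  rw [map_betaLevel hw h] at h1
  rw [map_restrictBall_latticeLaw] at h2
  exact h1.symm.trans h2

lemma map_betaLevel_perm (hw : 0 < w) (h : IsFineGrainingCoupling P 2 w β) {n : ℕ}
    {σ : Equiv.Perm (Fin (2 ^ n))}
    (hσ : ∀ i j : Fin (2 ^ n), hierDist (σ i) (σ j) = hierDist i j) :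
    P.map (fun ω => betaLevel β n ω ∘ σ) = P.map (betaLevel β n) := by
  have h1 := Measure.map_map (μ := P) (measurable_comp_right σ) (measurable_betaLevel h n)
  rw [map_betaLevel hw h, map_comp_ballLaw hw fun i j => ?_] at h1
  · rw [map_betaLevel hw h]; exact h1.symm
  · simp only [latticeWeight, hσ, Fin.val_inj, σ.injective.eq_iff]

lemma map_expULevel_perm (hw : 0 < w) (h : IsFineGrainingCoupling P 2 w β) {n : ℕ}
    {σ : Equiv.Perm (Fin (2 ^ n))}
    (hσ : ∀ i j : Fin (2 ^ n), hierDist (σ i) (σ j) = hierDist i j) :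
    P.map (fun ω => expULevel 2 w β n ω ∘ σ) = P.map (expULevel 2 w β n) := by
  have hm := measurable_ballField w n
  have hb := measurable_betaLevel h n
  have h1 : (fun ω => expULevel 2 w β n ω ∘ σ)
      =ᵐ[P] ballField w n ∘ fun ω => betaLevel β n ω ∘ σ := by
    filter_upwards [ae_expULevel_eq h n] with ω hω
    rw [hω, Function.comp, ballField_comp_perm hσ]
  have h2 : expULevel 2 w β n =ᵐ[P] ballField w n ∘ betaLevel β n := ae_expULevel_eq h n
  rw [Measure.map_congr h1, Measure.map_congr h2,
    ← Measure.map_map hm (show Measurable fun ω => betaLevel β n ω ∘ σ from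
      (measurable_comp_right σ).comp hb), ← Measure.map_map hm hb]
  exact congrArg _ (map_betaLevel_perm hw h hσ)

/-- Convergence in law involves only the law of each level, which is that of the field of the
lattice potential on `Λ_n`; those fields converge almost surely. -/
lemma tendstoInDistribution_expULattice (hw : 0 < w) (h : IsFineGrainingCoupling P 2 w β)
    [IsProbabilityMeasure ((latticeLaw hw).map (limitField w))] :
    TendstoInDistribution (expULattice 2 w β) atTop (id : (ℕ → ℝ) → (ℕ → ℝ)) (fun _ => P)
      ((latticeLaw hw).map (limitField w)) := by
  have hX : ∀ n, AEMeasurable (expULattice 2 w β n) P := fun n =>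
    ((measurable_extendedField w n).comp (measurable_betaLevel h n)).aemeasurable.congr
      (ae_expULattice_eq h n).symm
  have h1 := tendstoInDistribution_of_ae_tendsto (μ' := latticeLaw hw)
    (fun n => ((measurable_extendedField w n).comp (measurable_restrictBall n)).aemeasurable)
    (measurable_limitField w).aemeasurable (ae_tendsto_limitField hw)
  refine ⟨hX, aemeasurable_id, ?_⟩
  have hlim := h1.tendsto
  refine Tendsto.congr (fun n => Subtype.ext ?_) (hlim.trans (le_of_eq (congrArg _ (Subtype.ext ?_))))
  · exact ((Measure.map_congr (ae_expULattice_eq h n)).trans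
      (map_extendedField_betaLevel hw h n)).symm
  · exact Measure.map_id.symm

end Coupling

end H22

namespace H22

/-! ### Merging siblings -/

/-- The vertices of `Λ_{n+1}` as left and right children of the vertices of `Λ_n`. -/
noncomputable def childEquiv (n : ℕ) : Fin (2 ^ n) ⊕ Fin (2 ^ n) ≃ Fin (2 ^ (n + 1)) :=
  Equiv.ofBijective (Sum.elim leftChild rightChild) <| by
    rw [Fintype.bijective_iff_injective_and_card]
    refine ⟨?_, by simp [pow_succ, mul_two]⟩
    rintro (i | i) (j | j) h <;>
      simp only [Sum.elim_inl, Sum.elim_inr, leftChild, rightChild, Fin.mk.injEq] at h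
    · exact congrArg _ (Fin.ext (by omega))
    · omega
    · omega
    · exact congrArg _ (Fin.ext (by omega))

@[simp] lemma childEquiv_inl {n : ℕ} (k : Fin (2 ^ n)) :
    childEquiv n (Sum.inl k) = leftChild k := rfl

@[simp] lemma childEquiv_inr {n : ℕ} (k : Fin (2 ^ n)) :
    childEquiv n (Sum.inr k) = rightChild k := rfl

lemma sum_children {n : ℕ} (f : Fin (2 ^ (n + 1)) → ℝ) :
    ∑ j, f j = ∑ k, (f (leftChild k) + f (rightChild k)) := by
  rw [← (childEquiv n).sum_comp, Fintype.sum_sum_type, ← Finset.sum_add_distrib]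
  rfl

lemma forall_children {n : ℕ} {p : Fin (2 ^ (n + 1)) → Prop} (hl : ∀ k, p (leftChild k))
    (hr : ∀ k, p (rightChild k)) (j : Fin (2 ^ (n + 1))) : p j := by
  obtain ⟨i, rfl⟩ := (childEquiv n).surjective j
  rcases i with k | k
  · exact hl k
  · exact hr k

/-- Distances between children of different vertices exceed those of the parents by one, so the four
new edges share the old weight equally. -/
lemma latticeWeight_children (w : ℝ) {k l a b : ℕ} (hkl : k ≠ l) (ha : a < 2) (hb : b < 2) :
    latticeWeight w (2 * k + a) (2 * l + b) = latticeWeight w k l / 4 := by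
  have h : hierDist (2 * k + a) (2 * l + b) = hierDist k l + 1 := by
    refine eq_of_forall_ge_iff fun m => ?_
    rw [hierDist_le_iff]
    rcases m with _ | m
    · simp only [pow_zero, Nat.div_one]; omega
    · rw [pow_succ', ← Nat.div_div_eq_div_mul, ← Nat.div_div_eq_div_mul, Nat.add_le_add_iff_right,
        hierDist_le_iff, show (2 * k + a) / 2 = k by omega, show (2 * l + b) / 2 = l by omega]
  rw [latticeWeight, latticeWeight, if_neg (by omega), if_neg hkl, h, pow_succ, mul_inv]
  ring

lemma latticeWeight_siblings (w : ℝ) (k : ℕ) :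
    latticeWeight w (2 * k) (2 * k + 1) = w / 4 := by
  have h : hierDist (2 * k) (2 * k + 1) = 1 := hierDist_eq_succ (by simp; omega) (by simp)
  rw [latticeWeight, if_neg (by omega), h, pow_one]
  rfl

lemma latticeWeight_self (w : ℝ) (k : ℕ) : latticeWeight w k k = 0 := if_pos rfl

section Weights

variable {n : ℕ} (w : ℝ) (k l : Fin (2 ^ n))

lemma latticeWeight_left_right : latticeWeight w (leftChild k) (rightChild k) = w / 4 :=
  latticeWeight_siblings w k

variable {k l} (h : k ≠ l)
include h

lemma latticeWeight_left_left_of_ne :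
    latticeWeight w (leftChild k) (leftChild l) = latticeWeight w k l / 4 :=
  latticeWeight_children w (fun h' => h (Fin.ext h')) two_pos two_pos

lemma latticeWeight_left_right_of_ne :
    latticeWeight w (leftChild k) (rightChild l) = latticeWeight w k l / 4 :=
  latticeWeight_children w (fun h' => h (Fin.ext h')) two_pos one_lt_two

lemma latticeWeight_right_right_of_ne :
    latticeWeight w (rightChild k) (rightChild l) = latticeWeight w k l / 4 :=
  latticeWeight_children w (fun h' => h (Fin.ext h')) one_lt_two one_lt_two

end Weights

/-- Merging all pairs of siblings. -/
noncomputable def merge (w : ℝ) (n : ℕ) (x : Fin (2 ^ (n + 1)) → ℝ) (k : Fin (2 ^ n)) : ℝ :=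
  mergedPotential (w / 4) (x (leftChild k)) (x (rightChild k))

lemma mergedPotential_eq (s a b : ℝ) : mergedPotential s a b = (4 * a * b - s ^ 2) / (a + b + s) := by
  rw [mergedPotential, show 2 * (1 / 4 * ((2 * a + 2 * b + 2 * s) /
    (4 * a * b - s ^ 2))) = (a + b + s) / (4 * a * b - s ^ 2) by ring, one_div_div]

lemma mergedPotential_comm (s a b : ℝ) : mergedPotential s a b = mergedPotential s b a := by
  rw [mergedPotential_eq, mergedPotential_eq]
  ring

lemma measurable_merge (w : ℝ) (n : ℕ) : Measurable (merge w n) := by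
  refine measurable_pi_lambda _ fun k => ?_
  unfold merge mergedPotential
  fun_prop

lemma pos_of_posDef {V : Type*} [Fintype V] [DecidableEq V] {W : V → V → ℝ} {x : V → ℝ}
    (h : (schrodinger W x).PosDef) (i : V) : 0 < x i := by
  have := h.diag_pos (i := i)
  rw [schrodinger_diag] at this
  linarith

/-- The ratio of the field at a child and the field at its parent, where `a` and `b` are the
potentials at the child and at its sibling. -/
noncomputable def childRatio (s a b : ℝ) : ℝ := (2 * b + s) / (a + b + s)

lemma childRatio_pos {s a b : ℝ} (hs : 0 < s) (ha : 0 < a) (hb : 0 < b) : 0 < childRatio s a b := by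
  unfold childRatio; positivity

lemma childRatio_add {s a b : ℝ} (hs : 0 < s) (ha : 0 < a) (hb : 0 < b) :
    childRatio s a b + childRatio s b a = 2 := by
  unfold childRatio
  rw [add_comm b a, ← add_div, div_eq_iff (by positivity)]
  ring

lemma boundaryWeight_succ (w : ℝ) (n : ℕ) : boundaryWeight w (n + 1) = boundaryWeight w n / 2 := by
  rw [boundaryWeight, boundaryWeight, pow_succ, mul_inv]
  ring

/-- The equation that determines the field, in terms of the potential. -/
lemma schrodinger_mulVec {V : Type*} [Fintype V] [DecidableEq V] {W : V → V → ℝ}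
    (hW : ∀ i, W i i = 0) (x y : V → ℝ) (i : V) :
    (schrodinger W x).mulVec y i = 2 * x i * y i - ∑ j, W i j * y j := by
  simp only [Matrix.mulVec, dotProduct]
  rw [← Finset.add_sum_erase _ _ (Finset.mem_univ i), schrodinger_diag,
    ← Finset.add_sum_erase _ (fun j => W i j * y j) (Finset.mem_univ i), hW, zero_mul,
    zero_add, sub_eq_add_neg, ← Finset.sum_neg_distrib]
  congr 1
  refine Finset.sum_congr rfl fun j hj => ?_
  rw [schrodinger_off _ _ (Finset.ne_of_mem_erase hj).symm, neg_mul]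

lemma schrodinger_latticeWeight_mulVec (w : ℝ) {n : ℕ} (x y : Fin (2 ^ n) → ℝ) (i : Fin (2 ^ n)) :
    (schrodinger (fun i j : Fin (2 ^ n) => latticeWeight w i j) x).mulVec y i
      = 2 * x i * y i - ∑ j : Fin (2 ^ n), latticeWeight w i j * y j :=
  schrodinger_mulVec (W := fun i j : Fin (2 ^ n) => latticeWeight w i j)
    (fun i => latticeWeight_self w (i : ℕ)) x y i

variable {w : ℝ} {n : ℕ} {x : Fin (2 ^ (n + 1)) → ℝ}

/-- The field at the children in terms of the field at the parents. -/
theorem ballField_children (hw : 0 < w)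
    (h : (schrodinger (fun i j : Fin (2 ^ n) => latticeWeight w i j) (merge w n x)).PosDef)
    (h' : (schrodinger (fun i j : Fin (2 ^ (n + 1)) => latticeWeight w i j) x).PosDef)
    (k : Fin (2 ^ n)) :
    ballField w (n + 1) x (leftChild k)
      = childRatio (w / 4) (x (leftChild k)) (x (rightChild k)) * ballField w n (merge w n x) k ∧
    ballField w (n + 1) x (rightChild k)
      = childRatio (w / 4) (x (rightChild k)) (x (leftChild k)) * ballField w n (merge w n x) k := by
  set y := ballField w n (merge w n x) with hy
  -- The candidate solution. As the two ratios add up to `2`, a pair of children contributes to the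
  -- row of a distant vertex half of what its parent did; the boundary weight is halved too, so each
  -- child row reduces to half of the parent row.
  let z : Fin (2 ^ (n + 1)) → ℝ := Sum.elim
    (fun k => childRatio (w / 4) (x (leftChild k)) (x (rightChild k)) * y k)
    (fun k => childRatio (w / 4) (x (rightChild k)) (x (leftChild k)) * y k) ∘ (childEquiv n).symm
  have hzl : ∀ k, z (leftChild k)
      = childRatio (w / 4) (x (leftChild k)) (x (rightChild k)) * y k := fun k => by
    simp only [z, Function.comp, ← childEquiv_inl, Equiv.symm_apply_apply, Sum.elim_inl]
  have hzr : ∀ k, z (rightChild k)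
      = childRatio (w / 4) (x (rightChild k)) (x (leftChild k)) * y k := fun k => by
    simp only [z, Function.comp, ← childEquiv_inr, Equiv.symm_apply_apply, Sum.elim_inr]
  have hs : 0 < w / 4 := by positivity
  have hz : ∀ k, z (leftChild k) + z (rightChild k) = 2 * y k := fun k => by
    rw [hzl, hzr, ← add_mul, childRatio_add hs (pos_of_posDef h' _) (pos_of_posDef h' _)]
  have hrow : ∀ k, 2 * merge w n x k * y k - ∑ l : Fin (2 ^ n), latticeWeight w k l * y l
      = boundaryWeight w n := fun k => by
    rw [← schrodinger_latticeWeight_mulVec, hy, schrodinger_mulVec_ballField h]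
  have hsum : ∀ k (f : Fin (2 ^ n) → ℝ), (∀ l, k ≠ l → f l = latticeWeight w k l * y l / 2) →
      ∑ l, f l = f k + (∑ l : Fin (2 ^ n), latticeWeight w k l * y l) / 2 := by
    intro k f hf
    rw [← Finset.add_sum_erase _ _ (Finset.mem_univ k),
      ← Finset.add_sum_erase _ (fun l : Fin (2 ^ n) => latticeWeight w k l * y l)
        (Finset.mem_univ k), latticeWeight_self, zero_mul, zero_add, Finset.sum_div]
    congr 1
    exact Finset.sum_congr rfl fun l hl => hf l (Finset.ne_of_mem_erase hl).symm
  have key : (schrodinger (fun i j : Fin (2 ^ (n + 1)) => latticeWeight w i j) x).mulVec z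
      = fun _ => boundaryWeight w (n + 1) := by
    refine funext (forall_children (fun k => ?_) fun k => ?_) <;>
      rw [schrodinger_latticeWeight_mulVec, sum_children]
    · have ha := pos_of_posDef h' (leftChild k)
      have hb := pos_of_posDef h' (rightChild k)
      rw [hsum k _ fun l hl => by
        rw [latticeWeight_left_left_of_ne w hl, latticeWeight_left_right_of_ne w hl, ← mul_add, hz]
        ring]
      have hk := hrow k
      rw [latticeWeight_self, latticeWeight_left_right, hzl, hzr, boundaryWeight_succ, ← hk, merge,
        mergedPotential_eq, childRatio, childRatio, add_comm (x (rightChild k))]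
      field_simp
      ring
    · have ha := pos_of_posDef h' (leftChild k)
      have hb := pos_of_posDef h' (rightChild k)
      rw [hsum k _ fun l hl => by
        rw [latticeWeight_right_right_of_ne w hl, latticeWeight_comm,
          latticeWeight_left_right_of_ne w hl.symm, latticeWeight_comm, ← mul_add, hz]
        ring]
      have hk := hrow k
      rw [latticeWeight_self, latticeWeight_comm, latticeWeight_left_right, hzl, hzr,
        boundaryWeight_succ, ← hk, merge,
        mergedPotential_eq, childRatio, childRatio, add_comm (x (rightChild k))]
      field_simp
      ring
  have hfin : ballField w (n + 1) x = z := inv_mulVec_eq h' key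
  rw [hfin]
  exact ⟨hzl k, hzr k⟩

lemma ballField_zero_pos (hw : 0 < w) {x : Fin (2 ^ 0) → ℝ}
    (h : (schrodinger (fun i j : Fin (2 ^ 0) => latticeWeight w i j) x).PosDef) :
    0 < ballField w 0 x 0 := by
  have h1 := congrFun (schrodinger_mulVec_ballField h) 0
  rw [schrodinger_latticeWeight_mulVec] at h1
  have h0 : ∀ f : Fin (2 ^ 0) → ℝ, ∑ j, f j = f 0 := fun f => Fin.sum_univ_one f
  rw [h0, latticeWeight_self, zero_mul, sub_zero] at h1
  have h2 := pos_of_posDef h 0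
  have h3 := boundaryWeight_pos hw 0
  by_contra hneg
  have : 2 * x 0 * ballField w 0 x 0 ≤ 0 :=
    mul_nonpos_of_nonneg_of_nonpos (by linarith) (not_lt.1 hneg)
  linarith

end H22

namespace H22

/-! ### The field along a branch -/

/-- The exchange of all pairs of siblings. -/
noncomputable def siblingSwap (n : ℕ) : Equiv.Perm (Fin (2 ^ (n + 1))) :=
  ((childEquiv n).symm.trans (Equiv.sumComm _ _)).trans (childEquiv n)

@[simp] lemma siblingSwap_leftChild {n : ℕ} (k : Fin (2 ^ n)) :
    siblingSwap n (leftChild k) = rightChild k := by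
  simp [siblingSwap, ← childEquiv_inl]

@[simp] lemma siblingSwap_rightChild {n : ℕ} (k : Fin (2 ^ n)) :
    siblingSwap n (rightChild k) = leftChild k := by
  simp [siblingSwap, ← childEquiv_inr]

lemma latticeWeight_siblingSwap (w : ℝ) {n : ℕ} (i j : Fin (2 ^ (n + 1))) :
    latticeWeight w (siblingSwap n i) (siblingSwap n j) = latticeWeight w i j := by
  obtain ⟨i, rfl⟩ := (childEquiv n).surjective i
  obtain ⟨j, rfl⟩ := (childEquiv n).surjective j
  rcases i with k | k <;> rcases j with l | l <;> rcases eq_or_ne k l with rfl | h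
  · simp [latticeWeight_self]
  · simp [latticeWeight_left_left_of_ne w h, latticeWeight_right_right_of_ne w h]
  · simp [latticeWeight_comm]
  · simp [latticeWeight_comm (rightChild k : ℕ), latticeWeight_left_right_of_ne w h,
      latticeWeight_left_right_of_ne w h.symm, latticeWeight_comm (l : ℕ)]
  · simp [latticeWeight_comm]
  · simp [latticeWeight_comm (rightChild k : ℕ), latticeWeight_left_right_of_ne w h,
      latticeWeight_left_right_of_ne w h.symm, latticeWeight_comm (l : ℕ)]
  · simp [latticeWeight_self]
  · simp [latticeWeight_left_left_of_ne w h, latticeWeight_right_right_of_ne w h]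

lemma merge_comp_siblingSwap (w : ℝ) {n : ℕ} (x : Fin (2 ^ (n + 1)) → ℝ) :
    merge w n (x ∘ siblingSwap n) = merge w n x := by
  funext k
  simp [merge, mergedPotential_comm _ (x (rightChild k))]

/-- Potentials on the balls `Λ_n`, each of which is obtained from the next one by merging all pairs
of siblings. -/
structure IsMergingFamily {Ω : Type*} [MeasurableSpace Ω] (P : Measure Ω) (w : ℝ)
    (T : (n : ℕ) → Ω → Fin (2 ^ n) → ℝ) : Prop where
  measurable : ∀ n, Measurable (T n)
  law : ∀ n, P.map (T n) = ballLaw w n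
  merge_eq : ∀ n, ∀ᵐ ω ∂P, merge w n (T (n + 1) ω) = T n ω

lemma IsFineGrainingCoupling.isMergingFamily {Ω : Type*} [MeasurableSpace Ω] {P : Measure Ω}
    [IsProbabilityMeasure P] {w : ℝ} (hw : 0 < w) {β : (n : ℕ) → Ω → Vertex n → ℝ}
    (h : IsFineGrainingCoupling P 2 w β) : IsMergingFamily P w (betaLevel β) where
  measurable := measurable_betaLevel h
  law := map_betaLevel hw h
  merge_eq n := by
    filter_upwards [h.coarse n] with ω hω
    funext k
    rw [betaLevel, ← hω]
    simp only [coarseGrain, levelTemperature, div_self (two_ne_zero' ℝ), one_pow, mul_one,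
      wiredWeight_some_some, latticeWeight_left_right]
    rfl

/-- A sequence of vertices each of which is the parent of the next one. -/
structure IsBranch (i : ℕ → ℕ) : Prop where
  zero : i 0 = 0
  succ : ∀ n, i (n + 1) / 2 = i n

lemma IsBranch.lt {i : ℕ → ℕ} (h : IsBranch i) (n : ℕ) : i n < 2 ^ n := by
  induction n with
  | zero => simp [h.zero]
  | succ n ih => have := h.succ n; rw [pow_succ]; omega

lemma isBranch_floor {x : ℝ} (hx : x ∈ Set.Ico (0 : ℝ) 1) : IsBranch fun n => ⌊2 ^ n * x⌋₊ where
  zero := by simpa using hx.2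
  succ n := by
    rw [show (2 : ℝ) ^ n * x = 2 ^ (n + 1) * x / (2 : ℕ) by rw [pow_succ]; push_cast; ring,
      Nat.floor_div_natCast]

section

variable {Ω : Type*} [MeasurableSpace Ω] {P : Measure Ω} [IsProbabilityMeasure P] {w : ℝ}
  {T : (n : ℕ) → Ω → Fin (2 ^ n) → ℝ}

lemma IsMergingFamily.ae_posDef (h : IsMergingFamily P w T) : ∀ᵐ ω ∂P, ∀ n,
    (schrodinger (fun i j : Fin (2 ^ n) => latticeWeight w i j) (T n ω)).PosDef := by
  refine ae_all_iff.2 fun n => ?_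
  have h1 := ae_posDef_ballLaw w n
  rw [← h.law] at h1
  exact ae_of_ae_map (h.measurable n).aemeasurable h1

lemma IsMergingFamily.measurable_field (h : IsMergingFamily P w T) (n : ℕ) (i : Fin (2 ^ n)) :
    Measurable fun ω => ballField w n (T n ω) i :=
  (measurable_pi_apply i).comp ((measurable_ballField w n).comp (h.measurable n))

lemma IsMergingFamily.ae_children (hw : 0 < w) (h : IsMergingFamily P w T) (n : ℕ) :
    ∀ᵐ ω ∂P, ∀ k, ballField w (n + 1) (T (n + 1) ω) (leftChild k)
        + ballField w (n + 1) (T (n + 1) ω) (rightChild k) = 2 * ballField w n (T n ω) k := by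
  filter_upwards [h.ae_posDef, h.merge_eq n] with ω hpd hm k
  have h1 := hpd n
  have h2 := hpd (n + 1)
  rw [← hm] at h1 ⊢
  obtain ⟨hl, hr⟩ := ballField_children hw h1 h2 k
  rw [hl, hr, ← add_mul, childRatio_add (by positivity) (pos_of_posDef h2 _) (pos_of_posDef h2 _)]

lemma measurePreserving_siblingSwap (hw : 0 < w) (n : ℕ) :
    MeasurePreserving (fun x => x ∘ siblingSwap n) (ballLaw w (n + 1)) (ballLaw w (n + 1)) :=
  ⟨measurable_comp_right _, map_comp_ballLaw hw (latticeWeight_siblingSwap w)⟩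

/-- The exchange of siblings preserves the law of the fine level, fixes its coarse-graining and
hence every event determined by it, and interchanges the two fields. -/
lemma IsMergingFamily.setLIntegral_leftChild_eq (hw : 0 < w) (h : IsMergingFamily P w T) (n : ℕ)
    {B : Set (Fin (2 ^ n) → ℝ)} (hB : MeasurableSet B) (k : Fin (2 ^ n)) :
    ∫⁻ ω in T n ⁻¹' B, ENNReal.ofReal (ballField w (n + 1) (T (n + 1) ω) (leftChild k)) ∂P
      = ∫⁻ ω in T n ⁻¹' B, ENNReal.ofReal (ballField w (n + 1) (T (n + 1) ω) (rightChild k)) ∂P := by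
  have hset : T n ⁻¹' B =ᵐ[P] T (n + 1) ⁻¹' (merge w n ⁻¹' B) := by
    filter_upwards [h.merge_eq n] with ω hω
    exact congrArg (· ∈ B) hω.symm
  have hB' := measurable_merge w n hB
  have hf : ∀ i, Measurable fun x => ENNReal.ofReal (ballField w (n + 1) x i) := fun i =>
    ((measurable_pi_apply i).comp (measurable_ballField w (n + 1))).ennreal_ofReal
  have e := fun i => setLIntegral_map (μ := P) hB' (hf i) (h.measurable (n + 1))
  simp only [h.law] at e
  rw [setLIntegral_congr hset, setLIntegral_congr hset, ← e, ← e,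
    ← (measurePreserving_siblingSwap hw n).setLIntegral_comp_preimage hB' (hf _)]
  have hpre : (fun x => x ∘ siblingSwap n) ⁻¹' (merge w n ⁻¹' B) = merge w n ⁻¹' B := by
    ext x
    simp only [Set.mem_preimage, merge_comp_siblingSwap]
  rw [hpre]
  refine lintegral_congr fun x => ?_
  have := field_comp_equiv (siblingSwap n)
    (W := fun i j : Fin (2 ^ (n + 1)) => latticeWeight w i j)
    (η := fun _ => boundaryWeight w (n + 1)) (latticeWeight_siblingSwap w) (fun _ => rfl) x
  change ENNReal.ofReal (ballField w (n + 1) (x ∘ siblingSwap n) _) = _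
  rw [ballField, this, Function.comp, siblingSwap_leftChild]
  rfl

/-- The children have equal integrals over coarse events and almost surely add up to twice the
parent; this is the martingale property along branches. -/
lemma IsMergingFamily.setLIntegral_children (hw : 0 < w) (h : IsMergingFamily P w T) (n : ℕ)
    {B : Set (Fin (2 ^ n) → ℝ)} (hB : MeasurableSet B) (k : Fin (2 ^ n)) :
    ∫⁻ ω in T n ⁻¹' B, ENNReal.ofReal (ballField w (n + 1) (T (n + 1) ω) (leftChild k)) ∂P
      = ∫⁻ ω in T n ⁻¹' B, ENNReal.ofReal (ballField w n (T n ω) k) ∂P := by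
  have h1 := h.setLIntegral_leftChild_eq hw n hB k
  have h2 : ∫⁻ ω in T n ⁻¹' B, ENNReal.ofReal (ballField w (n + 1) (T (n + 1) ω) (leftChild k)) ∂P
      + ∫⁻ ω in T n ⁻¹' B, ENNReal.ofReal (ballField w (n + 1) (T (n + 1) ω) (rightChild k)) ∂P
      = 2 * ∫⁻ ω in T n ⁻¹' B, ENNReal.ofReal (ballField w n (T n ω) k) ∂P := by
    rw [← lintegral_add_left (h.measurable_field _ _).ennreal_ofReal,
      ← lintegral_const_mul _ (h.measurable_field _ _).ennreal_ofReal]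
    refine lintegral_congr_ae (ae_restrict_of_ae ?_)
    filter_upwards [h.ae_children hw n, h.ae_posDef] with ω hω hpd
    rw [← ENNReal.ofReal_add (ballField_nonneg hw (hpd _) _) (ballField_nonneg hw (hpd _) _), hω,
      ENNReal.ofReal_mul two_pos.le, ENNReal.ofReal_ofNat]
  rw [← h1, ← two_mul] at h2
  exact (ENNReal.mul_right_inj two_ne_zero ENNReal.ofNat_ne_top).1 h2

/-- The field along a branch converges almost surely. -/
theorem IsMergingFamily.ae_tendsto (hw : 0 < w) (h : IsMergingFamily P w T) {i : ℕ → ℕ}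
    (hi : IsBranch i) : ∀ᵐ ω ∂P, ∃ c, 0 ≤ c ∧
      Tendsto (fun n => extendedField w n (T n ω) (i n)) atTop (𝓝 c) := by
  -- Level `n` is a function of level `n + 1` only almost surely, so the `σ`-algebras are nested
  -- only modulo null sets.
  let ℱ : Filtration ℕ (inferInstance : MeasurableSpace Ω) :=
    { seq := fun n => aeComap P (T n)
      mono' := monotone_nat_of_le_succ fun n => aeComap_comp_le P (measurable_merge w n) <| by
        filter_upwards [h.merge_eq n] with ω hω using hω.symm
      le' := fun n => aeComap_le P (T n) }
  have hM : ∀ n ω, extendedField w n (T n ω) (i n) = ballField w n (T n ω) ⟨i n, hi.lt n⟩ :=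
    fun n ω => dif_pos (hi.lt n)
  simp only [hM]
  refine ae_tendsto_of_supermartingale P ℱ (fun n => ?_) (fun n => ?_) (fun n => ?_) fun n A hA => ?_
  · exact ((measurable_pi_apply _).comp (measurable_ballField w n)).comp
      (measurable_aeComap P (h.measurable n))
  · filter_upwards [h.ae_posDef] with ω hpd using ballField_nonneg hw (hpd n) _
  · have e := lintegral_map (μ := P) ((measurable_pi_apply ⟨i n, hi.lt n⟩).comp
      (measurable_ballField w n)).ennreal_ofReal (h.measurable n)
    rw [h.law] at e
    exact e.symm.le.trans (lintegral_ballField_le_one hw n _)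
  · obtain ⟨-, B, hB, hAB⟩ := hA
    rw [setLIntegral_congr hAB, setLIntegral_congr hAB]
    refine le_of_eq ?_
    have h1 := h.setLIntegral_children hw n hB ⟨i n, hi.lt n⟩
    have hsucc := hi.succ n
    rcases Nat.mod_two_eq_zero_or_one (i (n + 1)) with h2 | h2
    · rw [← h1, show (⟨i (n + 1), hi.lt (n + 1)⟩ : Fin (2 ^ (n + 1))) = leftChild ⟨i n, hi.lt n⟩
        from Fin.ext (show i (n + 1) = 2 * i n by omega)]
    · rw [← h1, h.setLIntegral_leftChild_eq hw n hB,
        show (⟨i (n + 1), hi.lt (n + 1)⟩ : Fin (2 ^ (n + 1))) = rightChild ⟨i n, hi.lt n⟩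
        from Fin.ext (show i (n + 1) = 2 * i n + 1 by omega)]

/-- Exclusive or with `i` is an automorphism that preserves `Λ_n` and moves `0` to `i`. -/
lemma map_extendedField_ballLaw (hw : 0 < w) {n i : ℕ} (hi : i < 2 ^ n) :
    (ballLaw w n).map (fun x => extendedField w n x i)
      = (ballLaw w n).map (fun x => extendedField w n x 0) := by
  have hg : ∀ j, xorPerm i j < 2 ^ n ↔ j < 2 ^ n := fun j => by
    rw [xorPerm_apply]
    refine ⟨fun h => ?_, fun h => Nat.xor_lt_two_pow h hi⟩
    simpa using Nat.xor_lt_two_pow h hi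
  have hσ : ∀ a b : Fin (2 ^ n), hierDist (permBall hg a) (permBall hg b) = hierDist a b :=
    fun a b => xorPerm_mem i a b
  have h1 : (ballLaw w n).map (fun x => x ∘ permBall hg) = ballLaw w n :=
    map_comp_ballLaw hw fun a b => by
      simp only [latticeWeight, hσ, Fin.val_inj, (permBall hg).injective.eq_iff]
  have hm : ∀ j, Measurable fun x => extendedField w n x j := fun j =>
    (measurable_pi_apply j).comp (measurable_extendedField w n)
  conv_rhs => rw [← h1, Measure.map_map (hm 0) (measurable_comp_right _)]
  congr 1
  funext x
  have h0 : permBall hg ⟨0, by positivity⟩ = ⟨i, hi⟩ := Fin.ext (by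
    change xorPerm i 0 = i
    simp [xorPerm_apply])
  simp only [Function.comp_def, extendedField, dif_pos hi, dif_pos (show 0 < 2 ^ n by positivity)]
  have := congrFun (ballField_comp_perm (w := w) hσ x) ⟨0, by positivity⟩
  simp only [Function.comp_def, h0] at this
  exact this.symm

lemma map_eq_of_tendsto {Ω' E : Type*} [MeasurableSpace Ω'] {Q : Measure Ω'}
    [IsProbabilityMeasure Q] [TopologicalSpace E] [MeasurableSpace E] [BorelSpace E]
    [HasOuterApproxClosed E] {X : ℕ → Ω → E} {Y : ℕ → Ω' → E} {Z : Ω → E} {Z' : Ω' → E}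
    (hX : ∀ n, AEMeasurable (X n) P) (hY : ∀ n, AEMeasurable (Y n) Q) (hZ : AEMeasurable Z P)
    (hZ' : AEMeasurable Z' Q) (h : ∀ n, P.map (X n) = Q.map (Y n))
    (hXZ : ∀ᵐ ω ∂P, Tendsto (fun n => X n ω) atTop (𝓝 (Z ω)))
    (hYZ : ∀ᵐ ω ∂Q, Tendsto (fun n => Y n ω) atTop (𝓝 (Z' ω))) : P.map Z = Q.map Z' := by
  have h1 := tendstoInDistribution_of_ae_tendsto hX hZ hXZ
  have h2 := tendstoInDistribution_of_ae_tendsto hY hZ' hYZ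
  have h3 : TendstoInDistribution X atTop Z' (fun _ => P) Q :=
    ⟨hX, hZ', Tendsto.congr (fun n => Subtype.ext (h n).symm) h2.tendsto⟩
  exact tendstoInDistribution_unique X h1 h3

/-- The limit of the field along a branch. -/
noncomputable def branchLimit (w : ℝ) (t : (n : ℕ) → Fin (2 ^ n) → ℝ) (i : ℕ → ℕ) : ℝ≥0∞ :=
  limsup (fun n => ENNReal.ofReal (extendedField w n (t n) (i n))) atTop

lemma IsMergingFamily.ae_branchLimit (hw : 0 < w) (h : IsMergingFamily P w T) {i : ℕ → ℕ}
    (hi : IsBranch i) : ∀ᵐ ω ∂P, branchLimit w (fun n => T n ω) i < ∞ ∧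
      Tendsto (fun n => extendedField w n (T n ω) (i n)) atTop
        (𝓝 (branchLimit w (fun n => T n ω) i).toReal) := by
  filter_upwards [h.ae_tendsto hw hi] with ω ⟨c, hc, hω⟩
  have h1 : branchLimit w (fun n => T n ω) i = ENNReal.ofReal c :=
    ((ENNReal.continuous_ofReal.tendsto _).comp hω).limsup_eq
  rw [h1, ENNReal.toReal_ofReal hc]
  exact ⟨ENNReal.ofReal_lt_top, hω⟩

lemma IsMergingFamily.measurable_extendedField_apply (h : IsMergingFamily P w T) (n i : ℕ) :
    Measurable fun ω => extendedField w n (T n ω) i :=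
  (measurable_pi_apply i).comp ((measurable_extendedField w n).comp (h.measurable n))

lemma IsMergingFamily.measurable_branchLimit (h : IsMergingFamily P w T) (i : ℕ → ℕ) :
    Measurable fun ω => branchLimit w (fun n => T n ω) i :=
  Measurable.limsup fun n => (h.measurable_extendedField_apply n (i n)).ennreal_ofReal

/-- At each level the field on the branch has the law of the lattice field at `0`. The two sequences
are coupled across levels differently, but both converge almost surely, so their limits have the
same law. -/
lemma IsMergingFamily.measure_branchLimit_eq_zero (hw : 0 < w) (h : IsMergingFamily P w T)
    {i : ℕ → ℕ} (hi : IsBranch i) :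
    P {ω | branchLimit w (fun n => T n ω) i = 0} = latticeLaw hw {b | limitField w b 0 = 0} := by
  have hm : ∀ n j, Measurable fun x => extendedField w n x j := fun n j =>
    (measurable_pi_apply j).comp (measurable_extendedField w n)
  have hr := measurable_restrictBall
  have hL : Measurable fun b => limitField w b 0 :=
    (measurable_pi_apply 0).comp (measurable_limitField w)
  have key := map_eq_of_tendsto (P := P) (Q := latticeLaw hw)
    (X := fun n ω => extendedField w n (T n ω) (i n))
    (Y := fun n b => extendedField w n (restrictBall n b) 0)
    (Z := fun ω => (branchLimit w (fun n => T n ω) i).toReal) (Z' := fun b => limitField w b 0)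
    (fun n => (h.measurable_extendedField_apply n _).aemeasurable)
    (fun n => ((hm n 0).comp (hr n)).aemeasurable)
    (h.measurable_branchLimit i).ennreal_toReal.aemeasurable
    hL.aemeasurable
    (fun n => ?_) ((h.ae_branchLimit hw hi).mono fun ω hω => hω.2)
    ((ae_tendsto_limitField hw).mono fun b hb => tendsto_pi_nhds.1 hb 0)
  · have h1 := congrArg (fun ν => ν {(0 : ℝ)}) key
    beta_reduce at h1
    rw [Measure.map_apply (h.measurable_branchLimit i).ennreal_toReal (measurableSet_singleton 0),
      Measure.map_apply hL (measurableSet_singleton 0)] at h1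
    refine Eq.trans (measure_congr ?_) h1
    filter_upwards [h.ae_branchLimit hw hi] with ω hω
    change (_ = _) = (_ = _)
    rw [ENNReal.toReal_eq_zero_iff]
    simp [hω.1.ne]
  · have h1 := Measure.map_map (μ := P) (hm n (i n)) (h.measurable n)
    have h2 := Measure.map_map (μ := latticeLaw hw) (hm n 0) (hr n)
    rw [h.law] at h1
    rw [map_restrictBall_latticeLaw] at h2
    exact h1.symm.trans ((map_extendedField_ballLaw hw (hi.lt n)).trans h2)

/-- Along every branch the field vanishes in the limit, or along every branch it does not. -/
theorem IsMergingFamily.branchLimit_zero_or_pos (hw : 0 < w) (h : IsMergingFamily P w T) :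
    (∀ i, IsBranch i → ∀ᵐ ω ∂P, branchLimit w (fun n => T n ω) i = 0) ∨
      ∀ i, IsBranch i → ∀ᵐ ω ∂P, 0 < branchLimit w (fun n => T n ω) i := by
  rcases limitField_zero_or_one hw with h0 | h0
  · refine Or.inr fun i hi => ?_
    have := h.measure_branchLimit_eq_zero hw hi
    rw [h0] at this
    rw [ae_iff]
    simpa only [not_lt, nonpos_iff_eq_zero] using this
  · refine Or.inl fun i hi => ?_
    have := h.measure_branchLimit_eq_zero hw hi
    rw [h0] at this
    exact (mem_ae_iff_prob_eq_one (h.measurable_branchLimit i (measurableSet_singleton 0))).2 this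

end

end H22

namespace H22

/-! ### The field does not vanish in the limit along all branches -/

/-- The point is the supremum of the left endpoints of the dyadic intervals. Every left turn
strictly lowers the right endpoint, so infinitely many of them keep the supremum inside all the
half-open intervals. -/
lemma IsBranch.exists_real {g : ℕ → ℕ} (h : IsBranch g) :
    (∃ x ∈ Set.Ico (0 : ℝ) 1, (fun n => ⌊2 ^ n * x⌋₊) = g) ∨
      ∃ N, ∀ m ≥ N, g (m + 1) = 2 * g m + 1 := by
  refine or_iff_not_imp_right.2 fun hN => ?_
  push Not at hN
  have hcases : ∀ n, g (n + 1) = 2 * g n ∨ g (n + 1) = 2 * g n + 1 := fun n => by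
    have := h.succ n; omega
  set a : ℕ → ℝ := fun n => g n / 2 ^ n with ha
  set u : ℕ → ℝ := fun n => (g n + 1) / 2 ^ n with hu
  have ha_mono : Monotone a := monotone_nat_of_le_succ fun n => by
    have h1 : (2 * g n : ℝ) ≤ g (n + 1) := by
      rcases hcases n with h1 | h1 <;> rw [h1] <;> push_cast <;> linarith
    simp only [ha]
    rw [div_le_div_iff₀ (by positivity) (by positivity), pow_succ]
    nlinarith [pow_pos (two_pos (α := ℝ)) n]
  have hu_anti : Antitone u := antitone_nat_of_succ_le fun n => by
    have h1 : (g (n + 1) : ℝ) ≤ 2 * g n + 1 := by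
      rcases hcases n with h1 | h1 <;> rw [h1] <;> push_cast <;> linarith
    simp only [hu]
    rw [div_le_div_iff₀ (by positivity) (by positivity), pow_succ]
    nlinarith [pow_pos (two_pos (α := ℝ)) n]
  have hau : ∀ n, a n ≤ u n := fun n => by
    simp only [ha, hu]; gcongr; linarith
  have hau' : ∀ m n, a m ≤ u n := fun m n =>
    (ha_mono (le_max_left m n)).trans ((hau _).trans (hu_anti (le_max_right m n)))
  have hbdd : BddAbove (Set.range a) := ⟨u 0, by rintro _ ⟨m, rfl⟩; exact hau' m 0⟩
  have hlow : ∀ n, a n ≤ ⨆ m, a m := fun n => le_ciSup hbdd n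
  have hup : ∀ n, ⨆ m, a m < u n := fun n => by
    obtain ⟨m, hm, hm'⟩ := hN n
    refine lt_of_le_of_lt (ciSup_le fun k => hau' k (m + 1)) (lt_of_lt_of_le ?_ (hu_anti hm))
    have h1 := (hcases m).resolve_right hm'
    simp only [hu, h1]
    rw [div_lt_div_iff₀ (by positivity) (by positivity), pow_succ]
    push_cast
    nlinarith [pow_pos (two_pos (α := ℝ)) m]
  have h0 : (0 : ℝ) ≤ ⨆ m, a m := by
    have := hlow 0
    simpa [ha, h.zero] using this
  refine ⟨⨆ m, a m, ⟨h0, by simpa [hu, h.zero] using hup 0⟩, funext fun n => ?_⟩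
  have h1 := hlow n
  have h2 := hup n
  simp only [ha, hu] at h1 h2
  rw [div_le_iff₀ (by positivity)] at h1
  rw [lt_div_iff₀ (by positivity)] at h2
  rw [Nat.floor_eq_iff (by positivity)]
  constructor <;> linarith

/-- The branch that passes through the vertex `k` of `Λ_n` and then always turns right. -/
def rightBranch (n k m : ℕ) : ℕ := ((k + 1) * 2 ^ m - 1) / 2 ^ n

lemma isBranch_rightBranch {n k : ℕ} (hk : k < 2 ^ n) : IsBranch (rightBranch n k) where
  zero := by simp [rightBranch, Nat.div_eq_of_lt hk]
  succ m := by
    have h1 : 0 < (k + 1) * 2 ^ m := by positivity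
    rw [rightBranch, rightBranch, Nat.div_div_eq_div_mul, mul_comm (2 ^ n), ← Nat.div_div_eq_div_mul,
      pow_succ, ← mul_assoc]
    congr 1
    omega

lemma IsBranch.eventually_eq_rightBranch {g : ℕ → ℕ} {N : ℕ}
    (hN : ∀ m ≥ N, g (m + 1) = 2 * g m + 1) : ∀ m ≥ N, g m = rightBranch N (g N) m := by
  have h1 : ∀ j, g (N + j) + 1 = (g N + 1) * 2 ^ j := fun j => by
    induction j with
    | zero => simp
    | succ j ih =>
      have := hN (N + j) (by omega)
      rw [← add_assoc, this, pow_succ, ← mul_assoc, ← ih]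
      ring
  intro m hm
  obtain ⟨j, rfl⟩ := Nat.exists_eq_add_of_le hm
  have h2 : 0 < 2 ^ N := by positivity
  have h3 : (g N + 1) * 2 ^ (N + j) - 1 = 2 ^ N * g (N + j) + (2 ^ N - 1) := by
    rw [pow_add, mul_left_comm, ← h1 j, mul_add, mul_one]
    omega
  rw [rightBranch, h3, Nat.mul_add_div h2, Nat.div_eq_of_lt (by omega), add_zero]

/-- A parent is the mean of its children, so one child is not smaller; always move there. -/
lemma exists_branch_monotone {F : ℕ → ℕ → ℝ}
    (hF : ∀ n k, k < 2 ^ n → F (n + 1) (2 * k) + F (n + 1) (2 * k + 1) = 2 * F n k) :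
    ∃ g, IsBranch g ∧ ∀ n, F n (g n) ≤ F (n + 1) (g (n + 1)) := by
  let g : ℕ → ℕ := fun n => Nat.rec 0
    (fun n k => if F n k ≤ F (n + 1) (2 * k) then 2 * k else 2 * k + 1) n
  have hg : ∀ n, g (n + 1) = if F n (g n) ≤ F (n + 1) (2 * g n) then 2 * g n else 2 * g n + 1 :=
    fun n => rfl
  have hb : IsBranch g := ⟨rfl, fun n => by rw [hg]; split_ifs <;> omega⟩
  refine ⟨g, hb, fun n => ?_⟩
  rw [hg]
  split_ifs with h
  · exact h
  · linarith [hF n (g n) (hb.lt n)]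

variable {Ω : Type*} [MeasurableSpace Ω] {P : Measure Ω} [IsProbabilityMeasure P] {w : ℝ}
  {T : (n : ℕ) → Ω → Fin (2 ^ n) → ℝ}

/-- If the limit is almost surely zero along each fixed branch, follow a random branch on which the
field does not decrease: it starts from a positive value. It could fail to come from a real number
only by turning right forever, but there are countably many such branches and almost surely the
limit is zero on all of them. -/
lemma IsMergingFamily.ae_exists_pos (hw : 0 < w) (h : IsMergingFamily P w T) :
    ∀ᵐ ω ∂P, ∃ x ∈ Set.Ico (0 : ℝ) 1,
      0 < branchLimit w (fun n => T n ω) (fun n => ⌊2 ^ n * x⌋₊) := by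
  rcases h.branchLimit_zero_or_pos hw with h0 | h0
  · have hright : ∀ᵐ ω ∂P, ∀ n k, k < 2 ^ n →
        branchLimit w (fun n => T n ω) (rightBranch n k) = 0 :=
      ae_all_iff.2 fun n => ae_all_iff.2 fun k => by
        by_cases hk : k < 2 ^ n
        · filter_upwards [h0 _ (isBranch_rightBranch hk)] with ω hω _ using hω
        · exact ae_of_all _ fun ω h => absurd h hk
    filter_upwards [hright, h.ae_posDef, ae_all_iff.2 (h.ae_children hw)] with ω hω hpd hch
    obtain ⟨g, hg, hmono⟩ := exists_branch_monotone
      (F := fun n k => extendedField w n (T n ω) k) fun n k hk => by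
        have h1 : 2 * k < 2 ^ (n + 1) := by rw [pow_succ]; omega
        have h2 : 2 * k + 1 < 2 ^ (n + 1) := by rw [pow_succ]; omega
        simp only [extendedField, dif_pos hk, dif_pos h1, dif_pos h2]
        exact hch n ⟨k, hk⟩
    have hpos : 0 < branchLimit w (fun n => T n ω) g := by
      refine lt_of_lt_of_le (ENNReal.ofReal_pos.2 (ballField_zero_pos hw (hpd 0)))
        (le_trans ?_ liminf_le_limsup)
      refine le_liminf_of_le (by isBoundedDefault) (Eventually.of_forall fun n => ?_)
      refine ENNReal.ofReal_le_ofReal (le_trans (le_of_eq ?_) (monotone_nat_of_le_succ hmono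
        (Nat.zero_le n)))
      rw [hg.zero]
      rfl
    rcases hg.exists_real with ⟨x, hx, rfl⟩ | ⟨N, hN⟩
    · exact ⟨x, hx, hpos⟩
    · refine absurd (hω N (g N) (hg.lt N)) (ne_of_gt ?_)
      convert hpos using 1
      refine limsup_congr ?_
      filter_upwards [eventually_ge_atTop N] with m hm
      rw [IsBranch.eventually_eq_rightBranch hN m hm]
  · have hz : (0 : ℝ) ∈ Set.Ico (0 : ℝ) 1 := ⟨le_rfl, one_pos⟩
    filter_upwards [h0 _ (isBranch_floor hz)] with ω hω using ⟨0, hz, hω⟩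

end H22

namespace H22

/-! ### Analytic sets are universally measurable -/

section Analytic

variable {α : Type*} [TopologicalSpace α] [MeasurableSpace α]

/-- The sequences whose first `n` terms are bounded by the terms of `k`. -/
def boundedPrefix (k : ℕ → ℕ) (n : ℕ) : Set (ℕ → ℕ) := {x | ∀ i < n, x i ≤ k i}

lemma isCompact_forall_le (k : ℕ → ℕ) : IsCompact {x : ℕ → ℕ | ∀ i, x i ≤ k i} := by
  have : IsCompact (Set.univ.pi fun i => Set.Iic (k i)) :=
    isCompact_univ_pi fun i => (Set.finite_Iic (k i)).isCompact
  convert this using 1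
  exact Set.ext fun x => ⟨fun h i _ => h i, fun h i => h i trivial⟩

/-- Otherwise choose points outside `V` with longer and longer bounded prefixes. Truncated by `k`
they have a convergent subsequence, and truncation does not affect the limit, which lies in `V`. -/
lemma exists_boundedPrefix_subset {k : ℕ → ℕ} {V : Set (ℕ → ℕ)} (hV : IsOpen V)
    (h : {x : ℕ → ℕ | ∀ i, x i ≤ k i} ⊆ V) : ∃ n, boundedPrefix k n ⊆ V := by
  by_contra! hcon
  have hx : ∀ n, ∃ x ∈ boundedPrefix k n, x ∉ V := fun n => Set.not_subset.1 (hcon n)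
  choose x hx hxV using hx
  obtain ⟨y, hy, φ, hφ, hlim⟩ := (isCompact_forall_le k).tendsto_subseq (x := fun n i => min (x n i) (k i))
    fun n i => min_le_right _ _
  suffices Tendsto (fun n => x (φ n)) atTop (𝓝 y) from
    hV.isClosed_compl.mem_of_tendsto this (Eventually.of_forall fun n => hxV (φ n)) (h hy)
  refine tendsto_pi_nhds.2 fun i => (tendsto_pi_nhds.1 hlim i).congr' ?_
  filter_upwards [eventually_gt_atTop i] with n hn
  exact min_eq_left (hx (φ n) i (hn.trans_le (hφ.id_le n)))

/-- The bounds are chosen one coordinate at a time. Relaxing the bound on one coordinate exhausts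
the preceding set, and continuity from below, valid for increasing sequences of arbitrary sets,
keeps the measure above `c`. -/
lemma exists_lt_measure_boundedPrefix (μ : Measure α) (f : (ℕ → ℕ) → α) {c : ℝ≥0∞}
    (hc : c < μ (Set.range f)) : ∃ k, ∀ n, c < μ (f '' boundedPrefix k n) := by
  have step : ∀ n k, c < μ (f '' boundedPrefix k n) →
      ∃ m, c < μ (f '' boundedPrefix (Function.update k n m) (n + 1)) := by
    intro n k h
    have hsub : boundedPrefix k n ⊆ ⋃ m, boundedPrefix (Function.update k n m) (n + 1) := by
      refine fun x hx => Set.mem_iUnion.2 ⟨x n, fun i hi => ?_⟩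
      rcases (Nat.lt_succ_iff_lt_or_eq.1 hi) with hi | rfl
      · rw [Function.update_of_ne hi.ne]; exact hx i hi
      · rw [Function.update_self]
    have hmono : Monotone fun m => f '' boundedPrefix (Function.update k n m) (n + 1) :=
      fun m m' hm => Set.image_mono fun x hx i hi => (hx i hi).trans <| by
        rcases eq_or_ne i n with rfl | hin
        · simpa using hm
        · simp [hin]
    have h1 : c < μ (⋃ m, f '' boundedPrefix (Function.update k n m) (n + 1)) := by
      rw [← Set.image_iUnion]
      exact h.trans_le (measure_mono (Set.image_mono hsub))
    rw [hmono.measure_iUnion] at h1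
    exact lt_iSup_iff.1 h1
  have h0 : c < μ (f '' boundedPrefix 0 0) := by
    have : boundedPrefix 0 0 = Set.univ := Set.eq_univ_of_forall fun x i hi => absurd hi (by omega)
    rwa [this, Set.image_univ]
  let S : ∀ n, {k : ℕ → ℕ // c < μ (f '' boundedPrefix k n)} := fun n => Nat.rec ⟨0, h0⟩
    (fun n k => ⟨Function.update k.1 n (step n k.1 k.2).choose, (step n k.1 k.2).choose_spec⟩) n
  have hS : ∀ n, (S (n + 1)).1 = Function.update (S n).1 n (step n (S n).1 (S n).2).choose :=
    fun n => rfl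
  have hS' : ∀ n i, i < n → (S n).1 i = (S (i + 1)).1 i := by
    intro n i hi
    induction n with
    | zero => omega
    | succ n ih =>
      rcases (Nat.lt_succ_iff_lt_or_eq.1 hi) with hi | rfl
      · rw [← ih hi, hS, Function.update_of_ne hi.ne]
      · rfl
  refine ⟨fun i => (S (i + 1)).1 i, fun n => ?_⟩
  have h1 := (S n).2
  have h2 : boundedPrefix (S n).1 n = boundedPrefix (fun i => (S (i + 1)).1 i) n := by
    ext x
    exact forall₂_congr fun i hi => by rw [hS' n i hi]
  rwa [h2] at h1

variable [BorelSpace α] [T2Space α]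

/-- Take the image of the compact set of sequences bounded by `k`. Each open set containing it
already contains the image of a bounded prefix set, of measure above `c`; outer regularity
concludes. -/
lemma exists_compact_le_measure (μ : Measure α) [μ.OuterRegular] {f : (ℕ → ℕ) → α}
    (hf : Continuous f) {c : ℝ≥0∞} (hc : c < μ (Set.range f)) :
    ∃ K ⊆ Set.range f, MeasurableSet K ∧ c ≤ μ K := by
  obtain ⟨k, hk⟩ := exists_lt_measure_boundedPrefix μ f hc
  refine ⟨f '' {x | ∀ i, x i ≤ k i}, Set.image_subset_range _ _,
    ((isCompact_forall_le k).image hf).isClosed.measurableSet, ?_⟩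
  rw [Set.measure_eq_iInf_isOpen]
  refine le_iInf₂ fun U hU => le_iInf fun hUo => ?_
  obtain ⟨n, hn⟩ := exists_boundedPrefix_subset (hUo.preimage hf) (Set.image_subset_iff.1 hU)
  exact (hk n).le.trans (measure_mono (Set.image_subset_iff.2 hn))

theorem nullMeasurableSet_of_analyticSet (μ : Measure α) [IsFiniteMeasure μ] [μ.OuterRegular]
    {s : Set α} (hs : AnalyticSet s) : NullMeasurableSet s μ := by
  rw [AnalyticSet] at hs
  rcases hs with rfl | ⟨f, hf, rfl⟩
  · exact nullMeasurableSet_empty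
  rcases eq_or_ne (μ (Set.range f)) 0 with h0 | h0
  · exact NullMeasurableSet.of_null h0
  obtain ⟨u, -, hu, hlim⟩ := exists_seq_strictMono_tendsto' (pos_iff_ne_zero.2 h0)
  choose K hKs hKm hK using fun n => exists_compact_le_measure μ hf (hu n).2
  have h1 : μ (Set.range f) ≤ μ (⋃ n, K n) :=
    le_of_tendsto' hlim fun n => (hK n).trans (measure_mono (Set.subset_iUnion K n))
  have h2 : (⋃ n, K n : Set α) =ᵐ[μ] toMeasurable μ (Set.range f) :=
    ae_eq_of_subset_of_measure_ge ((Set.iUnion_subset hKs).trans (subset_toMeasurable _ _))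
      (by rwa [measure_toMeasurable]) (MeasurableSet.iUnion hKm).nullMeasurableSet
      (measure_ne_top _ _)
  have h3 : (⋃ n, K n : Set α) =ᵐ[μ] Set.range f := by
    refine (LE.le.eventuallyLE (Set.iUnion_subset hKs)).antisymm ?_
    exact (LE.le.eventuallyLE (subset_toMeasurable μ _)).trans h2.symm.le
  exact (MeasurableSet.iUnion hKm).nullMeasurableSet.congr h3

/-- Projections of measurable sets are universally measurable. -/
theorem nullMeasurableSet_exists {X Y : Type*} [MeasurableSpace X] [StandardBorelSpace X]
    [MeasurableSpace Y] [StandardBorelSpace Y] (μ : Measure X) [IsFiniteMeasure μ]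
    {S : Set (X × Y)} (hS : MeasurableSet S) : NullMeasurableSet {x | ∃ y, (x, y) ∈ S} μ := by
  let := upgradeStandardBorel X
  have h1 : AnalyticSet (Prod.fst '' S) := hS.analyticSet_image measurable_fst
  have h2 : {x | ∃ y, (x, y) ∈ S} = Prod.fst '' S := by
    ext x
    simp
  rw [h2]
  exact nullMeasurableSet_of_analyticSet μ h1

end Analytic

end H22

namespace H22

/-! ### The zero-one law for positivity along all branches -/

/-- The space of potentials on all balls `Λ_n`. -/
abbrev Tree : Type := (n : ℕ) → Fin (2 ^ n) → ℝ

/-- Levels up to `N` are almost surely a fixed function of level `N`, whose law is prescribed. So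
the finite-dimensional laws, and with them the joint law, are determined. -/
lemma IsMergingFamily.map_tree_eq {Ω Ω' : Type*} [MeasurableSpace Ω] [MeasurableSpace Ω']
    {P : Measure Ω} [IsProbabilityMeasure P] {Q : Measure Ω'} [IsProbabilityMeasure Q] {w : ℝ}
    {T : (n : ℕ) → Ω → Fin (2 ^ n) → ℝ} {T' : (n : ℕ) → Ω' → Fin (2 ^ n) → ℝ}
    (h : IsMergingFamily P w T) (h' : IsMergingFamily Q w T') :
    P.map (fun ω n => T n ω) = Q.map (fun ω n => T' n ω) := by
  have hq : ∀ N, ∃ q : (Fin (2 ^ N) → ℝ) → Tree, Measurable q ∧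
      ∀ t : Tree, (∀ n, merge w n (t (n + 1)) = t n) → ∀ n ≤ N, q (t N) n = t n := by
    intro N
    induction N with
    | zero =>
      refine ⟨fun y => Function.update (fun _ _ => (0 : ℝ)) 0 y, measurable_update _, fun t _ n hn => ?_⟩
      obtain rfl : n = 0 := by omega
      simp
    | succ N ih =>
      obtain ⟨q, hqm, hq⟩ := ih
      refine ⟨fun y => Function.update (q (merge w N y)) (N + 1) y, ?_, fun t ht n hn => ?_⟩
      · exact measurable_update'.comp
          ((hqm.comp (measurable_merge w N)).prodMk measurable_id)
      · rcases Nat.lt_succ_iff_lt_or_eq.1 (Nat.lt_succ_iff.2 hn) with h1 | rfl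
        · beta_reduce
          rw [Function.update_of_ne h1.ne, ht]
          exact hq t ht n (Nat.lt_succ_iff.1 h1)
        · exact Function.update_self _ _ _
  have hm : Measurable fun ω n => T n ω := measurable_pi_lambda _ h.measurable
  have hm' : Measurable fun ω n => T' n ω := measurable_pi_lambda _ h'.measurable
  have hfin : ∀ I : Finset ℕ,
      (P.map fun ω n => T n ω).map I.restrict = (Q.map fun ω n => T' n ω).map I.restrict := by
    intro I
    obtain ⟨q, hqm, hq⟩ := hq (I.sup id)
    have hI : Measurable fun y => I.restrict (q y) := (Finset.measurable_restrict I).comp hqm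
    have e1 : (fun ω => I.restrict fun n => T n ω)
        =ᵐ[P] fun ω => I.restrict (q (T (I.sup id) ω)) := by
      filter_upwards [ae_all_iff.2 h.merge_eq] with ω hω
      exact funext fun i =>
        (hq (fun n => T n ω) hω i (Finset.le_sup (f := id) i.2)).symm
    have e2 : (fun ω => I.restrict fun n => T' n ω)
        =ᵐ[Q] fun ω => I.restrict (q (T' (I.sup id) ω)) := by
      filter_upwards [ae_all_iff.2 h'.merge_eq] with ω hω
      exact funext fun i =>
        (hq (fun n => T' n ω) hω i (Finset.le_sup (f := id) i.2)).symm
    rw [Measure.map_map (Finset.measurable_restrict I) hm,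
      Measure.map_map (Finset.measurable_restrict I) hm']
    refine (Measure.map_congr e1).trans (Eq.trans ?_ (Measure.map_congr e2).symm)
    have f1 := Measure.map_map (μ := P) hI (h.measurable (I.sup id))
    have f2 := Measure.map_map (μ := Q) hI (h'.measurable (I.sup id))
    rw [h.law] at f1
    rw [h'.law] at f2
    exact f1.symm.trans f2
  have : IsProbabilityMeasure (P.map fun ω n => T n ω) :=
    Measure.isProbabilityMeasure_map hm.aemeasurable
  have h1 : IsProjectiveLimit (P.map fun ω n => T n ω)
    (fun I => (P.map fun ω n => T n ω).map I.restrict) := fun I => rfl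
  have h2 : IsProjectiveLimit (Q.map fun ω n => T' n ω)
    (fun I => (P.map fun ω n => T n ω).map I.restrict) := fun I => (hfin I).symm
  exact h1.unique h2

/-- The embedding of `Λ_n` onto the block with number `k` in `Λ_{m + n}`. -/
def blockEmb {m : ℕ} (k : Fin (2 ^ m)) (n : ℕ) (i : Fin (2 ^ n)) : Fin (2 ^ (m + n)) :=
  ⟨k * 2 ^ n + i, by
    have h1 := k.isLt
    have h2 := i.isLt
    calc (k : ℕ) * 2 ^ n + i < (k + 1) * 2 ^ n := by rw [add_mul, one_mul]; omega
      _ ≤ 2 ^ m * 2 ^ n := Nat.mul_le_mul_right _ h1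
      _ = 2 ^ (m + n) := (pow_add 2 m n).symm⟩

/-- The potentials on the descendants of the vertex `k` of `Λ_m`. -/
def subtree {m : ℕ} (k : Fin (2 ^ m)) (t : Tree) : Tree := fun n => t (m + n) ∘ blockEmb k n

lemma measurable_subtree {m : ℕ} (k : Fin (2 ^ m)) : Measurable (subtree k) :=
  measurable_pi_lambda _ fun n => (measurable_comp_right _).comp (measurable_pi_apply (m + n))

lemma leftChild_blockEmb {m : ℕ} (k : Fin (2 ^ m)) {n : ℕ} (i : Fin (2 ^ n)) :
    leftChild (blockEmb k n i) = blockEmb k (n + 1) (leftChild i) :=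
  Fin.ext (by simp only [leftChild, blockEmb, pow_succ]; ring)

lemma rightChild_blockEmb {m : ℕ} (k : Fin (2 ^ m)) {n : ℕ} (i : Fin (2 ^ n)) :
    rightChild (blockEmb k n i) = blockEmb k (n + 1) (rightChild i) :=
  Fin.ext (by simp only [rightChild, blockEmb, pow_succ]; ring)

/-- The potentials in `t` are consistent and the associated matrices are positive definite. -/
structure IsRegularTree (w : ℝ) (t : Tree) : Prop where
  posDef : ∀ n, (schrodinger (fun i j : Fin (2 ^ n) => latticeWeight w i j) (t n)).PosDef
  merge_eq : ∀ n, merge w n (t (n + 1)) = t n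

lemma IsRegularTree.children {w : ℝ} (hw : 0 < w) {t : Tree} (h : IsRegularTree w t) (n : ℕ)
    (k : Fin (2 ^ n)) :
    ballField w (n + 1) (t (n + 1)) (leftChild k)
      = childRatio (w / 4) (t (n + 1) (leftChild k)) (t (n + 1) (rightChild k))
        * ballField w n (t n) k ∧
    ballField w (n + 1) (t (n + 1)) (rightChild k)
      = childRatio (w / 4) (t (n + 1) (rightChild k)) (t (n + 1) (leftChild k))
        * ballField w n (t n) k := by
  have h1 := h.posDef n
  rw [← h.merge_eq] at h1
  have h2 := ballField_children hw h1 (h.posDef (n + 1)) k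
  rwa [h.merge_eq] at h2

lemma IsRegularTree.ballField_pos {w : ℝ} (hw : 0 < w) {t : Tree} (h : IsRegularTree w t) (n : ℕ)
    (k : Fin (2 ^ n)) : 0 < ballField w n (t n) k := by
  induction n with
  | zero =>
    rw [Subsingleton.elim (α := Fin 1) k 0]
    exact ballField_zero_pos hw (h.posDef 0)
  | succ n ih =>
    have hs : 0 < w / 4 := by positivity
    have hp := pos_of_posDef (h.posDef (n + 1))
    revert k
    refine forall_children (fun k => ?_) fun k => ?_
    · rw [(h.children hw n k).1]
      exact mul_pos (childRatio_pos hs (hp _) (hp _)) (ih k)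
    · rw [(h.children hw n k).2]
      exact mul_pos (childRatio_pos hs (hp _) (hp _)) (ih k)

/-- The field on a subtree is proportional to the field on the whole tree. -/
lemma IsRegularTree.ballField_subtree {w : ℝ} (hw : 0 < w) {t : Tree} (h : IsRegularTree w t)
    {m : ℕ} (k : Fin (2 ^ m)) (hk : IsRegularTree w (subtree k t)) (n : ℕ) (i : Fin (2 ^ n)) :
    ballField w (m + n) (t (m + n)) (blockEmb k n i)
      = ballField w m (t m) k / ballField w 0 (subtree k t 0) 0
        * ballField w n (subtree k t n) i := by
  -- The ratios along the subtree involve only its own potentials, so both fields satisfy the same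
  -- recursion and their quotient at the root persists.
  induction n with
  | zero =>
    have hi : i = 0 := Subsingleton.elim (α := Fin 1) i 0
    have h0 := (hk.ballField_pos hw 0 0).ne'
    subst hi
    rw [div_mul_cancel₀ _ h0]
    congr 1
    exact Fin.ext (by simp [blockEmb])
  | succ n ih =>
    revert i
    refine forall_children (fun j => ?_) fun j => ?_
    · have h1 := (h.children hw (m + n) (blockEmb k n j)).1
      rw [leftChild_blockEmb, rightChild_blockEmb, ih] at h1
      rw [(hk.children hw n j).1]
      exact h1.trans (mul_left_comm _ _ _)
    · have h1 := (h.children hw (m + n) (blockEmb k n j)).2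
      rw [leftChild_blockEmb, rightChild_blockEmb, ih] at h1
      rw [(hk.children hw n j).2]
      exact h1.trans (mul_left_comm _ _ _)

/-- The field is positive in the limit along all branches that belong to real numbers. -/
def positiveTrees (w : ℝ) : Set Tree :=
  {t | ∀ x ∈ Set.Ico (0 : ℝ) 1, 0 < branchLimit w t fun n => ⌊2 ^ n * x⌋₊}

/-- The point `x` of the subtree is the point `(k + x) / 2 ^ m` of the whole tree, and there the two
limits differ by a finite factor. -/
lemma IsRegularTree.subtree_mem {w : ℝ} (hw : 0 < w) {t : Tree} (h : IsRegularTree w t)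
    {m : ℕ} (k : Fin (2 ^ m)) (hk : IsRegularTree w (subtree k t)) (ht : t ∈ positiveTrees w) :
    subtree k t ∈ positiveTrees w := by
  intro x hx
  have hk1 : (k : ℝ) + 1 ≤ 2 ^ m := by exact_mod_cast k.isLt
  have hx' : (k + x) / 2 ^ m ∈ Set.Ico (0 : ℝ) 1 := by
    refine ⟨div_nonneg (add_nonneg (Nat.cast_nonneg _) hx.1) (by positivity), ?_⟩
    rw [div_lt_one (by positivity)]
    linarith [hx.2]
  have h1 := ht _ hx'
  have hb := isBranch_floor hx
  set c := ballField w m (t m) k / ballField w 0 (subtree k t 0) 0 with hc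
  have h2 : branchLimit w t (fun n => ⌊2 ^ n * ((k + x) / 2 ^ m)⌋₊)
      = ENNReal.ofReal c * branchLimit w (subtree k t) fun n => ⌊2 ^ n * x⌋₊ := by
    rw [branchLimit, branchLimit, ← ENNReal.limsup_const_mul_of_ne_top ENNReal.ofReal_ne_top,
      ← limsup_nat_add _ m]
    refine limsup_congr (Eventually.of_forall fun n => ?_)
    have hfl : ⌊(2 : ℝ) ^ (m + n) * ((k + x) / 2 ^ m)⌋₊ = k * 2 ^ n + ⌊2 ^ n * x⌋₊ := by
      rw [show (2 : ℝ) ^ (m + n) * ((k + x) / 2 ^ m) = 2 ^ n * x + ((k * 2 ^ n : ℕ) : ℝ) by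
        rw [pow_add]; push_cast; field_simp; ring,
        Nat.floor_add_natCast (mul_nonneg (by positivity) hx.1), add_comm]
    have hlt := (blockEmb k n ⟨_, hb.lt n⟩).isLt
    rw [add_comm n m, hfl, ← ENNReal.ofReal_mul (div_nonneg (h.ballField_pos hw _ _).le
      (hk.ballField_pos hw _ _).le), extendedField, extendedField, dif_pos (hb.lt n),
      ← h.ballField_subtree hw k hk]
    exact congrArg _ (dif_pos hlt)
  rw [h2] at h1
  exact pos_iff_ne_zero.2 fun h0 => by simp [h0] at h1

lemma measurableSet_branchLimit_eq_zero (w : ℝ) : MeasurableSet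
    {p : Tree × ℝ | p.2 ∈ Set.Ico (0 : ℝ) 1 ∧ branchLimit w p.1 (fun n => ⌊2 ^ n * p.2⌋₊) = 0} := by
  refine (measurable_snd measurableSet_Ico).inter
    ((Measurable.limsup fun n => ?_) (measurableSet_singleton 0))
  have h1 : Measurable fun p : Tree × ℕ => extendedField w n (p.1 n) p.2 :=
    measurable_from_prod_countable_left fun j => (measurable_pi_apply j).comp
      ((measurable_extendedField w n).comp (measurable_pi_apply n))
  exact (h1.comp (measurable_fst.prodMk
    (Nat.measurable_floor.comp (measurable_snd.const_mul _)))).ennreal_ofReal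

/-- The uncountable quantifier over `x` makes the complement a projection of a measurable set. -/
lemma nullMeasurableSet_positiveTrees (w : ℝ) (μ : Measure Tree) [IsFiniteMeasure μ] :
    NullMeasurableSet (positiveTrees w) μ := by
  have h1 := (nullMeasurableSet_exists μ (measurableSet_branchLimit_eq_zero w)).compl
  convert h1 using 1
  ext t
  simp only [positiveTrees, pos_iff_ne_zero, Set.mem_compl_iff]
  change _ ↔ ¬ ∃ x, _ ∧ _
  push Not
  rfl

section

variable {μ : Measure Tree} [IsProbabilityMeasure μ] {w : ℝ}

lemma IsMergingFamily.subtree (hw : 0 < w) (h : IsMergingFamily μ w fun n t => t n) {m : ℕ}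
    (k : Fin (2 ^ m)) : IsMergingFamily μ w fun n t => subtree k t n where
  measurable n := (measurable_pi_apply n).comp (measurable_subtree k)
  law n := by
    have h1 := Measure.map_map (μ := μ) (measurable_comp_right (blockEmb k n))
      (h.measurable (m + n))
    rw [h.law, map_comp_ballLaw hw fun i j => latticeWeight_block k n i.isLt j.isLt] at h1
    exact h1.symm
  merge_eq n := by
    filter_upwards [h.merge_eq (m + n)] with t ht
    have h1 := congrArg (fun x => x ∘ blockEmb k n) ht
    refine Eq.trans (funext fun i => ?_) h1
    simp only [merge, Function.comp, H22.subtree, leftChild_blockEmb, rightChild_blockEmb]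
    rfl

lemma IsMergingFamily.ae_isRegularTree (h : IsMergingFamily μ w fun n t => t n) :
    ∀ᵐ t ∂μ, IsRegularTree w t := by
  filter_upwards [h.ae_posDef, ae_all_iff.2 h.merge_eq] with t h1 h2 using ⟨h1, h2⟩

lemma IsMergingFamily.measurePreserving_subtree (hw : 0 < w)
    (h : IsMergingFamily μ w fun n t => t n) {m : ℕ} (k : Fin (2 ^ m)) :
    MeasurePreserving (H22.subtree k) μ μ :=
  ⟨measurable_subtree k, ((h.subtree hw k).map_tree_eq h).trans Measure.map_id⟩

/-- One inclusion is `IsRegularTree.subtree_mem`; it is an equality up to a null set because passing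
to the subtree preserves `μ`. -/
lemma IsMergingFamily.ae_mem_iff_subtree (hw : 0 < w) (h : IsMergingFamily μ w fun n t => t n)
    {m : ℕ} (k : Fin (2 ^ m)) :
    (positiveTrees w : Set Tree) =ᵐ[μ] H22.subtree k ⁻¹' positiveTrees w := by
  have hp := h.measurePreserving_subtree hw k
  have hn := nullMeasurableSet_positiveTrees w μ
  refine ae_eq_of_ae_subset_of_measure_ge ?_ (hp.measure_preimage hn).le hn (measure_ne_top _ _)
  filter_upwards [h.ae_isRegularTree, hp.quasiMeasurePreserving.ae h.ae_isRegularTree]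
    with t h1 h2 h3 using h1.subtree_mem hw k h2 h3

/-- The two roots lie in different halves of `Λ_{m+1}`. Their descendants `N` levels further down
form `Λ_N` and its image under `blockSwap (m + N)`, so the lattice estimate applies. -/
lemma IsMergingFamily.mul_le_liminf (hw : 0 < w) (h : IsMergingFamily μ w fun n t => t n) (N : ℕ)
    {C D : Set (Fin (2 ^ N) → ℝ)} (hC : MeasurableSet C) (hD : MeasurableSet D) :
    ballLaw w N C * ballLaw w N D ≤ liminf (fun m => μ
      {t | H22.subtree (m := m + 1) ⟨0, by positivity⟩ t N ∈ C ∧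
        H22.subtree (m := m + 1) ⟨2 ^ m, Nat.pow_lt_pow_right one_lt_two m.lt_succ_self⟩ t N ∈ D})
      atTop := by
  have h1 := mul_le_liminf_latticeLaw hw N hC hD
  rw [← liminf_nat_add _ N] at h1
  refine h1.trans (le_of_eq (liminf_congr (Eventually.of_forall fun m => ?_)))
  set e := blockEmb (m := m + 1) ⟨0, by positivity⟩ N with he
  set e' := blockEmb (m := m + 1) ⟨2 ^ m, Nat.pow_lt_pow_right one_lt_two m.lt_succ_self⟩ N with he'
  have hS : MeasurableSet {x : Fin (2 ^ (m + 1 + N)) → ℝ | x ∘ e ∈ C ∧ x ∘ e' ∈ D} :=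
    (measurable_comp_right e hC).inter (measurable_comp_right e' hD)
  have f1 := Measure.map_apply (μ := μ) (h.measurable (m + 1 + N)) hS
  have f2 := Measure.map_apply (μ := latticeLaw hw) (measurable_restrictBall (m + 1 + N)) hS
  rw [h.law] at f1
  rw [map_restrictBall_latticeLaw] at f2
  refine Eq.trans ?_ (f2.symm.trans f1)
  congr 1
  ext b
  have g1 : restrictBall (m + 1 + N) b ∘ e = restrictBall N b := by
    funext i
    simp [restrictBall, he, blockEmb]
  have g2 : restrictBall (m + 1 + N) b ∘ e' = restrictBall N (b ∘ blockSwap (m + N)) := by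
    funext i
    have hi : (i : ℕ) < 2 ^ (m + N) :=
      i.isLt.trans_le (Nat.pow_le_pow_right two_pos (Nat.le_add_left N m))
    simp [restrictBall, he', blockEmb, blockSwap_of_lt hi, pow_add]
  change _ ↔ _ ∧ _
  rw [g1, g2]
  rfl

/-- The event is almost surely the same when read off from either of the two subtrees, and these are
asymptotically independent. -/
theorem IsMergingFamily.positiveTrees_zero_or_one (hw : 0 < w)
    (h : IsMergingFamily μ w fun n t => t n) :
    μ (positiveTrees w) = 0 ∨ μ (positiveTrees w) = 1 := by
  obtain ⟨A, -, hA, hAE⟩ :=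
    (nullMeasurableSet_positiveTrees w μ).exists_measurable_superset_ae_eq
  rw [← measure_congr hAE]
  have hpre : ∀ {m : ℕ} (k : Fin (2 ^ m)), (positiveTrees w : Set Tree) =ᵐ[μ] H22.subtree k ⁻¹' A :=
    fun k => (h.ae_mem_iff_subtree hw k).trans
      ((h.measurePreserving_subtree hw k).quasiMeasurePreserving.preimage_ae_eq hAE).symm
  refine zero_or_one_of_mixing μ (f := fun n (t : Tree) => t n) (fun n => measurable_pi_apply n)
    (monotone_nat_of_le_succ fun n => aeComap_comp_le μ (measurable_merge w n) ?_) ?_ μ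
    (fun m => h.measurePreserving_subtree hw (m := m + 1) ⟨0, by positivity⟩)
    (fun m => h.measurePreserving_subtree hw (m := m + 1)
      ⟨2 ^ m, Nat.pow_lt_pow_right one_lt_two m.lt_succ_self⟩) (fun N C hC => ?_) hA fun m => ?_
  · filter_upwards [h.merge_eq n] with t ht using ht.symm
  · refine iSup_le fun n => le_iSup_of_le n ?_
    rintro _ ⟨B, hB, rfl⟩
    exact measurable_aeComap μ (measurable_pi_apply n) hB
  · have h1 := h.mul_le_liminf hw N hC hC.compl
    rwa [← h.law, Measure.map_apply (h.measurable N) hC,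
      Measure.map_apply (h.measurable N) hC.compl] at h1
  · have h1 := (hpre (m := m + 1) ⟨0, by positivity⟩).symm.trans (hpre (m := m + 1)
      ⟨2 ^ m, Nat.pow_lt_pow_right one_lt_two m.lt_succ_self⟩)
    rw [← compl_mem_ae_iff]
    filter_upwards [h1] with t ht ⟨ht1, ht2⟩
    exact ht2 (ht.mp ht1)

end

lemma IsMergingFamily.map_tree {Ω : Type*} [MeasurableSpace Ω] {P : Measure Ω}
    [IsProbabilityMeasure P] {w : ℝ} {T : (n : ℕ) → Ω → Fin (2 ^ n) → ℝ}
    (h : IsMergingFamily P w T) :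
    IsMergingFamily (P.map fun ω n => T n ω) w fun n t => t n := by
  have hm : Measurable fun ω n => T n ω := measurable_pi_lambda _ h.measurable
  refine ⟨fun n => measurable_pi_apply n, fun n => ?_, fun n => ?_⟩
  · rw [Measure.map_map (measurable_pi_apply n) hm]
    exact h.law n
  · refine (ae_map_iff hm.aemeasurable (measurableSet_eq_fun ((measurable_merge w n).comp
      (measurable_pi_apply (n + 1))) (measurable_pi_apply n))).2 (h.merge_eq n)

/-- The event that the field is positive in the limit along all branches is trivial. -/
theorem IsMergingFamily.zero_or_one_of_pos {Ω : Type*} [MeasurableSpace Ω] {P : Measure Ω}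
    [IsProbabilityMeasure P] {w : ℝ} (hw : 0 < w) {T : (n : ℕ) → Ω → Fin (2 ^ n) → ℝ}
    (h : IsMergingFamily P w T) :
    NullMeasurableSet {ω | (fun n => T n ω) ∈ positiveTrees w} P ∧
      (P {ω | (fun n => T n ω) ∈ positiveTrees w} = 0 ∨
        P {ω | (fun n => T n ω) ∈ positiveTrees w} = 1) := by
  have hm : Measurable fun ω n => T n ω := measurable_pi_lambda _ h.measurable
  have : IsProbabilityMeasure (P.map fun ω n => T n ω) :=
    Measure.isProbabilityMeasure_map hm.aemeasurable
  have hn := nullMeasurableSet_positiveTrees w (P.map fun ω n => T n ω)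
  have hp := hm.measurePreserving P
  refine ⟨hn.preimage hp.quasiMeasurePreserving, ?_⟩
  have h1 := h.map_tree.positiveTrees_zero_or_one hw
  rwa [← hp.measure_preimage hn] at h1

end H22

namespace H22

/-! ### Merging one pair of siblings -/

/-- The density of the potentials at two siblings, relative to the density of the merged
potential. -/
noncomputable def pairDensity (s a b : ℝ) : ℝ≥0∞ :=
  if 0 < 2 * a + s ∧ 0 < 2 * b + s ∧ 0 < mergedPotential s a b then
    ENNReal.ofReal (√(2 / Real.pi) * Real.exp (-(a + b - s - mergedPotential s a b))
      / √((a + b + s) / 2))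
  else 0

/-- The integrand in `lintegral_pair` in the variables `2 a + s` and `2 b + s`. -/
noncomputable def pairIntegrand (s : ℝ) (F : ℝ → ℝ≥0∞) (h p : ℝ) : ℝ≥0∞ :=
  if s < h then F (2 * h - 2 * s) * ENNReal.ofReal
    (2 * √(2 / Real.pi) * Real.exp h * ((1 / √(p - h) + h / ((p - h) * √(p - h)))
      * Real.exp (-((p - h) + h ^ 2 / (p - h)) / 2)))
  else 0

/-- In the variable `p - h` the integrand is a multiple of the one in `lintegral_inv_sqrt_add` with
`a = h`; the exponentials cancel, so each fibre has the same mass. -/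
lemma lintegral_pairIntegrand {s : ℝ} (hs : 0 < s) (F : ℝ → ℝ≥0∞) (h : ℝ) :
    ∫⁻ p in Set.Ioi h, pairIntegrand s F h p = if s < h then 8 * F (2 * h - 2 * s) else 0 := by
  by_cases hsh : s < h
  · have h0 : 0 < h := hs.trans hsh
    simp only [pairIntegrand, if_pos hsh]
    have h1 := (measurePreserving_sub_right volume h).setLIntegral_comp_preimage_emb
      (MeasurableEquiv.subRight h).measurableEmbedding
      (fun z => F (2 * h - 2 * s) * ENNReal.ofReal (2 * √(2 / Real.pi) * Real.exp h
        * ((1 / √z + h / (z * √z)) * Real.exp (-(z + h ^ 2 / z) / 2)))) (Set.Ioi 0)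
    have h2 : (fun x => x - h) ⁻¹' Set.Ioi 0 = Set.Ioi h := by ext x; simp
    rw [h2] at h1
    rw [h1]
    have h3 : ∀ z, F (2 * h - 2 * s) * ENNReal.ofReal (2 * √(2 / Real.pi) * Real.exp h
        * ((1 / √z + h / (z * √z)) * Real.exp (-(z + h ^ 2 / z) / 2)))
        = F (2 * h - 2 * s) * ENNReal.ofReal (2 * √(2 / Real.pi) * Real.exp h)
          * ENNReal.ofReal ((1 / √z + h / (z * √z)) * Real.exp (-(z + h ^ 2 / z) / 2)) := fun z => by
      rw [mul_assoc (F _), ← ENNReal.ofReal_mul (by positivity)]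
    simp only [h3]
    rw [lintegral_const_mul _ (by fun_prop), lintegral_inv_sqrt_add h0, mul_assoc,
      ← ENNReal.ofReal_mul (by positivity), mul_comm]
    congr 1
    rw [show 2 * √(2 / Real.pi) * Real.exp h * (2 * √(2 * Real.pi) * Real.exp (-h))
      = 4 * (√(2 / Real.pi) * √(2 * Real.pi)) * (Real.exp h * Real.exp (-h)) by ring,
      ← Real.sqrt_mul (by positivity), ← Real.exp_add, add_neg_cancel, Real.exp_zero,
      show 2 / Real.pi * (2 * Real.pi) = 2 ^ 2 by field_simp, Real.sqrt_sq (by norm_num)]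
    norm_num
  · simp [pairIntegrand, hsh]

/-- In these variables merging is, up to a shift, the harmonic mean. This motivates the sign
conditions in `pairDensity`. -/
lemma mergedPotential_eq_harmonic {s a b p q : ℝ} (hp : p = 2 * a + s) (hq : q = 2 * b + s)
    (h : 0 < p + q) : mergedPotential s a b = 2 * (p * q / (p + q)) - 2 * s := by
  rw [mergedPotential_eq, show a + b + s = (p + q) / 2 by rw [hp, hq]; ring]
  field_simp
  rw [hp, hq]
  ring

lemma measurable_pairIntegrand (s : ℝ) {F : ℝ → ℝ≥0∞} (hF : Measurable F) :
    Measurable fun x : ℝ × ℝ => pairIntegrand s F x.1 x.2 := by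
  unfold pairIntegrand
  refine Measurable.ite (measurableSet_lt measurable_const measurable_fst) ?_ measurable_const
  fun_prop

/-- Change of variables `q = p h / (p - h)`. -/
lemma lintegral_harmonic {p : ℝ} (hp : 0 < p) (g : ℝ → ℝ≥0∞) :
    ∫⁻ q in Set.Ioi 0, g q
      = ∫⁻ h in Set.Ioo 0 p, ENNReal.ofReal (p ^ 2 / (p - h) ^ 2) * g (p * h / (p - h)) := by
  have key := lintegral_image_eq_lintegral_abs_deriv_mul (s := Set.Ioo 0 p)
    (f := fun h => p * h / (p - h)) (f' := fun h => p ^ 2 / (p - h) ^ 2) measurableSet_Ioo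
    (fun h hh => by
      have h1 : p - h ≠ 0 := (sub_pos.2 hh.2).ne'
      have h2 := (((hasDerivAt_id h).const_mul p).div ((hasDerivAt_id h).const_sub p) h1)
      refine (h2.congr_deriv ?_).hasDerivWithinAt
      simp only [id]
      congr 1
      ring)
    (fun x hx y hy hxy => by
      have h1 : p - x ≠ 0 := (sub_pos.2 hx.2).ne'
      have h2 : p - y ≠ 0 := (sub_pos.2 hy.2).ne'
      simp only at hxy
      rw [div_eq_div_iff h1 h2] at hxy
      have h3 : p ^ 2 * (x - y) = 0 := by linear_combination hxy
      rcases mul_eq_zero.1 h3 with h | h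
      · exact absurd h (by positivity)
      · linarith) g
  have him : (fun h => p * h / (p - h)) '' Set.Ioo 0 p = Set.Ioi 0 := by
    ext q
    simp only [Set.mem_image, Set.mem_Ioo, Set.mem_Ioi]
    constructor
    · rintro ⟨h, ⟨h1, h2⟩, rfl⟩
      exact div_pos (mul_pos hp h1) (sub_pos.2 h2)
    · intro hq
      have h1 : 0 < p + q := by linarith
      refine ⟨p * q / (p + q), ⟨by positivity, ?_⟩, ?_⟩
      · rw [div_lt_iff₀ h1]; nlinarith
      · have e : p - p * q / (p + q) = p ^ 2 / (p + q) := by field_simp; ring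
        rw [e]
        field_simp
  rw [him] at key
  rw [key]
  refine setLIntegral_congr_fun measurableSet_Ioo fun h hh => ?_
  rw [abs_of_nonneg (by positivity)]

lemma pairDensity_eq {s a b p q : ℝ} (hp : p = 2 * a + s) (hq : q = 2 * b + s) :
    pairDensity s a b = if 0 < p ∧ 0 < q ∧ s < p * q / (p + q) then
      ENNReal.ofReal (2 * √(2 / Real.pi) * Real.exp (2 * (p * q / (p + q)) - (p + q) / 2)
        / √(p + q)) else 0 := by
  rw [pairDensity, ← hp, ← hq]
  by_cases h : 0 < p ∧ 0 < q
  · have hpq : 0 < p + q := add_pos h.1 h.2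
    have h1 := mergedPotential_eq_harmonic hp hq hpq
    have h2 : (0 < p ∧ 0 < q ∧ 0 < mergedPotential s a b)
        ↔ (0 < p ∧ 0 < q ∧ s < p * q / (p + q)) := by
      rw [h1]
      refine and_congr_right fun _ => and_congr_right fun _ => ⟨fun h => by linarith,
        fun h => by linarith⟩
    simp only [h2]
    refine if_congr Iff.rfl ?_ rfl
    congr 1
    have h3 : (a + b + s) / 2 = (p + q) / 2 ^ 2 := by rw [hp, hq]; ring
    have h4 : -(a + b - s - mergedPotential s a b) = 2 * (p * q / (p + q)) - (p + q) / 2 := by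
      rw [h1, hp, hq]; ring
    rw [h3, h4, Real.sqrt_div hpq.le, Real.sqrt_sq two_pos.le]
    field_simp
  · rw [if_neg fun h' => h ⟨h'.1, h'.2.1⟩, if_neg fun h' => h ⟨h'.1, h'.2.1⟩]

lemma measurable_mergedPotential (s : ℝ) :
    Measurable fun x : ℝ × ℝ => mergedPotential s x.1 x.2 := by
  unfold mergedPotential
  fun_prop

lemma measurable_pairDensity (s : ℝ) : Measurable fun x : ℝ × ℝ => pairDensity s x.1 x.2 := by
  have h := measurable_mergedPotential s
  unfold pairDensity
  refine Measurable.ite ?_ (by fun_prop) measurable_const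
  have h1 : Measurable fun x : ℝ × ℝ => 2 * x.1 + s := by fun_prop
  have h2 : Measurable fun x : ℝ × ℝ => 2 * x.2 + s := by fun_prop
  exact (measurableSet_lt measurable_const h1).inter
    ((measurableSet_lt measurable_const h2).inter (measurableSet_lt measurable_const h))

/-- Pass to `p` and `q`, replace `q` by `h = p q / (p + q)`, and integrate over `p` first. The
constants cancel: `1/2` from each of the two affine substitutions, `8` from the fibre, and `1/2`
from `x = 2 h - 2 s`. -/
theorem lintegral_pair {s : ℝ} (hs : 0 < s) {F : ℝ → ℝ≥0∞} (hF : Measurable F) :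
    ∫⁻ a, ∫⁻ b, F (mergedPotential s a b) * pairDensity s a b = ∫⁻ x in Set.Ioi 0, F x := by
  let Ψ : ℝ → ℝ → ℝ≥0∞ := fun p q => if s < p * q / (p + q) then
    F (2 * (p * q / (p + q)) - 2 * s) * ENNReal.ofReal
      (2 * √(2 / Real.pi) * Real.exp (2 * (p * q / (p + q)) - (p + q) / 2) / √(p + q)) else 0
  have hpt : ∀ a b, F (mergedPotential s a b) * pairDensity s a b
      = (Set.Ioi (-s / 2)).indicator (fun a => (Set.Ioi (-s / 2)).indicator
        (fun b => Ψ (2 * a - -s) (2 * b - -s)) b) a := by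
    intro a b
    rw [pairDensity_eq rfl rfl]
    simp only [sub_neg_eq_add, Ψ]
    by_cases ha : a ∈ Set.Ioi (-s / 2)
    · have ha' : 0 < 2 * a + s := by have := Set.mem_Ioi.1 ha; linarith
      by_cases hb : b ∈ Set.Ioi (-s / 2)
      · have hb' : 0 < 2 * b + s := by have := Set.mem_Ioi.1 hb; linarith
        rw [Set.indicator_of_mem ha, Set.indicator_of_mem hb,
          mergedPotential_eq_harmonic rfl rfl (add_pos ha' hb')]
        simp only [ha', hb', true_and]
        split_ifs <;> simp
      · have hb' : ¬ 0 < 2 * b + s := fun h => hb (Set.mem_Ioi.2 (by linarith))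
        rw [Set.indicator_of_mem ha, Set.indicator_of_notMem hb, if_neg fun h => hb' h.2.1, mul_zero]
    · have ha' : ¬ 0 < 2 * a + s := fun h => ha (Set.mem_Ioi.2 (by linarith))
      rw [Set.indicator_of_notMem ha, if_neg fun h => ha' h.1, mul_zero]
  have hstep : ∀ p ∈ Set.Ioi (0 : ℝ), ∫⁻ q in Set.Ioi 0, Ψ p q
      = ∫⁻ h, (Set.Ioi 0).indicator (fun h => (Set.Ioi h).indicator (pairIntegrand s F h) p) h := by
    intro p hp
    have hp := Set.mem_Ioi.1 hp
    rw [lintegral_harmonic hp, ← lintegral_indicator measurableSet_Ioo]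
    refine lintegral_congr fun h => ?_
    by_cases hh : h ∈ Set.Ioo 0 p
    · have h0 := hh.1
      have hph : 0 < p - h := sub_pos.2 hh.2
      rw [Set.indicator_of_mem hh, Set.indicator_of_mem (Set.mem_Ioi.2 h0),
        Set.indicator_of_mem (Set.mem_Ioi.2 hh.2)]
      have e1 : p + p * h / (p - h) = p ^ 2 / (p - h) := by field_simp; ring
      have e2 : p * (p * h / (p - h)) / (p + p * h / (p - h)) = h := by
        rw [e1]; field_simp
      simp only [Ψ, pairIntegrand]
      rw [e2, e1]
      split_ifs with hsh
      · rw [mul_left_comm, ← ENNReal.ofReal_mul (by positivity)]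
        congr 2
        have e3 : 2 * h - p ^ 2 / (p - h) / 2 = h + -((p - h) + h ^ 2 / (p - h)) / 2 := by
          field_simp; ring
        rw [e3, Real.exp_add, Real.sqrt_div (sq_nonneg p), Real.sqrt_sq hp.le]
        generalize √(2 / Real.pi) = c
        obtain ⟨r, hr, hr2⟩ : ∃ r, 0 < r ∧ p - h = r ^ 2 :=
          ⟨√(p - h), Real.sqrt_pos.2 hph, (Real.sq_sqrt hph.le).symm⟩
        obtain rfl : p = r ^ 2 + h := by linarith
        rw [show r ^ 2 + h - h = r ^ 2 by ring, Real.sqrt_sq hr.le]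
        field_simp
      · simp
    · rw [Set.indicator_of_notMem hh]
      by_cases h0 : h ∈ Set.Ioi (0 : ℝ)
      · rw [Set.indicator_of_mem h0, Set.indicator_of_notMem
          (show p ∉ Set.Ioi h from fun h' => hh ⟨h0, h'⟩)]
      · rw [Set.indicator_of_notMem h0]
  have hmeas : Measurable fun x : ℝ × ℝ => (Set.Ioi (0 : ℝ)).indicator
      (fun h => (Set.Ioi h).indicator (pairIntegrand s F h) x.1) x.2 := by
    have h1 : (fun x : ℝ × ℝ => (Set.Ioi (0 : ℝ)).indicator
        (fun h => (Set.Ioi h).indicator (pairIntegrand s F h) x.1) x.2)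
        = {x : ℝ × ℝ | 0 < x.2 ∧ x.2 < x.1}.indicator fun x => pairIntegrand s F x.2 x.1 := by
      funext x
      simp only [Set.indicator_apply, Set.mem_Ioi]
      by_cases h1 : 0 < x.2 <;> by_cases h2 : x.2 < x.1 <;> simp [h1, h2]
    rw [h1]
    exact ((measurable_pairIntegrand s hF).comp measurable_swap).indicator
      ((measurableSet_lt measurable_const measurable_snd).inter
        (measurableSet_lt measurable_snd measurable_fst))
  calc ∫⁻ a, ∫⁻ b, F (mergedPotential s a b) * pairDensity s a b
      = ∫⁻ a in Set.Ioi (-s / 2), ∫⁻ b in Set.Ioi (-s / 2), Ψ (2 * a - -s) (2 * b - -s) := by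
        rw [← lintegral_indicator measurableSet_Ioi]
        refine lintegral_congr fun a => ?_
        simp only [hpt]
        by_cases ha : a ∈ Set.Ioi (-s / 2)
        · simp only [Set.indicator_of_mem ha]
          rw [lintegral_indicator measurableSet_Ioi]
        · simp only [Set.indicator_of_notMem ha, lintegral_zero]
    _ = 2⁻¹ * ∫⁻ p in Set.Ioi 0, 2⁻¹ * ∫⁻ q in Set.Ioi 0, Ψ p q := by
        have hin : ∀ p, ∫⁻ b in Set.Ioi (-s / 2), Ψ p (2 * b - -s)
            = 2⁻¹ * ∫⁻ q in Set.Ioi 0, Ψ p q := fun p => lintegral_comp_affine (Ψ p)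
        simp only [hin]
        rw [lintegral_comp_affine fun p => 2⁻¹ * ∫⁻ q in Set.Ioi 0, Ψ p q]
    _ = 2⁻¹ * (2⁻¹ * ∫⁻ p in Set.Ioi (0 : ℝ), ∫⁻ h, (Set.Ioi 0).indicator
          (fun h => (Set.Ioi h).indicator (pairIntegrand s F h) p) h) := by
        rw [lintegral_const_mul' _ _ (by simp), setLIntegral_congr_fun measurableSet_Ioi hstep]
    _ = 2⁻¹ * (2⁻¹ * ∫⁻ h in Set.Ioi (0 : ℝ), ∫⁻ p in Set.Ioi h, pairIntegrand s F h p) := by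
        rw [lintegral_lintegral_swap hmeas.aemeasurable, ← lintegral_indicator measurableSet_Ioi]
        congr 2
        refine lintegral_congr fun h => ?_
        by_cases hh : h ∈ Set.Ioi (0 : ℝ)
        · have hsub : Set.Ioi h ⊆ Set.Ioi 0 := Set.Ioi_subset_Ioi (le_of_lt hh)
          simp only [Set.indicator_of_mem hh]
          rw [← lintegral_indicator measurableSet_Ioi, ← lintegral_indicator measurableSet_Ioi,
            Set.indicator_indicator, Set.inter_eq_right.2 hsub]
        · simp only [Set.indicator_of_notMem hh, lintegral_zero]
    _ = 2⁻¹ * (2⁻¹ * ∫⁻ h in Set.Ioi (2 * s / 2), 8 * F (2 * h - 2 * s)) := by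
        simp only [lintegral_pairIntegrand hs]
        rw [← lintegral_indicator measurableSet_Ioi, ← lintegral_indicator measurableSet_Ioi]
        congr 3
        funext h
        rw [mul_div_cancel_left₀ _ (two_ne_zero' ℝ)]
        simp only [Set.indicator_apply, Set.mem_Ioi]
        by_cases h1 : s < h
        · simp [h1, hs.trans h1]
        · simp [h1]
    _ = ∫⁻ x in Set.Ioi 0, F x := by
        rw [lintegral_const_mul' _ _ (by simp), lintegral_comp_affine F, ← mul_assoc, ← mul_assoc,
          ← mul_assoc]
        have : (2⁻¹ * 2⁻¹ * 8 * 2⁻¹ : ℝ≥0∞) = 1 := by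
          rw [show (8 : ℝ≥0∞) = 2 * 2 * 2 by norm_num]
          have h2 : (2 : ℝ≥0∞)⁻¹ * 2 = 1 := ENNReal.inv_mul_cancel two_ne_zero ENNReal.ofNat_ne_top
          calc (2⁻¹ * 2⁻¹ * (2 * 2 * 2) * 2⁻¹ : ℝ≥0∞)
              = (2⁻¹ * 2) * (2⁻¹ * 2) * (2⁻¹ * 2) := by ring
            _ = 1 := by rw [h2, one_mul, one_mul]
        rw [this, one_mul]

end H22

namespace H22

/-! ### Splitting all vertices except one

The vertices of the split graph are indexed by `Option K ⊕ K`: the vertex `none` of `Option K` is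
kept, the vertex `some k` is split into `inl (some k)` and `inr k`. -/

section Split

variable {K : Type*} [Fintype K] [DecidableEq K]

/-- The weights after splitting: siblings are joined by an edge of weight `s`, the weight of the
other edges is shared equally. -/
noncomputable def splitWeight (s : ℝ) (W : Option K → Option K → ℝ) : Option K ⊕ K → Option K ⊕ K → ℝ
  | .inl none, .inl none => 0
  | .inl none, .inl (some l) => W (some l) none / 2
  | .inl none, .inr l => W (some l) none / 2
  | .inl (some k), .inl none => W (some k) none / 2
  | .inl (some k), .inl (some l) => W (some k) (some l) / 4
  | .inl (some k), .inr l => if k = l then s else W (some k) (some l) / 4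
  | .inr k, .inl none => W (some k) none / 2
  | .inr k, .inl (some l) => if k = l then s else W (some k) (some l) / 4
  | .inr k, .inr l => W (some k) (some l) / 4

/-- The potential on the split graph. -/
def splitPotential (a b : K → ℝ) (d : ℝ) : Option K ⊕ K → ℝ := Sum.elim (optionCons a d) b

/-- The merged potential. -/
noncomputable def mergePairs (s : ℝ) (a b : K → ℝ) (d : ℝ) : Option K → ℝ :=
  optionCons (fun k => mergedPotential s (a k) (b k)) d

/-- The change of basis that separates the merged graph. -/
noncomputable def splitBasis (s : ℝ) (a b : K → ℝ) : Matrix (Option K ⊕ K) (Option K ⊕ K) ℝ :=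
  Matrix.fromBlocks
    (Matrix.diagonal fun o => o.elim 1 fun k => childRatio s (a k) (b k))
    (Matrix.of fun o l => if o = some l then -1 else 0)
    (Matrix.of fun k o => if o = some k then childRatio s (b k) (a k) else 0) 1

variable {s : ℝ} {W : Option K → Option K → ℝ} {a b : K → ℝ} {d : ℝ}

lemma det_splitBasis (h : ∀ k, childRatio s (a k) (b k) + childRatio s (b k) (a k) = 2) :
    (splitBasis s a b).det = 2 ^ Fintype.card K := by
  have h1 : (Matrix.diagonal fun o : Option K => o.elim 1 fun k => childRatio s (a k) (b k))
      - (Matrix.of fun (o : Option K) (l : K) => if o = some l then (-1 : ℝ) else 0)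
        * (Matrix.of fun (k : K) o => if o = some k then childRatio s (b k) (a k) else 0)
      = Matrix.diagonal fun o : Option K => o.elim 1 fun _ => 2 := by
    ext (_ | k) (_ | l)
    · simp [Matrix.mul_apply]
    · simp [Matrix.mul_apply]
    · simp [Matrix.mul_apply]
    · rcases eq_or_ne k l with rfl | hkl
      · simp [Matrix.mul_apply, h]
      · simp [Matrix.mul_apply, hkl]
  rw [splitBasis, Matrix.det_fromBlocks_one₂₂, h1, Matrix.det_diagonal, Fintype.prod_option]
  simp

lemma mul_splitBasis_none (M : Matrix (Option K ⊕ K) (Option K ⊕ K) ℝ) (i : Option K ⊕ K) :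
    (M * splitBasis s a b) i (.inl none) = M i (.inl none) := by
  simp [Matrix.mul_apply, Fintype.sum_sum_type, splitBasis, Matrix.diagonal]

lemma mul_splitBasis_some (M : Matrix (Option K ⊕ K) (Option K ⊕ K) ℝ) (i : Option K ⊕ K) (l : K) :
    (M * splitBasis s a b) i (.inl (some l)) = M i (.inl (some l)) * childRatio s (a l) (b l)
      + M i (.inr l) * childRatio s (b l) (a l) := by
  simp [Matrix.mul_apply, Fintype.sum_sum_type, splitBasis, Matrix.diagonal]

lemma mul_splitBasis_inr (M : Matrix (Option K ⊕ K) (Option K ⊕ K) ℝ) (i : Option K ⊕ K) (l : K) :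
    (M * splitBasis s a b) i (.inr l) = M i (.inr l) - M i (.inl (some l)) := by
  simp [Matrix.mul_apply, Fintype.sum_sum_type, splitBasis, Matrix.one_apply]
  ring

/-- One part of the basis distributes a value over two siblings by `childRatio`, the other consists
of sibling differences. They are orthogonal for the Schrödinger form, which restricts to the merged
form on the first part and is diagonal on the second. -/
lemma transpose_mul_mul_splitBasis (hab : ∀ k, a k + b k + s ≠ 0) (hW : ∀ i j, W i j = W j i) :
    (splitBasis s a b).transpose * schrodinger (splitWeight s W) (splitPotential a b d)
        * splitBasis s a b
      = Matrix.fromBlocks (schrodinger W (mergePairs s a b d)) 0 0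
        (Matrix.diagonal fun k => 2 * (a k + b k + s)) := by
  set H := schrodinger (splitWeight s W) (splitPotential a b d) with hH
  have hL : ∀ i j, ((splitBasis s a b).transpose * H * splitBasis s a b) i j
      = ((H * splitBasis s a b).transpose * splitBasis s a b) j i := by
    intro i j
    rw [Matrix.mul_assoc, ← Matrix.transpose_apply (_ * _) j i, Matrix.transpose_mul,
      Matrix.transpose_transpose]
  have hba : ∀ k, childRatio s (b k) (a k) = (2 * a k + s) / (a k + b k + s) := fun k => by
    rw [childRatio, add_comm (b k)]
  have h00 : H (.inl none) (.inl none) = 2 * d := schrodinger_diag _ _ _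
  have h0L : ∀ l, H (.inl none) (.inl (some l)) = -(W (some l) none / 2) := fun l =>
    schrodinger_off _ _ (by simp)
  have h0R : ∀ l, H (.inl none) (.inr l) = -(W (some l) none / 2) := fun l =>
    schrodinger_off _ _ (by simp)
  have hL0 : ∀ l, H (.inl (some l)) (.inl none) = -(W (some l) none / 2) := fun l =>
    schrodinger_off _ _ (by simp)
  have hR0 : ∀ l, H (.inr l) (.inl none) = -(W (some l) none / 2) := fun l =>
    schrodinger_off _ _ (by simp)
  have hLL : ∀ k l, H (.inl (some k)) (.inl (some l))
      = if k = l then 2 * a k else -(W (some k) (some l) / 4) := fun k l => by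
    split_ifs with h
    · subst h; exact schrodinger_diag _ _ _
    · exact schrodinger_off _ _ (by simpa using h)
  have hRR : ∀ k l, H (.inr k) (.inr l)
      = if k = l then 2 * b k else -(W (some k) (some l) / 4) := fun k l => by
    split_ifs with h
    · subst h; exact schrodinger_diag _ _ _
    · exact schrodinger_off _ _ (by simpa using h)
  have hLR : ∀ k l, H (.inl (some k)) (.inr l)
      = if k = l then -s else -(W (some k) (some l) / 4) := fun k l => by
    rw [hH, schrodinger_off _ _ (by simp)]
    simp only [splitWeight]
    split_ifs <;> rfl
  have hRL : ∀ k l, H (.inr k) (.inl (some l))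
      = if k = l then -s else -(W (some k) (some l) / 4) := fun k l => by
    rw [hH, schrodinger_off _ _ (by simp)]
    simp only [splitWeight]
    split_ifs <;> rfl
  have hd : ∀ (k : K), mergePairs s a b d (some k) = (4 * a k * b k - s ^ 2) / (a k + b k + s) :=
    fun k => mergedPotential_eq _ _ _
  have hkk : ∀ k, schrodinger W (mergePairs s a b d) (some k) (some k)
      = 2 * ((4 * a k * b k - s ^ 2) / (a k + b k + s)) := fun k => by rw [schrodinger_diag, hd]
  ext i j
  rw [hL]
  rcases i with (_ | i) | i <;> rcases j with (_ | j) | j <;>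
    simp only [mul_splitBasis_none, mul_splitBasis_some, mul_splitBasis_inr,
      Matrix.transpose_apply, h00, h0L, h0R, hL0, hR0, hLL, hLR, hRL, hRR, hba,
      Matrix.fromBlocks_apply₁₁, Matrix.fromBlocks_apply₁₂, Matrix.fromBlocks_apply₂₁,
      Matrix.fromBlocks_apply₂₂, Matrix.zero_apply, Matrix.diagonal_apply]
  · rw [schrodinger_diag]; rfl
  · have := hab j
    rw [schrodinger_off _ _ (by simp), hW none, childRatio]
    field_simp
    ring
  · ring
  · have := hab i
    rw [schrodinger_off _ _ (by simp), childRatio]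
    field_simp
    ring
  · have h1 := hab i
    have h2 := hab j
    rcases eq_or_ne i j with rfl | hij
    · simp only [if_true, hkk, childRatio]
      field_simp
      ring
    · rw [schrodinger_off _ _ (by simpa using hij)]
      simp only [if_neg hij, childRatio]
      field_simp
      ring
  · have h1 := hab i
    rcases eq_or_ne i j with rfl | hij
    · simp only [if_true, childRatio]
      field_simp
      ring
    · simp only [if_neg hij, childRatio]
      ring
  · ring
  · have h1 := hab j
    rcases eq_or_ne i j with rfl | hij
    · simp only [if_true, childRatio]
      field_simp
      ring
    · simp only [if_neg hij, childRatio]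
      ring
  · rcases eq_or_ne i j with rfl | hij
    · simp only [if_true]
      ring
    · simp only [if_neg hij]
      ring

lemma splitWeight_comm (hW : ∀ i j, W i j = W j i) : ∀ i j, splitWeight s W i j = splitWeight s W j i
  | .inl none, .inl none => rfl
  | .inl none, .inl (some _) => rfl
  | .inl none, .inr _ => rfl
  | .inl (some _), .inl none => rfl
  | .inl (some _), .inl (some _) => by simp only [splitWeight, hW]
  | .inl (some k), .inr l => by simp only [splitWeight, hW (some k), eq_comm]
  | .inr _, .inl none => rfl
  | .inr k, .inl (some l) => by simp only [splitWeight, hW (some k), eq_comm]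
  | .inr _, .inr _ => by simp only [splitWeight, hW]

lemma posDef_fromBlocks_diagonal {A : Matrix (Option K) (Option K) ℝ} {δ : K → ℝ} :
    (Matrix.fromBlocks A 0 0 (Matrix.diagonal δ)).PosDef ↔ A.PosDef ∧ ∀ k, 0 < δ k := by
  constructor
  · intro h
    refine ⟨?_, fun k => ?_⟩
    · exact h.submatrix (e := Sum.inl) Sum.inl_injective
    · simpa using h.diag_pos (i := Sum.inr k)
  · rintro ⟨hA, hδ⟩
    have hD := Matrix.PosDef.diagonal hδ
    refine posDef_of_forall_pos (Matrix.IsHermitian.fromBlocks hA.1 (by simp) hD.1) fun y hy => ?_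
    have hmul : y ⬝ᵥ (Matrix.fromBlocks A 0 0 (Matrix.diagonal δ)).mulVec y
        = (y ∘ Sum.inl) ⬝ᵥ A.mulVec (y ∘ Sum.inl)
          + (y ∘ Sum.inr) ⬝ᵥ (Matrix.diagonal δ).mulVec (y ∘ Sum.inr) := by
      rw [Matrix.fromBlocks_mulVec]
      simp [dotProduct, Fintype.sum_sum_type]
    rw [hmul]
    by_cases h : y ∘ Sum.inl = 0
    · have h' : y ∘ Sum.inr ≠ 0 := fun h' => hy (by
        funext i; rcases i with i | i
        · exact congrFun h i
        · exact congrFun h' i)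
      exact add_pos_of_nonneg_of_pos (dotProduct_mulVec_nonneg hA _) (dotProduct_mulVec_pos hD h')
    · exact add_pos_of_pos_of_nonneg (dotProduct_mulVec_pos hA h) (dotProduct_mulVec_nonneg hD _)

section

variable (hW : ∀ i j, W i j = W j i) (hs : 0 < s) (ha : ∀ k, 0 < a k) (hb : ∀ k, 0 < b k)
include hs ha hb

lemma isUnit_splitBasis : IsUnit (splitBasis s a b) := by
  rw [Matrix.isUnit_iff_isUnit_det, det_splitBasis fun k => childRatio_add hs (ha k) (hb k)]
  exact (pow_ne_zero _ two_ne_zero).isUnit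

include hW

lemma posDef_split_iff : (schrodinger (splitWeight s W) (splitPotential a b d)).PosDef
    ↔ (schrodinger W (mergePairs s a b d)).PosDef := by
  have hab : ∀ k, 0 < a k + b k + s := fun k => add_pos (add_pos (ha k) (hb k)) hs
  rw [← Matrix.IsUnit.posDef_star_left_conjugate_iff (isUnit_splitBasis hs ha hb),
    Matrix.star_eq_conjTranspose, Matrix.conjTranspose_eq_transpose_of_trivial,
    transpose_mul_mul_splitBasis (fun k => (hab k).ne') hW, posDef_fromBlocks_diagonal]
  exact and_iff_left fun k => mul_pos two_pos (hab k)

lemma det_split : (schrodinger (splitWeight s W) (splitPotential a b d)).det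
    = (schrodinger W (mergePairs s a b d)).det * ∏ k, (a k + b k + s) / 2 := by
  have hab : ∀ k, 0 < a k + b k + s := fun k => add_pos (add_pos (ha k) (hb k)) hs
  have h1 := congrArg Matrix.det
    (transpose_mul_mul_splitBasis (d := d) (fun k => (hab k).ne') hW)
  rw [Matrix.det_mul, Matrix.det_mul, Matrix.det_transpose, Matrix.det_fromBlocks_zero₂₁,
    Matrix.det_diagonal, det_splitBasis fun k => childRatio_add hs (ha k) (hb k)] at h1
  have h2 : ∏ k, 2 * (a k + b k + s)
      = (2 ^ Fintype.card K) ^ 2 * ∏ k, (a k + b k + s) / 2 := by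
    rw [← Finset.card_univ, ← pow_mul, mul_comm (Finset.card _), pow_mul, ← Finset.prod_const,
      ← Finset.prod_mul_distrib]
    exact Finset.prod_congr rfl fun k _ => by ring
  rw [h2] at h1
  have h3 : (2 : ℝ) ^ Fintype.card K ≠ 0 := pow_ne_zero _ two_ne_zero
  refine mul_left_cancel₀ (pow_ne_zero 2 h3) ?_
  linear_combination h1

end

lemma sum_split (hW : ∀ i j, W i j = W j i) :
    ∑ i, ∑ j, schrodinger (splitWeight s W) (splitPotential a b d) i j
      = ∑ i, ∑ j, schrodinger W (mergePairs s a b d) i j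
        + ∑ k, 2 * (a k + b k - s - mergedPotential s (a k) (b k)) := by
  simp only [Fintype.sum_sum_type, Fintype.sum_option, Finset.sum_add_distrib]
  have e0 : schrodinger (splitWeight s W) (splitPotential a b d) (.inl none) (.inl none)
      = schrodinger W (mergePairs s a b d) none none := by
    rw [schrodinger_diag, schrodinger_diag]; rfl
  have e1 : ∀ k, schrodinger (splitWeight s W) (splitPotential a b d) (.inl none) (.inl (some k))
      + schrodinger (splitWeight s W) (splitPotential a b d) (.inl none) (.inr k)
      = schrodinger W (mergePairs s a b d) none (some k) := fun k => by
    rw [schrodinger_off _ _ (by simp), schrodinger_off _ _ (by simp),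
      schrodinger_off _ _ (by simp), hW none]
    simp only [splitWeight]; ring
  have e2 : ∀ k, schrodinger (splitWeight s W) (splitPotential a b d) (.inl (some k)) (.inl none)
      + schrodinger (splitWeight s W) (splitPotential a b d) (.inr k) (.inl none)
      = schrodinger W (mergePairs s a b d) (some k) none := fun k => by
    rw [schrodinger_off _ _ (by simp), schrodinger_off _ _ (by simp),
      schrodinger_off _ _ (by simp)]
    simp only [splitWeight]; ring
  have e3 : ∀ k l,
      schrodinger (splitWeight s W) (splitPotential a b d) (.inl (some k)) (.inl (some l))
      + schrodinger (splitWeight s W) (splitPotential a b d) (.inl (some k)) (.inr l)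
      + schrodinger (splitWeight s W) (splitPotential a b d) (.inr k) (.inl (some l))
      + schrodinger (splitWeight s W) (splitPotential a b d) (.inr k) (.inr l)
      = schrodinger W (mergePairs s a b d) (some k) (some l)
        + if k = l then 2 * (a k + b k - s - mergedPotential s (a k) (b k)) else 0 := fun k l => by
    rw [schrodinger_off (i := Sum.inl (some k)) (j := Sum.inr l) _ _ (by simp),
      schrodinger_off (i := Sum.inr k) (j := Sum.inl (some l)) _ _ (by simp)]
    rcases eq_or_ne k l with rfl | hkl
    · rw [schrodinger_diag, schrodinger_diag, schrodinger_diag]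
      simp only [splitWeight, splitPotential, mergePairs, optionCons, Sum.elim_inl, Sum.elim_inr,
        Option.elim_some, if_true]
      ring
    · rw [schrodinger_off _ _ (by simpa using hkl), schrodinger_off _ _ (by simpa using hkl),
        schrodinger_off _ _ (by simpa using hkl)]
      simp only [splitWeight, if_neg hkl]
      ring
  have s1 := Finset.sum_congr (rfl : (Finset.univ : Finset K) = _) fun k _ => e1 k
  have s2 := Finset.sum_congr (rfl : (Finset.univ : Finset K) = _) fun k _ => e2 k
  have s3 := Finset.sum_congr (rfl : (Finset.univ : Finset K) = _) fun k _ =>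
    Finset.sum_congr (rfl : (Finset.univ : Finset K) = _) fun l _ => e3 k l
  simp only [Finset.sum_add_distrib, Finset.sum_ite_eq, Finset.mem_univ, if_true] at s1 s2 s3
  rw [e0]
  linarith

/-- The density of the split model in terms of the density of the merged model. -/
theorem h22Density_split (hW : ∀ i j, W i j = W j i) (hs : 0 < s) (a b : K → ℝ) (d : ℝ) :
    h22Density (splitWeight s W) 0 (splitPotential a b d)
      = h22Density W 0 (mergePairs s a b d) * ∏ k, pairDensity s (a k) (b k) := by
  have hpos : (schrodinger (splitWeight s W) (splitPotential a b d)).PosDef →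
      ∀ k, 0 < a k ∧ 0 < b k ∧ 0 < mergedPotential s (a k) (b k) := by
    intro h k
    have ha : 0 < a k := pos_of_posDef h (.inl (some k))
    have hb : 0 < b k := pos_of_posDef h (.inr k)
    refine ⟨ha, hb, ?_⟩
    -- The principal minor of the two siblings is the numerator of the merged potential.
    have h1 := (h.submatrix (e := ![Sum.inl (some k), Sum.inr k]) (by
      intro i j; fin_cases i <;> fin_cases j <;> simp)).det_pos
    rw [Matrix.det_fin_two] at h1
    simp only [Matrix.submatrix_apply, Matrix.cons_val_zero, Matrix.cons_val_one] at h1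
    rw [schrodinger_diag, schrodinger_diag, schrodinger_off _ _ (by simp),
      schrodinger_off _ _ (by simp)] at h1
    simp only [splitWeight, splitPotential, optionCons, Sum.elim_inl, Sum.elim_inr,
      Option.elim_some, if_true] at h1
    rw [mergedPotential_eq]
    exact div_pos (by linarith) (by positivity)
  by_cases hg : ∀ k, 0 < 2 * a k + s ∧ 0 < 2 * b k + s ∧ 0 < mergedPotential s (a k) (b k)
  · have hab : ∀ k, 0 < a k ∧ 0 < b k := by
      intro k
      obtain ⟨h1, h2, h3⟩ := hg k
      have h4 : 0 < a k + b k + s := by linarith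
      rw [mergedPotential_eq, div_pos_iff_of_pos_right h4] at h3
      have h5 : 0 < a k * b k := by nlinarith
      rcases pos_and_pos_or_neg_and_neg_of_mul_pos h5 with h | h
      · exact h
      -- If both were negative, `-2 a k` and `-2 b k` would lie below `s`, so `4 * a k * b k < s ^
      -- 2`.
      · nlinarith
    have ha := fun k => (hab k).1
    have hb := fun k => (hab k).2
    by_cases hpd : (schrodinger W (mergePairs s a b d)).PosDef
    · have hpd' := (posDef_split_iff (d := d) hW hs ha hb).2 hpd
      rw [h22Density_of_posDef hpd, h22Density_of_posDef hpd', det_split hW hs ha hb, sum_split hW]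
      simp only [pairDensity, if_pos (hg _)]
      rw [← ENNReal.ofReal_prod_of_nonneg fun k _ => by positivity,
        ← ENNReal.ofReal_mul (by positivity)]
      congr 1
      simp only [Pi.zero_apply, Finset.sum_const_zero, zero_dotProduct, mul_zero, sub_zero, add_zero]
      have hprod : ∀ k, 0 < (a k + b k + s) / 2 := fun k => by
        have := ha k; have := hb k; positivity
      have hP : ∏ k, (√(2 / Real.pi) * Real.exp (-(a k + b k - s - mergedPotential s (a k) (b k)))
          / √((a k + b k + s) / 2)) = √(2 / Real.pi) ^ Fintype.card K
            * Real.exp (∑ k, -(a k + b k - s - mergedPotential s (a k) (b k)))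
            / ∏ k, √((a k + b k + s) / 2) := by
        rw [Finset.prod_div_distrib, Finset.prod_mul_distrib, Finset.prod_const, ← Real.exp_sum,
          Finset.card_univ]
      rw [hP, Real.sqrt_mul hpd.det_pos.le, Fintype.card_sum, pow_add,
        Real.sqrt_prod _ fun k _ => (hprod k).le,
        show -(1 / 2) * (∑ i, ∑ j, schrodinger W (mergePairs s a b d) i j
          + ∑ k, 2 * (a k + b k - s - mergedPotential s (a k) (b k)))
          = -(1 / 2) * (∑ i, ∑ j, schrodinger W (mergePairs s a b d) i j)
            + ∑ k, -(a k + b k - s - mergedPotential s (a k) (b k)) by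
          rw [mul_add, ← Finset.mul_sum, Finset.sum_neg_distrib]; ring, Real.exp_add]
      have h1 := (Real.sqrt_pos.2 hpd.det_pos).ne'
      have h2 : ∏ k, √((a k + b k + s) / 2) ≠ 0 :=
        Finset.prod_ne_zero_iff.2 fun k _ => (Real.sqrt_pos.2 (hprod k)).ne'
      field_simp
    · rw [h22Density_of_not_posDef hpd, h22Density_of_not_posDef fun h =>
        hpd ((posDef_split_iff hW hs ha hb).1 h), zero_mul]
  · have h1 : ¬ (schrodinger (splitWeight s W) (splitPotential a b d)).PosDef := fun h =>
      hg fun k => by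
        obtain ⟨h1, h2, h3⟩ := hpos h k
        exact ⟨by positivity, by positivity, h3⟩
    push Not at hg
    obtain ⟨k, hk⟩ := hg
    have h2 : pairDensity s (a k) (b k) = 0 := if_neg fun h => absurd h.2.2 (not_lt.2 (hk h.1 h.2.1))
    rw [h22Density_of_not_posDef h1, Finset.prod_eq_zero (Finset.mem_univ k) h2, mul_zero]

end Split

end H22

namespace H22

/-! ### The coarse-graining of the `H^{2|2}`-model -/

lemma lintegral_fin_prod {E : Type*} [MeasurableSpace E] (μ : Measure E) [SigmaFinite μ] {n : ℕ}
    {f : Fin n → E → ℝ≥0∞} (hf : ∀ i, Measurable (f i)) :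
    ∫⁻ x, ∏ i, f i (x i) ∂(Measure.pi fun _ : Fin n => μ) = ∏ i, ∫⁻ x, f i x ∂μ := by
  induction n with
  | zero => simp
  | succ n ih =>
    have h := (measurePreserving_piFinSuccAbove (fun _ : Fin (n + 1) => μ) 0).symm
    rw [← h.lintegral_comp_emb (MeasurableEquiv.measurableEmbedding _)]
    simp_rw [MeasurableEquiv.piFinSuccAbove_symm_apply, Fin.insertNthEquiv, Fin.prod_univ_succ]
    simp only [Equiv.coe_fn_mk, Fin.insertNth_zero, Fin.cons_zero, Fin.cons_succ]
    rw [← ih fun i => hf i.succ]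
    exact lintegral_prod_mul (hf 0).aemeasurable (Finset.measurable_prod _ fun (i : Fin n) _ =>
      (hf i.succ).comp (measurable_pi_apply i)).aemeasurable

lemma pi_withDensity {E : Type*} [MeasurableSpace E] (μ : Measure E) [SigmaFinite μ] (n : ℕ)
    {g : E → ℝ≥0∞} (hg : Measurable g) [SigmaFinite (μ.withDensity g)] :
    Measure.pi (fun _ : Fin n => μ.withDensity g)
      = (Measure.pi fun _ : Fin n => μ).withDensity fun x => ∏ i, g (x i) := by
  refine Measure.pi_eq fun s hs => ?_
  rw [withDensity_apply _ (MeasurableSet.univ_pi hs), ← lintegral_indicator (MeasurableSet.univ_pi hs)]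
  have h1 : ∀ x : Fin n → E, (Set.univ.pi s).indicator (fun x => ∏ i, g (x i)) x
      = ∏ i, (s i).indicator g (x i) := by
    intro x
    by_cases hx : x ∈ Set.univ.pi s
    · rw [Set.indicator_of_mem hx]
      exact Finset.prod_congr rfl fun i _ => (Set.indicator_of_mem (hx i trivial) _).symm
    · rw [Set.indicator_of_notMem hx]
      obtain ⟨i, -, hi⟩ : ∃ i, i ∈ Set.univ ∧ x i ∉ s i := by
        by_contra! hcon
        exact hx fun i hi => hcon i hi
      exact (Finset.prod_eq_zero (Finset.mem_univ i) (Set.indicator_of_notMem hi _)).symm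
  simp_rw [h1]
  rw [lintegral_fin_prod μ fun i => hg.indicator (hs i)]
  exact Finset.prod_congr rfl fun i _ => by
    rw [lintegral_indicator (hs i), withDensity_apply _ (hs i)]

lemma pairDensity_ne_top (s a b : ℝ) : pairDensity s a b ≠ ∞ := by
  unfold pairDensity
  split_ifs <;> simp

/-- The measure on the potentials of a pair of siblings. -/
noncomputable def pairMeasure (s : ℝ) : Measure (ℝ × ℝ) :=
  volume.withDensity fun x => pairDensity s x.1 x.2

instance (s : ℝ) : SigmaFinite (pairMeasure s) :=
  SigmaFinite.withDensity_of_ne_top (ae_of_all _ fun x => pairDensity_ne_top s x.1 x.2)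

lemma map_pairMeasure {s : ℝ} (hs : 0 < s) :
    (pairMeasure s).map (fun x => mergedPotential s x.1 x.2) = volume.restrict (Set.Ioi 0) := by
  have hm := measurable_mergedPotential s
  ext A hA
  rw [Measure.map_apply hm hA, pairMeasure, withDensity_apply _ (hm hA),
    ← lintegral_indicator (hm hA)]
  have h1 : ∀ x : ℝ × ℝ, ((fun x : ℝ × ℝ => mergedPotential s x.1 x.2) ⁻¹' A).indicator
      (fun x => pairDensity s x.1 x.2) x
      = A.indicator 1 (mergedPotential s x.1 x.2) * pairDensity s x.1 x.2 := by
    intro x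
    by_cases hx : mergedPotential s x.1 x.2 ∈ A
    · rw [Set.indicator_of_mem (show x ∈ (fun x : ℝ × ℝ => mergedPotential s x.1 x.2) ⁻¹' A from hx),
        Set.indicator_of_mem hx, Pi.one_apply, one_mul]
    · rw [Set.indicator_of_notMem (show x ∉ (fun x : ℝ × ℝ => mergedPotential s x.1 x.2) ⁻¹' A from hx),
        Set.indicator_of_notMem hx, zero_mul]
  have hI : Measurable (A.indicator (1 : ℝ → ℝ≥0∞)) := measurable_one.indicator hA
  have hp : Measurable fun x : ℝ × ℝ =>
      A.indicator (1 : ℝ → ℝ≥0∞) (mergedPotential s x.1 x.2) * pairDensity s x.1 x.2 :=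
    (hI.comp hm).mul (measurable_pairDensity s)
  simp_rw [h1]
  rw [Measure.volume_eq_prod, lintegral_prod _ hp.aemeasurable, lintegral_pair hs hI,
    lintegral_indicator_one hA]

lemma lintegral_pairs {s : ℝ} (hs : 0 < s) {n : ℕ} {Φ : (Fin n → ℝ) → ℝ≥0∞} (hΦ : Measurable Φ) :
    ∫⁻ p : Fin n → ℝ × ℝ, Φ (fun k => mergedPotential s (p k).1 (p k).2)
        * ∏ k, pairDensity s (p k).1 (p k).2
      = ∫⁻ y in Set.univ.pi fun _ => Set.Ioi 0, Φ y := by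
  have hm := measurable_mergedPotential s
  have hd := measurable_pairDensity s
  have hM : Measurable fun (p : Fin n → ℝ × ℝ) k => mergedPotential s (p k).1 (p k).2 :=
    measurable_pi_lambda _ fun k => hm.comp (measurable_pi_apply k)
  have : SigmaFinite (Measure.map (fun x : ℝ × ℝ => mergedPotential s x.1 x.2) (pairMeasure s)) := by
    rw [map_pairMeasure hs]; infer_instance
  have h1 := Measure.pi_map_pi (ι := Fin n) (μ := fun _ => pairMeasure s)
    (f := fun _ x => mergedPotential s x.1 x.2) fun _ => hm.aemeasurable
  rw [map_pairMeasure hs, ← Measure.restrict_pi_pi] at h1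
  have : SigmaFinite ((volume : Measure (ℝ × ℝ)).withDensity fun x => pairDensity s x.1 x.2) :=
    inferInstanceAs (SigmaFinite (pairMeasure s))
  have h2 := pi_withDensity (volume : Measure (ℝ × ℝ)) n (g := fun x => pairDensity s x.1 x.2) hd
  rw [volume_pi (ι := Fin n) (α := fun _ => ℝ), ← h1, lintegral_map hΦ hM]
  simp only [pairMeasure]
  have hprod : Measurable fun p : Fin n → ℝ × ℝ => ∏ k, pairDensity s (p k).1 (p k).2 :=
    Finset.measurable_prod _ fun i _ => hd.comp (measurable_pi_apply i)
  have hΦM : Measurable fun p : Fin n → ℝ × ℝ => Φ fun k => mergedPotential s (p k).1 (p k).2 :=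
    hΦ.comp hM
  rw [h2, lintegral_withDensity_eq_lintegral_mul _ hprod hΦM, volume_pi]
  exact lintegral_congr fun p => mul_comm _ _

section

variable {K : Type*} [Fintype K] [DecidableEq K]

lemma measurable_splitPotential : Measurable fun x : (K → ℝ) × (K → ℝ) × ℝ =>
    splitPotential x.1 x.2.1 x.2.2 := by
  refine measurable_pi_lambda _ fun i => ?_
  rcases i with (_ | i) | i
  · exact measurable_snd.snd
  · exact (measurable_pi_apply i).comp measurable_fst
  · exact (measurable_pi_apply i).comp measurable_snd.fst

lemma lintegral_split {f : (Option K ⊕ K → ℝ) → ℝ≥0∞} (hf : Measurable f) :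
    ∫⁻ γ, f γ = ∫⁻ d : ℝ, ∫⁻ p : K → ℝ × ℝ,
      f (splitPotential (fun k => (p k).1) (fun k => (p k).2) d) := by
  have h1 := volume_measurePreserving_sumPiEquivProdPi_symm (fun _ : Option K ⊕ K => ℝ)
  rw [← h1.lintegral_comp_emb (MeasurableEquiv.measurableEmbedding _)]
  have h2 : ∀ x : (Option K → ℝ) × (K → ℝ),
      (MeasurableEquiv.sumPiEquivProdPi fun _ : Option K ⊕ K => ℝ).symm x = Sum.elim x.1 x.2 := by
    intro x
    funext i
    rcases i with i | i <;> rfl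
  have hm : Measurable fun x : (Option K → ℝ) × (K → ℝ) => f (Sum.elim x.1 x.2) := by
    simp_rw [← h2]
    exact hf.comp (MeasurableEquiv.measurable _)
  simp_rw [h2]
  have hsp := hf.comp (measurable_splitPotential (K := K))
  have hm2' : Measurable fun y : ((K → ℝ) × ℝ) × (K → ℝ) =>
      f (splitPotential y.1.1 y.2 y.1.2) := by
    have hperm : Measurable fun y : ((K → ℝ) × ℝ) × (K → ℝ) => (y.1.1, y.2, y.1.2) := by fun_prop
    exact hsp.comp hperm
  have hm2 : Measurable fun x : (K → ℝ) × ℝ =>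
      ∫⁻ b : K → ℝ, f (splitPotential x.1 b x.2) := hm2'.lintegral_prod_right'
  have h3 : ∫⁻ x : (Option K → ℝ) × (K → ℝ), f (Sum.elim x.1 x.2)
      = ∫⁻ α : Option K → ℝ, ∫⁻ b : K → ℝ, f (Sum.elim α b) := lintegral_prod _ hm.aemeasurable
  have h4 : ∫⁻ α : Option K → ℝ, ∫⁻ b : K → ℝ, f (Sum.elim α b)
      = ∫⁻ a : K → ℝ, ∫⁻ d : ℝ, ∫⁻ b : K → ℝ, f (splitPotential a b d) :=
    lintegral_option (fun α => ∫⁻ b : K → ℝ, f (Sum.elim α b)) hm.lintegral_prod_right'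
  have h5 : ∫⁻ a : K → ℝ, ∫⁻ d : ℝ, ∫⁻ b : K → ℝ, f (splitPotential a b d)
      = ∫⁻ d : ℝ, ∫⁻ a : K → ℝ, ∫⁻ b : K → ℝ, f (splitPotential a b d) :=
    lintegral_lintegral_swap hm2.aemeasurable
  rw [h3, h4, h5]
  refine lintegral_congr fun d => ?_
  have hm3 : Measurable fun x : (K → ℝ) × (K → ℝ) => f (splitPotential x.1 x.2 d) :=
    hsp.comp (measurable_fst.prodMk (measurable_snd.prodMk measurable_const))
  have h6 : ∫⁻ x : (K → ℝ) × (K → ℝ), f (splitPotential x.1 x.2 d)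
      = ∫⁻ a : K → ℝ, ∫⁻ b : K → ℝ, f (splitPotential a b d) := lintegral_prod _ hm3.aemeasurable
  rw [← h6]
  exact ((volume_measurePreserving_arrowProdEquivProdArrow ℝ ℝ K).lintegral_comp hm3).symm

end

/-- Merging all pairs of siblings, in the coordinates on the split graph. -/
noncomputable def mergeSplit {K : Type*} (s : ℝ) (γ : Option K ⊕ K → ℝ) : Option K → ℝ :=
  mergePairs s (fun k => γ (.inl (some k))) (fun k => γ (.inr k)) (γ (.inl none))

lemma measurable_mergeSplit {K : Type*} (s : ℝ) : Measurable (mergeSplit (K := K) s) := by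
  refine measurable_pi_lambda _ fun o => ?_
  rcases o with _ | k
  · exact measurable_pi_apply (Sum.inl none)
  · have h : Measurable fun γ : Option K ⊕ K → ℝ => (γ (.inl (some k)), γ (.inr k)) := by fun_prop
    exact (measurable_mergedPotential s).comp h

/-- The split density is the merged density times the pair densities, and these integrate over the
fibres of merging to Lebesgue measure on positive vectors, outside of which the merged density
vanishes anyway. -/
theorem map_mergeSplit {s : ℝ} (hs : 0 < s) {n : ℕ} {W : Option (Fin n) → Option (Fin n) → ℝ}
    (hW : ∀ i j, W i j = W j i) :
    (h22Eta (splitWeight s W) 0).map (mergeSplit s) = h22Eta W 0 := by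
  have hM := measurable_mergeSplit (K := Fin n) s
  have hd := measurable_h22Density hW 0
  have hd' := measurable_h22Density (splitWeight_comm (s := s) hW) 0
  ext A hA
  rw [Measure.map_apply hM hA, h22Eta, h22Eta, withDensity_apply _ (hM hA), withDensity_apply _ hA,
    ← lintegral_indicator (hM hA), ← lintegral_indicator hA,
    lintegral_split (hd'.indicator (hM hA)), lintegral_option _ (hd.indicator hA)]
  have hF : Measurable fun x : (Fin n → ℝ) × ℝ =>
      A.indicator (h22Density W 0) (optionCons x.1 x.2) :=
    (hd.indicator hA).comp measurable_optionCons
  refine Eq.trans ?_ (lintegral_lintegral_swap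
    (f := fun y d => A.indicator (h22Density W 0) (optionCons y d)) hF.aemeasurable).symm
  refine lintegral_congr fun d => ?_
  have h1 : ∀ p : Fin n → ℝ × ℝ, (mergeSplit s ⁻¹' A).indicator (h22Density (splitWeight s W) 0)
      (splitPotential (fun k => (p k).1) (fun k => (p k).2) d)
      = A.indicator (h22Density W 0)
        (optionCons (fun k => mergedPotential s (p k).1 (p k).2) d)
        * ∏ k, pairDensity s (p k).1 (p k).2 := by
    intro p
    have h2 : mergeSplit s (splitPotential (fun k => (p k).1) (fun k => (p k).2) d)
        = optionCons (fun k => mergedPotential s (p k).1 (p k).2) d := rfl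
    by_cases hp : optionCons (fun k => mergedPotential s (p k).1 (p k).2) d ∈ A
    · rw [Set.indicator_of_mem hp, Set.indicator_of_mem (show _ ∈ mergeSplit s ⁻¹' A from hp),
        h22Density_split hW hs]
      rfl
    · rw [Set.indicator_of_notMem hp, Set.indicator_of_notMem (show _ ∉ mergeSplit s ⁻¹' A from hp), zero_mul]
  simp_rw [h1]
  rw [lintegral_pairs hs (Φ := fun y => A.indicator (h22Density W 0) (optionCons y d))
    (hF.comp (measurable_id.prodMk measurable_const)),
    ← lintegral_indicator (MeasurableSet.univ_pi fun _ => measurableSet_Ioi)]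
  refine lintegral_congr fun y => ?_
  by_cases hy : y ∈ Set.univ.pi fun _ : Fin n => Set.Ioi (0 : ℝ)
  · rw [Set.indicator_of_mem hy]
  · rw [Set.indicator_of_notMem hy]
    have h2 : h22Density W 0 (optionCons y d) = 0 := h22Density_of_not_posDef fun h =>
      hy fun k _ => pos_of_posDef h (some k)
    by_cases hA' : optionCons y d ∈ A
    · rw [Set.indicator_of_mem hA', h2]
    · rw [Set.indicator_of_notMem hA']

/-- The vertices of `Λ_{n+1} ∪ {δ}` as vertices of the split graph of `Λ_n ∪ {δ}`. -/
noncomputable def splitEquiv (n : ℕ) : Vertex n ⊕ Fin (2 ^ n) ≃ Vertex (n + 1) :=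
  Equiv.ofBijective (Sum.elim (Option.map leftChild) (some ∘ rightChild)) <| by
    rw [Fintype.bijective_iff_injective_and_card]
    refine ⟨?_, by simp [pow_succ]; ring⟩
    rintro ((_ | i) | i) ((_ | j) | j) h <;>
      simp [leftChild, rightChild] at h
    · rfl
    · exact congrArg _ (congrArg _ (Fin.ext (by omega)))
    · omega
    · omega
    · exact congrArg _ (Fin.ext (by omega))

/-- Refining the lattice follows the splitting rule with `s = w / 4` and with the same `w` on both
levels. -/
lemma wiredWeight_splitEquiv (w : ℝ) (n : ℕ) : ∀ i j, wiredWeight 2 w (n + 1) (splitEquiv n i)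
    (splitEquiv n j) = splitWeight (w / 4) (wiredWeight 2 w n) i j := by
  have h0 : splitEquiv n (.inl none) = none := rfl
  have hl : ∀ k, splitEquiv n (.inl (some k)) = some (leftChild k) := fun _ => rfl
  have hr : ∀ k, splitEquiv n (.inr k) = some (rightChild k) := fun _ => rfl
  rintro ((_ | i) | i) ((_ | j) | j) <;>
    simp only [h0, hl, hr, splitWeight, wiredWeight_some_some, wiredWeight_some_none,
      wiredWeight_none_some, boundaryWeight_succ]
  · rfl
  · rcases eq_or_ne i j with rfl | h
    · simp [latticeWeight_self]
    · rw [latticeWeight_left_left_of_ne w h]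
  · rcases eq_or_ne i j with rfl | h
    · rw [if_pos rfl, latticeWeight_left_right]
    · rw [if_neg h, latticeWeight_left_right_of_ne w h]
  · rcases eq_or_ne i j with rfl | h
    · rw [if_pos rfl, latticeWeight_comm, latticeWeight_left_right]
    · rw [if_neg h, latticeWeight_comm, latticeWeight_left_right_of_ne w h.symm, latticeWeight_comm]
  · rcases eq_or_ne i j with rfl | h
    · simp [latticeWeight_self]
    · rw [latticeWeight_right_right_of_ne w h]

lemma coarseGrain_eq (w : ℝ) (n : ℕ) (β : Vertex (n + 1) → ℝ) :
    coarseGrain 2 w n β = mergeSplit (w / 4) (β ∘ splitEquiv n) := by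
  funext o
  rcases o with _ | k
  · rfl
  · change mergedPotential _ _ _ = mergedPotential _ _ _
    rw [wiredWeight_some_some, latticeWeight_left_right]
    rfl

lemma measurable_coarseGrain (w : ℝ) (n : ℕ) : Measurable (coarseGrain 2 w n) := by
  have : coarseGrain 2 w n = mergeSplit (w / 4) ∘ fun β => β ∘ splitEquiv n :=
    funext fun β => coarseGrain_eq w n β
  rw [this]
  exact (measurable_mergeSplit _).comp (measurable_comp_right _)

/-- The coarse-graining of the `H^{2|2}`-model is the `H^{2|2}`-model. -/
theorem map_coarseGrain {w : ℝ} (hw : 0 < w) (n : ℕ) :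
    (H22Law (wiredWeight 2 w (n + 1))).map (coarseGrain 2 w n) = H22Law (wiredWeight 2 w n) := by
  have h1 : coarseGrain 2 w n = mergeSplit (w / 4) ∘ fun β => β ∘ splitEquiv n :=
    funext fun β => coarseGrain_eq w n β
  rw [h1, ← Measure.map_map (measurable_mergeSplit _) (measurable_comp_right _), H22Law_eq_h22Eta,
    map_comp_equiv_h22Eta (splitEquiv n) (wiredWeight_comm w (n + 1))]
  simp only [wiredWeight_splitEquiv]
  rw [H22Law_eq_h22Eta, ← map_mergeSplit (s := w / 4) (by positivity) (wiredWeight_comm w n)]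
  rfl

theorem exists_isFineGrainingCoupling {w : ℝ} (hw : 0 < w) :
    ∃ P : Measure ((n : ℕ) → Vertex n → ℝ), IsProbabilityMeasure P ∧
      IsFineGrainingCoupling P 2 w fun n x => x n := by
  have := isProbabilityMeasure_H22Law hw
  obtain ⟨P, hP, hlaw, hcoarse⟩ := exists_measure_of_consistent (E := fun n => Vertex n → ℝ)
    (fun n => H22Law (wiredWeight 2 w n)) (fun n => coarseGrain 2 w n)
    (measurable_coarseGrain w) (map_coarseGrain hw)
  refine ⟨P, hP, fun n => measurable_pi_apply n, fun n => ?_, fun n => ?_⟩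
  · rw [hlaw, levelWeight_two]
  · simpa [levelTemperature] using hcoarse n

/-! ### The limits `φ_x` -/

section

variable {Ω : Type*} [MeasurableSpace Ω] {P : Measure Ω} [IsProbabilityMeasure P] {w : ℝ}
  {β : (n : ℕ) → Ω → Vertex n → ℝ}

lemma ae_phiLevel_eq (h : IsFineGrainingCoupling P 2 w β) : ∀ᵐ ω ∂P, ∀ n x,
    phiLevel 2 w β n x ω = extendedField w n (betaLevel β n ω) ⌊2 ^ n * x⌋₊ := by
  filter_upwards [ae_posDef_level h] with ω hω n x
  rw [phiLevel, expULattice_eq (hω n)]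

lemma ae_phi_eq (h : IsFineGrainingCoupling P 2 w β) : ∀ᵐ ω ∂P, ∀ x,
    phi 2 w β x ω = branchLimit w (fun n => betaLevel β n ω) fun n => ⌊2 ^ n * x⌋₊ := by
  filter_upwards [ae_phiLevel_eq h] with ω hω x
  simp only [phi, hω]
  rfl

end

end H22

/-! ### The main theorem -/

theorem mainTheorem9 (ρ Wbar : ℝ) (hρ : 1 < ρ) (hd : spectralDimension ρ = 2) (hW : 0 < Wbar) :
    (∃ (Ω : Type) (_ : MeasurableSpace Ω) (P : Measure Ω) (β : (n : ℕ) → Ω → Vertex n → ℝ),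
      IsProbabilityMeasure P ∧ IsFineGrainingCoupling P ρ Wbar β) ∧
    ∀ {Ω : Type*} [MeasurableSpace Ω] (P : Measure Ω) [IsProbabilityMeasure P]
      (β : (n : ℕ) → Ω → Vertex n → ℝ), IsFineGrainingCoupling P ρ Wbar β →
      -- at every level the fields are invariant in law under the automorphisms of `Λ_n`
      (∀ (n : ℕ) (σ : Equiv.Perm (Fin (2 ^ n))),
        (∀ i j : Fin (2 ^ n), hierDist (σ i) (σ j) = hierDist i j) →
        P.map (fun ω i => betaLevel β n ω (σ i)) = P.map (betaLevel β n) ∧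
        P.map (fun ω i => expULevel ρ Wbar β n ω (σ i)) = P.map (expULevel ρ Wbar β n)) ∧
      -- the `β`-field on the whole lattice exists and is stationary and ergodic
      (∃ (μ : Measure (ℕ → ℝ)), IsProbabilityMeasure μ ∧
        (∀ n : ℕ, μ.map (fun b (i : Fin (2 ^ n)) => b i) = P.map (betaLevel β n)) ∧
        IsStationaryErgodic μ) ∧
      -- the `e^u`-field on the whole lattice exists and is stationary and ergodic
      (∃ (μ : Measure (ℕ → ℝ)) (_ : IsProbabilityMeasure μ),
        TendstoInDistribution (expULattice ρ Wbar β) atTop (id : (ℕ → ℝ) → (ℕ → ℝ))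
          (fun _ => P) μ ∧
        IsStationaryErgodic μ) ∧
      -- existence of the limits `φ_x`
      (∀ x ∈ Set.Ico (0 : ℝ) 1, ∀ᵐ ω ∂P, phi ρ Wbar β x ω < ∞ ∧
        Tendsto (fun n => phiLevel ρ Wbar β n x ω) atTop (𝓝 (phi ρ Wbar β x ω).toReal)) ∧
      -- the zero-one law for the two events
      (NullMeasurableSet {ω | ∀ x ∈ Set.Ico (0 : ℝ) 1, phi ρ Wbar β x ω = 0} P ∧
        (P {ω | ∀ x ∈ Set.Ico (0 : ℝ) 1, phi ρ Wbar β x ω = 0} = 0 ∨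
          P {ω | ∀ x ∈ Set.Ico (0 : ℝ) 1, phi ρ Wbar β x ω = 0} = 1)) ∧
      (NullMeasurableSet {ω | ∀ x ∈ Set.Ico (0 : ℝ) 1, 0 < phi ρ Wbar β x ω} P ∧
        (P {ω | ∀ x ∈ Set.Ico (0 : ℝ) 1, 0 < phi ρ Wbar β x ω} = 0 ∨
          P {ω | ∀ x ∈ Set.Ico (0 : ℝ) 1, 0 < phi ρ Wbar β x ω} = 1)) ∧
      -- the zero-one law for every fixed `x`, with the same alternative for all `x`
      ((∀ x ∈ Set.Ico (0 : ℝ) 1, ∀ᵐ ω ∂P, phi ρ Wbar β x ω = 0) ∨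
        (∀ x ∈ Set.Ico (0 : ℝ) 1, ∀ᵐ ω ∂P, 0 < phi ρ Wbar β x ω)) := by
  obtain rfl := H22.eq_two_of_spectralDimension hρ hd
  obtain ⟨P, hP, hβ⟩ := H22.exists_isFineGrainingCoupling hW
  refine ⟨⟨_, _, P, _, hP, hβ⟩, ?_⟩
  intro Ω _ P _ β h
  have hM := H22.IsFineGrainingCoupling.isMergingFamily hW h
  have hphi := H22.ae_phi_eq h
  have hprob : IsProbabilityMeasure ((H22.latticeLaw hW).map (H22.limitField Wbar)) :=
    Measure.isProbabilityMeasure_map (H22.measurable_limitField Wbar).aemeasurable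
  refine ⟨fun n σ hσ => ⟨H22.map_betaLevel_perm hW h hσ, H22.map_expULevel_perm hW h hσ⟩,
    ⟨H22.latticeLaw hW, inferInstance, fun n => ?_, H22.isStationaryErgodic_latticeLaw hW⟩,
    ⟨(H22.latticeLaw hW).map (H22.limitField Wbar), hprob,
      H22.tendstoInDistribution_expULattice hW h, H22.isStationaryErgodic_limitField hW⟩,
    fun x hx => ?_, ?_, ?_, ?_⟩
  · exact (H22.map_restrictBall_latticeLaw hW n).trans (H22.map_betaLevel hW h n).symm
  · filter_upwards [hphi, H22.ae_phiLevel_eq h, hM.ae_branchLimit hW (H22.isBranch_floor hx)]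
      with ω h1 h2 h3
    simp only [h1, h2]
    exact h3
  -- Whichever alternative holds at fixed points, some random point has a positive limit, so this
  -- event is always null.
  · have h0 : P {ω | ∀ x ∈ Set.Ico (0 : ℝ) 1, phi 2 Wbar β x ω = 0} = 0 := by
      rw [← compl_mem_ae_iff]
      filter_upwards [hphi, hM.ae_exists_pos hW] with ω h1 ⟨x, hx, hpos⟩ h0
      rw [← h1 x, h0 x hx] at hpos
      exact lt_irrefl _ hpos
    exact ⟨NullMeasurableSet.of_null h0, Or.inl h0⟩
  · have h1 := hM.zero_or_one_of_pos hW
    -- `ae_phi_eq` has one null set for all `x`, as the uncountable quantifier requires.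
    have h2 : {ω | (fun n => betaLevel β n ω) ∈ H22.positiveTrees Wbar}
        =ᵐ[P] {ω | ∀ x ∈ Set.Ico (0 : ℝ) 1, 0 < phi 2 Wbar β x ω} := by
      filter_upwards [hphi] with ω hω
      refine propext (forall₂_congr fun x _ => ?_)
      rw [hω x]
    rw [← measure_congr h2]
    exact ⟨h1.1.congr h2, h1.2⟩
  · refine (hM.branchLimit_zero_or_pos hW).imp (fun h0 x hx => ?_) fun h0 x hx => ?_
    · filter_upwards [hphi, h0 _ (H22.isBranch_floor hx)] with ω h1 h2
      rw [h1 x, h2]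
    · filter_upwards [hphi, h0 _ (H22.isBranch_floor hx)] with ω h1 h2
      rwa [h1 x]
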